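/- Let $L,T>0$ and let $\mu,\sigma:(0,L)\to\mathbb R$ be continuous with $\sigma>0$. Put $\mathcal A=\mu\,\partial_x+\tfrac12\sigma^2\partial_x^2$, with scale density $\mathfrak s(x)=\exp\big(-\int_c^x 2\mu/\sigma^2\big)$ and speed density $\mathfrak m(x)=\tfrac{2}{\sigma^2(x)}\exp\big(\int_c^x 2\mu/\sigma^2\big)$, $c\in(0,L)$. With $I_0=\int_0^c\big(\int_0^z\mathfrak s\big)\mathfrak m(z)\,dz$ and $J_0=\int_0^c\big(\int_z^c\mathfrak s\big)\mathfrak m(z)\,dz$, the endpoint $0$ is called regular if $I_0,J_0<\infty$, exit if $I_0<\infty=J_0$, and natural if $I_0=J_0=\infty$ (finiteness does not depend on $c$). Assume that $0$ is regular, exit or natural, and that $L$ is regular, i.e. $\int_c^L\big(\int_z^L\mathfrak s\big)\mathfrak m(z)\,dz<\infty$ and $\int_c^L\big(\int_c^z\mathfrak s\big)\mathfrak m(z)\,dz<\infty$. Call $0$ accessible if it is regular or exit. Let $g:[0,L]\to\mathbb R$ be $C^2$ on $(0,L)$, and let $u$, continuous on $[0,T]\times[0,L]$ and $C^{1,2}$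 on $(0,T)\times(0,L)$, be a classical solution of $$(\partial_t+\mathcal A-x)u=0,\quad u(T,x)=g(x),\quad u(t,L)=e^{-L(T-t)}g(L),\quad u(t,0)=g(0)\ \text{ if } 0 \text{ is accessible}.$$ Let $f\in C^2((0,L))$ satisfy $\tfrac12\sigma^2(f')^2-\mathcal Af-x=0$ on $(0,L)$, and let $f$ be continuous (with finite values) on $(0,L]$, and on $[0,L]$ if $0$ is accessible. Put $\tilde{\mathcal A}=(\mu-\sigma^2f')\partial_x+\tfrac12\sigma^2\partial_x^2$. Let $\tilde\Gamma(t,x;s,y)\ge 0$ ($0\le t<s\le T$, $x\in[0,L]$, $y\in(0,L)$) be a fundamental solution of $\partial_t+\tilde{\mathcal A}$ with Dirichlet conditions at the accessible endpoints, that is: for fixed $(s,y)$ it is continuous on $[0,s)\times[0,L]$, is $C^{1,2}$ on $(0,s)\times(0,L)$, satisfies $(\partial_t+\tilde{\mathcal A})\tilde\Gamma=0$ there, and vanishes at $x=L$ and, if $0$ is accessible, at $x=0$; it is locally integrable in $y\in(0,L)$; and $\tilde\Gamma(s,\cdot\,;s,y)=\delta_y$ in the sense that, for every continuous $\varphi$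 with compact support in $(0,L)$, the function equal to $\int_0^L\tilde\Gamma(t,x;s,y)\varphi(y)\,dy$ for $t<s$ and to $\varphi(x)$ for $t=s$ is continuous on $[0,s]\times[0,L]$, is $C^{1,2}$ on $(0,s)\times(0,L)$, satisfies $(\partial_t+\tilde{\mathcal A})v=0$ there, and satisfies the same Dirichlet conditions. Then for every $t\in[0,T]$ and every $x\in(0,L]$ (and also $x=0$ if $0$ is accessible) for which the double integral below converges absolutely, $$u(t,x)=e^{-x(T-t)}g(x)+e^{-f(x)}\int_t^T\!\!\int_0^L\tilde\Gamma(t,x;s,\xi)\,(\partial_s+\tilde{\mathcal A})\big[e^{-\xi(T-s)+f(\xi)}g(\xi)\big]\,d\xi\,ds .$$ -/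

import Mathlib

open Set MeasureTheory

noncomputable section

namespace ShortRate

/-- The differential operator `b(x) ∂ₓ + ½ σ(x)² ∂ₓ²`. -/
def generator (b σ : ℝ → ℝ) (φ : ℝ → ℝ) (x : ℝ) : ℝ :=
  b x * deriv φ x + 1 / 2 * σ x ^ 2 * deriv (deriv φ) x

/-- Scale density (normalised at `c`) of the diffusion with drift `b` and volatility `σ`. -/
def scaleDensity (b σ : ℝ → ℝ) (c x : ℝ) : ℝ :=
  Real.exp (-∫ y in c..x, 2 * b y / σ y ^ 2)

/-- Speed density (normalised at `c`) of the diffusion with drift `b` and volatility `σ`. -/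
def speedDensity (b σ : ℝ → ℝ) (c x : ℝ) : ℝ :=
  2 / σ x ^ 2 * Real.exp (∫ y in c..x, 2 * b y / σ y ^ 2)

/-- Scale measure of the interval with endpoints `x ≤ y` (possibly infinite). -/
def scaleMeasure (b σ : ℝ → ℝ) (c x y : ℝ) : ENNReal :=
  ∫⁻ z in Ioo x y, ENNReal.ofReal (scaleDensity b σ c z)

/-- `∫₀ᶜ S(0,z] m(z) dz`. -/
def fellerI0 (b σ : ℝ → ℝ) (c : ℝ) : ENNReal :=
  ∫⁻ z in Ioo 0 c, scaleMeasure b σ c 0 z * ENNReal.ofReal (speedDensity b σ c z)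

/-- `∫₀ᶜ S[z,c] m(z) dz`. -/
def fellerJ0 (b σ : ℝ → ℝ) (c : ℝ) : ENNReal :=
  ∫⁻ z in Ioo 0 c, scaleMeasure b σ c z c * ENNReal.ofReal (speedDensity b σ c z)

/-- `∫_c^L S[z,L) m(z) dz`. -/
def fellerIL (b σ : ℝ → ℝ) (c L : ℝ) : ENNReal :=
  ∫⁻ z in Ioo c L, scaleMeasure b σ c z L * ENNReal.ofReal (speedDensity b σ c z)

/-- `∫_c^L S[c,z] m(z) dz`. -/
def fellerJL (b σ : ℝ → ℝ) (c L : ℝ) : ENNReal :=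
  ∫⁻ z in Ioo c L, scaleMeasure b σ c c z * ENNReal.ofReal (speedDensity b σ c z)

/-! Feller's boundary classification for the diffusion on `(0, L)`. Finiteness of the integrals does
not depend on the interior reference point, which is taken to be the midpoint. -/

def ZeroIsRegular (b σ : ℝ → ℝ) (L : ℝ) : Prop :=
  fellerI0 b σ (L / 2) < ⊤ ∧ fellerJ0 b σ (L / 2) < ⊤

def ZeroIsExit (b σ : ℝ → ℝ) (L : ℝ) : Prop :=
  fellerI0 b σ (L / 2) < ⊤ ∧ fellerJ0 b σ (L / 2) = ⊤

def ZeroIsNatural (b σ : ℝ → ℝ) (L : ℝ) : Prop :=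
  fellerI0 b σ (L / 2) = ⊤ ∧ fellerJ0 b σ (L / 2) = ⊤

def RightIsRegular (b σ : ℝ → ℝ) (L : ℝ) : Prop :=
  fellerIL b σ (L / 2) L < ⊤ ∧ fellerJL b σ (L / 2) L < ⊤

/-- `v` is of class `C^{1,2}` on `(0,S) × (0,L)` (first argument: time) and satisfies
`∂ₜ v + b ∂ₓ v + ½ σ² ∂ₓ² v - k v = 0` there. -/
structure SolvesBackwardPDE (L S : ℝ) (b σ k : ℝ → ℝ) (v : ℝ → ℝ → ℝ) : Prop where
  diff_time : ∀ t ∈ Ioo 0 S, ∀ x ∈ Ioo 0 L, DifferentiableAt ℝ (fun r => v r x) t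
  diff_space : ∀ t ∈ Ioo 0 S, ∀ x ∈ Ioo 0 L, DifferentiableAt ℝ (v t) x
  diff_space_two : ∀ t ∈ Ioo 0 S, ∀ x ∈ Ioo 0 L, DifferentiableAt ℝ (deriv (v t)) x
  cont_time :
    ContinuousOn (fun p : ℝ × ℝ => deriv (fun r => v r p.2) p.1) (Ioo 0 S ×ˢ Ioo 0 L)
  cont_space :
    ContinuousOn (fun p : ℝ × ℝ => deriv (v p.1) p.2) (Ioo 0 S ×ˢ Ioo 0 L)
  cont_space_two :
    ContinuousOn (fun p : ℝ × ℝ => deriv (deriv (v p.1)) p.2) (Ioo 0 S ×ˢ Ioo 0 L)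
  pde : ∀ t ∈ Ioo 0 S, ∀ x ∈ Ioo 0 L,
    deriv (fun r => v r x) t + generator b σ (v t) x - k x * v t x = 0

/-- `v` is a classical solution on `[0,S] × [0,L]` of the terminal-boundary value problem
`(∂ₜ + b ∂ₓ + ½ σ² ∂ₓ² - k) v = 0`, `v(S,·) = φ`, `v(·,L) = βL`, and, if `acc` holds,
`v(·,0) = β0`. -/
structure IsClassicalSolution (acc : Prop) (L S : ℝ) (b σ k φ β0 βL : ℝ → ℝ)
    (v : ℝ → ℝ → ℝ) : Prop where
  continuousOn : ContinuousOn (fun p : ℝ × ℝ => v p.1 p.2) (Icc 0 S ×ˢ Icc 0 L)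
  solves : SolvesBackwardPDE L S b σ k v
  terminal : ∀ x ∈ Icc 0 L, v S x = φ x
  bc_zero : acc → ∀ t ∈ Icc 0 S, v t 0 = β0 t
  bc_right : ∀ t ∈ Icc 0 S, v t L = βL t

/-- The pricing Cauchy problem for a payoff `g` at maturity `T`, with discounting at rate `x`. -/
def SolvesPricingProblem (L T : ℝ) (μ σ g : ℝ → ℝ) (u : ℝ → ℝ → ℝ) : Prop :=
  IsClassicalSolution (ZeroIsRegular μ σ L ∨ ZeroIsExit μ σ L) L T μ σ (fun x => x) g
    (fun _ => g 0) (fun t => Real.exp (-L * (T - t)) * g L) u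

/-- `Γ t x s y` is a fundamental solution of `∂ₜ + b ∂ₓ + ½ σ² ∂ₓ²` on `(0,L)` for terminal times
`s ∈ (0,T]`, with a Dirichlet condition at `L` and, if `acc` holds, at `0`.
For fixed `(s,y)` it is a nonnegative classical solution for `t < s`. The terminal condition
`Γ(s,·;s,y) = δ_y` has the usual meaning: for every continuous `φ` with compact support in
`(0,L)`, the function `∫ Γ(t,x;s,y) φ(y) dy` is the classical solution with terminal value `φ`
at time `s`. -/
structure IsFundamentalSolution (acc : Prop) (L T : ℝ) (b σ : ℝ → ℝ)
    (Γ : ℝ → ℝ → ℝ → ℝ → ℝ) : Prop where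
  nonneg : ∀ s ∈ Ioc 0 T, ∀ t ∈ Ico 0 s, ∀ x ∈ Icc 0 L, ∀ y ∈ Ioo 0 L, 0 ≤ Γ t x s y
  continuousOn : ∀ s ∈ Ioc 0 T, ∀ y ∈ Ioo 0 L,
    ContinuousOn (fun p : ℝ × ℝ => Γ p.1 p.2 s y) (Ico 0 s ×ˢ Icc 0 L)
  solves : ∀ s ∈ Ioc 0 T, ∀ y ∈ Ioo 0 L,
    SolvesBackwardPDE L s b σ (fun _ => 0) (fun t x => Γ t x s y)
  bc_zero : acc → ∀ s ∈ Ioc 0 T, ∀ y ∈ Ioo 0 L, ∀ t ∈ Ico 0 s, Γ t 0 s y = 0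
  bc_right : ∀ s ∈ Ioc 0 T, ∀ y ∈ Ioo 0 L, ∀ t ∈ Ico 0 s, Γ t L s y = 0
  locallyIntegrable : ∀ s ∈ Ioc 0 T, ∀ t ∈ Ico 0 s, ∀ x ∈ Icc 0 L,
    LocallyIntegrableOn (fun y => Γ t x s y) (Ioo 0 L)
  terminal : ∀ s ∈ Ioc 0 T, ∀ φ : ℝ → ℝ, Continuous φ → HasCompactSupport φ →
    tsupport φ ⊆ Ioo 0 L →
    IsClassicalSolution acc L s b σ (fun _ => 0) φ (fun _ => 0) (fun _ => 0)
      (fun t x => if t < s then ∫ y in 0..L, Γ t x s y * φ y else φ x)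

/-- The drift `μ - σ² f'`. -/
def tiltedDrift (μ σ f : ℝ → ℝ) (x : ℝ) : ℝ := μ x - σ x ^ 2 * deriv f x

/-- `(∂ₛ + Ã) [e^{-ξ(T-s) + f(ξ)} g(ξ)]`, where `Ã = (μ - σ² f') ∂ₓ + ½ σ² ∂ₓ²`. -/
def source (T : ℝ) (μ σ f g : ℝ → ℝ) (s ξ : ℝ) : ℝ :=
  deriv (fun r => Real.exp (-ξ * (T - r) + f ξ) * g ξ) s +
    generator (tiltedDrift μ σ f) σ (fun y => Real.exp (-y * (T - s) + f y) * g y) ξ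

end ShortRate

end

open Set MeasureTheory

noncomputable section

namespace ShortRate

/-! The equation for `f` says that conjugation by `e^f` turns `𝒜 - x` into `Ã`; equivalently, `ψ =
e^{-f}` solves `𝒜ψ = xψ`. Hence `w = e^f (u - e^{-x(T-t)} g)` (`excess`) satisfies `(∂ₜ + Ã) w =
-source` with zero terminal value and zero values at `L` and at an accessible `0`. The theorem is
Duhamel's formula for `w`.

The dependence of the kernel on `(s, y)` is controlled only through its sign, its local
integrability in `y` and its action on test functions, so Duhamel's formula is obtained by
comparison rather than by differentiating under the integral. The coefficients do not depend on
time, so by uniqueness the evolution of a test function from terminal time `s` is a time shift of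
the one from `T` (`evolve_eq_evolve_add`). Thus the potential of a source `e^{-ks} φ(x)` is a time
integral of one classical solution and can be differentiated by hand. By Stone–Weierstrass, sums of
such sources approximate any continuous compactly supported one. Comparing `w` with these potentials
gives `w ≤ ∫∫ Γ F` (`le_integral`), where `F` is the source; applied to `-w` this gives equality.

The other difficulty is a natural endpoint `0`, where no boundary condition is given and `w` may be
as large as a multiple of `e^f`. The comparison principle then needs a barrier `Φ ≥ 0` with `ÃΦ ≤ Φ`
such that both `Φ` and `Φ e^{-f}` tend to infinity at `0` (`exists_isBarrier_of_zeroIsNatural`). If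
`ψ` is bounded near `0`, take `e^f (1 + v)` with `v` the scale potential of the original diffusion,
which diverges because `I₀ = ∞`. Otherwise `ψ` increases to infinity at `0`, and `1 + v` works with
`v` the scale potential of the tilted diffusion; its divergence
(`tendsto_atTop_of_transformed_potential`) is where `J₀ = ∞` enters. At an accessible endpoint the
zero barrier suffices. -/

open Filter Topology

/-! ### Pointwise calculus of the parabolic operator. -/

/-- At the point `(t, x)` the function `q` has a time derivative and two space derivatives, and
`∂ₜ q + b ∂ₓ q + ½ σ² ∂ₓ² q = ℓ` there. -/
def HasParabolicAt (b σ : ℝ → ℝ) (q : ℝ → ℝ → ℝ) (t x ℓ : ℝ) : Prop :=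
  ∃ (qt : ℝ) (D : ℝ → ℝ) (d : ℝ), HasDerivAt (fun r => q r x) qt t ∧
    (∀ᶠ y in 𝓝 x, HasDerivAt (q t) (D y) y) ∧ HasDerivAt D d x ∧
    ℓ = qt + (b x * D x + 1 / 2 * σ x ^ 2 * d)

namespace HasParabolicAt

variable {b σ : ℝ → ℝ} {p q : ℝ → ℝ → ℝ} {t x ℓ ℓ' : ℝ}

theorem add (hp : HasParabolicAt b σ p t x ℓ) (hq : HasParabolicAt b σ q t x ℓ') :
    HasParabolicAt b σ (fun r y => p r y + q r y) t x (ℓ + ℓ') := by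
  obtain ⟨a, D, d, h1, h2, h3, h4⟩ := hp
  obtain ⟨a', D', d', h1', h2', h3', h4'⟩ := hq
  refine ⟨a + a', fun y => D y + D' y, d + d', h1.add h1', ?_, h3.add h3', ?_⟩
  · filter_upwards [h2, h2'] with y hy hy' using hy.add hy'
  · rw [h4, h4']; ring

theorem const_mul (c : ℝ) (hp : HasParabolicAt b σ p t x ℓ) :
    HasParabolicAt b σ (fun r y => c * p r y) t x (c * ℓ) := by
  obtain ⟨a, D, d, h1, h2, h3, h4⟩ := hp
  refine ⟨c * a, fun y => c * D y, c * d, h1.const_mul c, ?_, h3.const_mul c, ?_⟩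
  · filter_upwards [h2] with y hy using hy.const_mul c
  · rw [h4]; ring

theorem neg (hp : HasParabolicAt b σ p t x ℓ) :
    HasParabolicAt b σ (fun r y => -p r y) t x (-ℓ) := by
  simpa using hp.const_mul (-1)

theorem sub (hp : HasParabolicAt b σ p t x ℓ) (hq : HasParabolicAt b σ q t x ℓ') :
    HasParabolicAt b σ (fun r y => p r y - q r y) t x (ℓ - ℓ') := by
  simpa [sub_eq_add_neg] using hp.add hq.neg

theorem of_time {c : ℝ → ℝ} {c' : ℝ} (hc : HasDerivAt c c' t) :
    HasParabolicAt b σ (fun r _ => c r) t x c' :=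
  ⟨c', fun _ => 0, 0, hc, Eventually.of_forall fun y => hasDerivAt_const y _,
    hasDerivAt_const x _, by ring⟩

theorem sum {ι : Type*} (s : Finset ι) {p : ι → ℝ → ℝ → ℝ} {ℓ : ι → ℝ}
    (hp : ∀ i ∈ s, HasParabolicAt b σ (p i) t x (ℓ i)) :
    HasParabolicAt b σ (fun r y => ∑ i ∈ s, p i r y) t x (∑ i ∈ s, ℓ i) := by
  classical
  induction s using Finset.induction_on with
  | empty => simpa using of_time (hasDerivAt_const t (0 : ℝ))
  | insert i s hi ih =>
    simp only [Finset.sum_insert hi]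
    exact (hp i (by simp)).add (ih fun j hj => hp j (by simp [hj]))

theorem comp_add_const {s : ℝ} (hp : HasParabolicAt b σ p (t + s) x ℓ) :
    HasParabolicAt b σ (fun r y => p (r + s) y) t x ℓ := by
  obtain ⟨a, D, d, h1, h2, h3, h4⟩ := hp
  exact ⟨a, D, d, h1.comp_add_const t s, h2, h3, h4⟩

end HasParabolicAt

/-- `φ` is twice differentiable at `x` and `b φ' + ½ σ² φ'' = ℓ` there. -/
def HasGeneratorAt (b σ φ : ℝ → ℝ) (x ℓ : ℝ) : Prop :=
  ∃ (D : ℝ → ℝ) (d : ℝ), (∀ᶠ y in 𝓝 x, HasDerivAt φ (D y) y) ∧ HasDerivAt D d x ∧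
    ℓ = b x * D x + 1 / 2 * σ x ^ 2 * d

theorem HasGeneratorAt.generator_eq {b σ φ : ℝ → ℝ} {x ℓ : ℝ} (h : HasGeneratorAt b σ φ x ℓ) :
    generator b σ φ x = ℓ := by
  obtain ⟨D, d, h1, h2, h3⟩ := h
  have e : deriv φ =ᶠ[𝓝 x] D := h1.mono fun y hy => hy.deriv
  rw [generator, e.eq_of_nhds, e.deriv_eq, h2.deriv, h3]

theorem HasGeneratorAt.const_add {b σ φ : ℝ → ℝ} {x ℓ : ℝ} (h : HasGeneratorAt b σ φ x ℓ)
    (c : ℝ) : HasGeneratorAt b σ (fun y => c + φ y) x ℓ := by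
  obtain ⟨D, d, h1, h2, h3⟩ := h
  exact ⟨D, d, h1.mono fun y hy => hy.const_add c, h2, h3⟩

theorem HasGeneratorAt.mul_time {b σ φ c : ℝ → ℝ} {t x ℓ c' : ℝ} (h : HasGeneratorAt b σ φ x ℓ)
    (hc : HasDerivAt c c' t) :
    HasParabolicAt b σ (fun r y => c r * φ y) t x (c' * φ x + c t * ℓ) := by
  obtain ⟨D, d, h1, h2, h3⟩ := h
  refine ⟨c' * φ x, fun y => c t * D y, c t * d, hc.mul_const _, ?_, h2.const_mul _, ?_⟩
  · filter_upwards [h1] with y hy using hy.const_mul _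
  · rw [h3]; ring

theorem SolvesBackwardPDE.hasParabolicAt {L S : ℝ} {b σ : ℝ → ℝ} {v : ℝ → ℝ → ℝ} {k : ℝ → ℝ}
    (hv : SolvesBackwardPDE L S b σ k v) {t x : ℝ} (ht : t ∈ Ioo 0 S) (hx : x ∈ Ioo 0 L) :
    HasParabolicAt b σ v t x (k x * v t x) := by
  refine ⟨_, deriv (v t), _, (hv.diff_time t ht x hx).hasDerivAt, ?_,
    (hv.diff_space_two t ht x hx).hasDerivAt, ?_⟩
  · filter_upwards [isOpen_Ioo.mem_nhds hx] with y hy using (hv.diff_space t ht y hy).hasDerivAt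
  · have := hv.pde t ht x hx
    unfold generator at this
    linarith

/-! ### Minimum principle on rectangles. -/

/-- If `d < 0`, the second derivative test makes `x` a local maximum too, so `φ` is locally constant
and `d = 0`. -/
theorem second_deriv_nonneg_of_isLocalMin {φ D : ℝ → ℝ} {x d : ℝ}
    (hφ : ∀ᶠ y in 𝓝 x, HasDerivAt φ (D y) y) (hD : HasDerivAt D d x) (hmin : IsLocalMin φ x) :
    0 ≤ d := by
  by_contra! hd
  have e : deriv φ =ᶠ[𝓝 x] D := hφ.mono fun y hy => hy.deriv
  have h0 : deriv φ x = 0 := hmin.deriv_eq_zero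
  have hmax : IsLocalMax φ x := isLocalMax_of_deriv_deriv_neg
    (by rw [e.deriv_eq, hD.deriv]; exact hd) h0 hφ.self_of_nhds.continuousAt
  have hc : φ =ᶠ[𝓝 x] fun _ => φ x := by
    filter_upwards [hmin, hmax] with y h1 h2 using le_antisymm h2 h1
  have hD0 : D =ᶠ[𝓝 x] fun _ => 0 := by
    filter_upwards [hc.eventuallyEq_nhds, e] with y h1 h2
    rw [← h2, h1.deriv_eq, deriv_const]
  have := hD.deriv
  rw [hD0.deriv_eq, deriv_const] at this
  linarith

/-- Only later times are compared, because the minimum over a rectangle may lie on its initial face.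
-/
theorem deriv_nonneg_of_forall_right {φ : ℝ → ℝ} {t S d : ℝ} (htS : t < S)
    (hφ : HasDerivAt φ d t) (hmin : ∀ r ∈ Ioo t S, φ t ≤ φ r) : 0 ≤ d := by
  have h := (hasDerivAt_iff_tendsto_slope.1 hφ).mono_left
    (nhdsWithin_mono t (s := Ioi t) fun y hy => ne_of_gt hy)
  refine ge_of_tendsto h ?_
  filter_upwards [Ioo_mem_nhdsGT htS] with r hr
  rw [slope_def_field]
  exact div_nonneg (sub_nonneg.2 (hmin r hr)) (sub_pos.2 hr.1).le

/-- Minimum principle on a compact rectangle. -/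
theorem nonneg_of_hasParabolicAt_nonpos {b σ : ℝ → ℝ} {q : ℝ → ℝ → ℝ} {S₀ S l r : ℝ}
    (hcont : ContinuousOn (fun p : ℝ × ℝ => q p.1 p.2) (Icc S₀ S ×ˢ Icc l r))
    (hpar : ∀ t ∈ Ioo S₀ S, ∀ x ∈ Ioo l r, ∃ ℓ ≤ 0, HasParabolicAt b σ q t x ℓ)
    (hterm : ∀ x ∈ Icc l r, 0 ≤ q S x) (hleft : ∀ t ∈ Icc S₀ S, 0 ≤ q t l)
    (hright : ∀ t ∈ Icc S₀ S, 0 ≤ q t r) :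
    ∀ t ∈ Icc S₀ S, ∀ x ∈ Icc l r, 0 ≤ q t x := by
  -- The equation is known only for `t > S₀`; the initial time is recovered by continuity at the
  -- end.
  have key : ∀ t ∈ Ioc S₀ S, ∀ x ∈ Icc l r, 0 ≤ q t x := by
    intro t₁ ht₁ x₁ hx₁
    by_contra! hneg
    -- Adding `η (S - t)` makes the principle strict: at a negative minimum the operator applied to
    -- `q` would be at least `η > 0`.
    obtain ⟨η, hη, hη'⟩ : ∃ η > 0, q t₁ x₁ + η * (S - t₁) < 0 := by
      have hpos : 0 < S - t₁ + 1 := by linarith [ht₁.2]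
      refine ⟨-q t₁ x₁ / (S - t₁ + 1), div_pos (by linarith) hpos, ?_⟩
      have : -q t₁ x₁ / (S - t₁ + 1) * (S - t₁) < -q t₁ x₁ := by
        rw [div_mul_eq_mul_div, div_lt_iff₀ hpos]; nlinarith
      linarith
    have hsub : Icc t₁ S ×ˢ Icc l r ⊆ Icc S₀ S ×ˢ Icc l r :=
      prod_mono (Icc_subset_Icc_left ht₁.1.le) Subset.rfl
    have hc : ContinuousOn (fun p : ℝ × ℝ => q p.1 p.2 + η * (S - p.1)) (Icc t₁ S ×ˢ Icc l r) :=
      (hcont.mono hsub).add (by fun_prop)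
    obtain ⟨⟨t, x⟩, ⟨ht, hx⟩, hmin⟩ := (isCompact_Icc.prod isCompact_Icc).exists_isMinOn
      ⟨(t₁, x₁), ⟨left_mem_Icc.2 ht₁.2, hx₁⟩⟩ hc
    have hle : ∀ t' ∈ Icc t₁ S, ∀ x' ∈ Icc l r,
        q t x + η * (S - t) ≤ q t' x' + η * (S - t') :=
      fun t' ht' x' hx' => hmin (⟨ht', hx'⟩ : (t', x') ∈ Icc t₁ S ×ˢ Icc l r)
    simp only at ht hx
    have hlt : q t x + η * (S - t) < 0 := (hle t₁ (left_mem_Icc.2 ht₁.2) x₁ hx₁).trans_lt hη'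
    have hqt : q t x < 0 := by nlinarith [ht.2]
    have htS : t < S := lt_of_le_of_ne ht.2 fun h => by
      subst h; exact absurd (hterm x hx) (not_le.2 hqt)
    have ht' : t ∈ Icc S₀ S := ⟨ht₁.1.le.trans ht.1, ht.2⟩
    have hxl : l < x := lt_of_le_of_ne hx.1 fun h => by
      subst h; exact absurd (hleft t ht') (not_le.2 hqt)
    have hxr : x < r := lt_of_le_of_ne hx.2 fun h => by
      subst h; exact absurd (hright t ht') (not_le.2 hqt)
    obtain ⟨ℓ, hℓ, qt, D, d, h1, h2, h3, h4⟩ := hpar t ⟨ht₁.1.trans_le ht.1, htS⟩ x ⟨hxl, hxr⟩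
    have hloc : IsLocalMin (q t) x := by
      filter_upwards [Icc_mem_nhds hxl hxr] with y hy
      linarith [hle t ht y hy]
    have hD : D x = 0 := by
      rw [← h2.self_of_nhds.deriv]; exact hloc.deriv_eq_zero
    have hd : 0 ≤ d := second_deriv_nonneg_of_isLocalMin h2 h3 hloc
    have htime : 0 ≤ qt + η * (0 - 1) :=
      deriv_nonneg_of_forall_right htS
        (h1.add (((hasDerivAt_const t S).sub (hasDerivAt_id t)).const_mul η))
        fun s hs => hle s ⟨ht.1.trans hs.1.le, hs.2.le⟩ x hx
    rw [hD] at h4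
    have : 0 ≤ 1 / 2 * σ x ^ 2 * d := by positivity
    linarith
  intro t ht x hx
  rcases ht.1.eq_or_lt with h | h
  · subst h
    rcases ht.2.eq_or_lt with h' | h'
    · rw [h']; exact hterm x hx
    · have hc : ContinuousWithinAt (fun s => q s x) (Ioc S₀ S) S₀ := by
        have := hcont.comp (f := fun s : ℝ => (s, x)) (s := Icc S₀ S) (by fun_prop)
          fun s hs => ⟨hs, hx⟩
        exact (this S₀ ht).mono Ioc_subset_Icc_self
      have hne : (𝓝[Ioc S₀ S] S₀).NeBot := by
        rw [nhdsWithin_Ioc_eq_nhdsGT h']; infer_instance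
      exact ge_of_tendsto hc (eventually_mem_nhdsWithin.mono fun s hs => key s hs x hx)
  · exact key t ⟨h, ht.2⟩ x hx

/-! ### Barriers and comparison on the whole strip. -/

/-- A nonnegative function on `(0, L)` with `b Φ' + ½ σ² Φ'' ≤ Φ`. -/
structure IsBarrier (L : ℝ) (b σ Φ : ℝ → ℝ) : Prop where
  nonneg : ∀ x ∈ Ioo 0 L, 0 ≤ Φ x
  gen : ∀ x ∈ Ioo 0 L, ∃ ℓ ≤ Φ x, HasGeneratorAt b σ Φ x ℓ

theorem IsBarrier.continuousOn {L : ℝ} {b σ Φ : ℝ → ℝ} (h : IsBarrier L b σ Φ) :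
    ContinuousOn Φ (Ioo 0 L) := fun x hx => by
  obtain ⟨ℓ, -, D, d, h1, -⟩ := h.gen x hx
  exact h1.self_of_nhds.continuousAt.continuousWithinAt

theorem isBarrier_zero (L : ℝ) (b σ : ℝ → ℝ) : IsBarrier L b σ fun _ => 0 where
  nonneg _ _ := le_rfl
  gen x _ := ⟨0, le_rfl, fun _ => 0, 0, Eventually.of_forall fun y => hasDerivAt_const y _,
    hasDerivAt_const x _, by ring⟩

/-- The time derivative of `e^{S-r}` contributes `-e^{S-r} Φ`, which absorbs `b Φ' + ½ σ² Φ'' ≤ Φ`: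
the result is a supersolution. -/
theorem IsBarrier.exists_hasParabolicAt {L : ℝ} {b σ Φ : ℝ → ℝ} (h : IsBarrier L b σ Φ)
    {S κ t x : ℝ} (hκ : 0 ≤ κ) (hx : x ∈ Ioo 0 L) :
    ∃ ℓ ≤ 0, HasParabolicAt b σ (fun r y => κ * (1 + Real.exp (S - r) * Φ y)) t x ℓ := by
  obtain ⟨ℓ, hℓ, hg⟩ := h.gen x hx
  have hexp : HasDerivAt (fun r => Real.exp (S - r)) (Real.exp (S - t) * -1) t := by
    simpa using ((hasDerivAt_id t).const_sub S).exp
  refine ⟨_, ?_, ((HasParabolicAt.of_time (hasDerivAt_const t (1 : ℝ))).add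
    (hg.mul_time hexp)).const_mul κ⟩
  have : Real.exp (S - t) * ℓ ≤ Real.exp (S - t) * Φ x := by gcongr
  have h2 : 0 + (Real.exp (S - t) * -1 * Φ x + Real.exp (S - t) * ℓ) ≤ 0 := by linarith
  exact mul_nonpos_of_nonneg_of_nonpos hκ h2

/-- `k` is small near `x = L` and small compared with `1 + Φ` near `x = 0`, uniformly in time. -/
def NegligibleAtBoundary (L S : ℝ) (Φ : ℝ → ℝ) (k : ℝ → ℝ → ℝ) : Prop :=
  ∀ κ > 0, ∃ δ > 0, ∀ t ∈ Icc 0 S, ∀ x ∈ Ioo 0 L,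
    (x < δ → |k t x| ≤ κ * (1 + Φ x)) ∧ (L - δ < x → |k t x| ≤ κ)

namespace NegligibleAtBoundary

variable {L S : ℝ} {Φ : ℝ → ℝ} {k k' : ℝ → ℝ → ℝ}

theorem add (h : NegligibleAtBoundary L S Φ k) (h' : NegligibleAtBoundary L S Φ k') :
    NegligibleAtBoundary L S Φ fun t x => k t x + k' t x := by
  intro κ hκ
  obtain ⟨δ, hδ, H⟩ := h (κ / 2) (half_pos hκ)
  obtain ⟨δ', hδ', H'⟩ := h' (κ / 2) (half_pos hκ)
  refine ⟨min δ δ', lt_min hδ hδ', fun t ht x hx => ⟨fun h1 => ?_, fun h1 => ?_⟩⟩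
  · have a1 := (H t ht x hx).1 (h1.trans_le (min_le_left _ _))
    have a2 := (H' t ht x hx).1 (h1.trans_le (min_le_right _ _))
    have := abs_add_le (k t x) (k' t x)
    linarith
  · have a1 := (H t ht x hx).2 (by linarith [min_le_left δ δ'])
    have a2 := (H' t ht x hx).2 (by linarith [min_le_right δ δ'])
    have := abs_add_le (k t x) (k' t x)
    linarith

theorem const_mul (c : ℝ) (h : NegligibleAtBoundary L S Φ k) :
    NegligibleAtBoundary L S Φ fun t x => c * k t x := by
  intro κ hκ
  have hc : 0 < |c| + 1 := by positivity
  obtain ⟨δ, hδ, H⟩ := h (κ / (|c| + 1)) (by positivity)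
  have key : ∀ a y, |y| ≤ κ / (|c| + 1) * a → |c * y| ≤ κ * a := fun a y hy => by
    rw [abs_mul]
    calc |c| * |y| ≤ (|c| + 1) * |y| := by gcongr; linarith
      _ ≤ (|c| + 1) * (κ / (|c| + 1) * a) := by gcongr
      _ = κ * a := by field_simp
  refine ⟨δ, hδ, fun t ht x hx => ⟨fun h1 => key _ _ ((H t ht x hx).1 h1), fun h1 => ?_⟩⟩
  simpa using key 1 (k t x) (by simpa using (H t ht x hx).2 h1)

theorem neg (h : NegligibleAtBoundary L S Φ k) :
    NegligibleAtBoundary L S Φ fun t x => -k t x := by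
  simpa using h.const_mul (-1)

theorem sub (h : NegligibleAtBoundary L S Φ k) (h' : NegligibleAtBoundary L S Φ k') :
    NegligibleAtBoundary L S Φ fun t x => k t x - k' t x := by
  simpa [sub_eq_add_neg] using h.add h'.neg

theorem comp_add_const {S' s : ℝ} (hs : 0 ≤ s) (hS : S + s ≤ S')
    (h : NegligibleAtBoundary L S' Φ k) :
    NegligibleAtBoundary L S Φ fun t x => k (t + s) x := by
  intro κ hκ
  obtain ⟨δ, hδ, H⟩ := h κ hκ
  exact ⟨δ, hδ, fun t ht x hx => H (t + s) ⟨by linarith [ht.1], by linarith [ht.2]⟩ x hx⟩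

end NegligibleAtBoundary

/-- Comparison principle on the whole strip. -/
theorem nonneg_of_boundary_lower_bound {L S : ℝ} {b σ Φ : ℝ → ℝ} {q : ℝ → ℝ → ℝ}
    (hΦ : IsBarrier L b σ Φ)
    (hcont : ContinuousOn (fun p : ℝ × ℝ => q p.1 p.2) (Icc 0 S ×ˢ Ioo 0 L))
    (hpar : ∀ t ∈ Ioo 0 S, ∀ x ∈ Ioo 0 L, ∃ ℓ ≤ 0, HasParabolicAt b σ q t x ℓ)
    (hterm : ∀ x ∈ Ioo 0 L, 0 ≤ q S x)
    (hbd : ∀ κ > 0, ∃ δ > 0, ∀ t ∈ Icc 0 S, ∀ x ∈ Ioo 0 L,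
      (x < δ → -(κ * (1 + Φ x)) ≤ q t x) ∧ (L - δ < x → -κ ≤ q t x)) :
    ∀ t ∈ Icc 0 S, ∀ x ∈ Ioo 0 L, 0 ≤ q t x := by
  intro t ht x hx
  have key : ∀ κ > 0, 0 ≤ q t x + κ * (1 + Real.exp (S - t) * Φ x) := by
    intro κ hκ
    obtain ⟨δ, hδ, H⟩ := hbd κ hκ
    -- The rectangle reaches far enough into both boundary layers for the added supersolution to
    -- dominate the boundary error on its sides.
    obtain ⟨l, hl0, hl⟩ : ∃ l, 0 < l ∧ l < min δ x := exists_between (lt_min hδ hx.1)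
    obtain ⟨r, hr, hrL⟩ : ∃ r, max (L - δ) x < r ∧ r < L :=
      exists_between (max_lt (by linarith) hx.2)
    have hlx : l < x := hl.trans_le (min_le_right _ _)
    have hxr : x < r := (le_max_right _ _).trans_lt hr
    have hsub : Icc l r ⊆ Ioo 0 L := fun y hy => ⟨hl0.trans_le hy.1, hy.2.trans_lt hrL⟩
    have hlm : l ∈ Ioo 0 L := hsub (left_mem_Icc.2 (hlx.trans hxr).le)
    have hrm : r ∈ Ioo 0 L := hsub (right_mem_Icc.2 (hlx.trans hxr).le)
    have hexp : ∀ s ∈ Icc 0 S, ∀ y ∈ Ioo 0 L, Φ y ≤ Real.exp (S - s) * Φ y := fun s hs y hy =>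
      le_mul_of_one_le_left (hΦ.nonneg y hy) (Real.one_le_exp (by linarith [hs.2]))
    have hbar : ∀ s, ∀ y ∈ Ioo 0 L, 0 ≤ κ * (1 + Real.exp (S - s) * Φ y) := fun s y hy => by
      have := hΦ.nonneg y hy
      positivity
    refine nonneg_of_hasParabolicAt_nonpos (b := b) (σ := σ) (S₀ := 0) (S := S) (l := l) (r := r)
      (q := fun s y => q s y + κ * (1 + Real.exp (S - s) * Φ y)) ?_ ?_ ?_ ?_ ?_ t ht x
      ⟨hlx.le, hxr.le⟩
    · refine (hcont.mono (prod_mono Subset.rfl hsub)).add ?_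
      have : ContinuousOn (fun p : ℝ × ℝ => Φ p.2) (Icc 0 S ×ˢ Icc l r) :=
        (hΦ.continuousOn.mono hsub).comp continuousOn_snd fun p hp => hp.2
      exact continuousOn_const.mul (continuousOn_const.add
        ((by fun_prop : Continuous fun p : ℝ × ℝ => Real.exp (S - p.1)).continuousOn.mul this))
    · intro s hs y hy
      obtain ⟨ℓ, hℓ, h1⟩ := hpar s hs y (hsub (Ioo_subset_Icc_self hy))
      obtain ⟨ℓ', hℓ', h2⟩ := hΦ.exists_hasParabolicAt (S := S) (t := s) hκ.le
        (hsub (Ioo_subset_Icc_self hy))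
      exact ⟨ℓ + ℓ', by linarith, h1.add h2⟩
    · intro y hy
      have := hterm y (hsub hy)
      have := hbar S y (hsub hy)
      linarith
    · intro s hs
      have h1 := (H s hs l hlm).1 (hl.trans_le (min_le_left _ _))
      have h2 : κ * (1 + Φ l) ≤ κ * (1 + Real.exp (S - s) * Φ l) := by
        gcongr; exact hexp s hs l hlm
      linarith
    · intro s hs
      have h1 := (H s hs r hrm).2 ((le_max_left _ _).trans_lt hr)
      have h2 : κ * 1 ≤ κ * (1 + Real.exp (S - s) * Φ r) := by
        gcongr
        have := hΦ.nonneg r hrm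
        have : 0 ≤ Real.exp (S - s) * Φ r := by positivity
        linarith
      linarith
  have hlim : Tendsto (fun κ : ℝ => q t x + κ * (1 + Real.exp (S - t) * Φ x)) (𝓝[>] 0)
      (𝓝 (q t x + 0 * (1 + Real.exp (S - t) * Φ x))) :=
    (Continuous.tendsto (by fun_prop) 0).mono_left nhdsWithin_le_nhds
  rw [zero_mul, add_zero] at hlim
  exact ge_of_tendsto hlim (eventually_mem_nhdsWithin.mono fun κ hκ => key κ hκ)

/-- Uniform continuity on the compact rectangle makes the decay to the zero edge values uniform in
time. -/
theorem exists_small_near_edge {S l r e κ : ℝ} {k : ℝ → ℝ → ℝ}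
    (hk : ContinuousOn (fun p : ℝ × ℝ => k p.1 p.2) (Icc 0 S ×ˢ Icc l r)) (he : e ∈ Icc l r)
    (h0 : ∀ t ∈ Icc 0 S, k t e = 0) (hκ : 0 < κ) :
    ∃ δ > 0, ∀ t ∈ Icc 0 S, ∀ x ∈ Icc l r, |x - e| < δ → |k t x| ≤ κ := by
  have huc := (isCompact_Icc.prod isCompact_Icc).uniformContinuousOn_of_continuous hk
  obtain ⟨δ, hδ, H⟩ := Metric.uniformContinuousOn_iff.1 huc κ hκ
  refine ⟨δ, hδ, fun t ht x hx hxe => ?_⟩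
  have := H (t, x) ⟨ht, hx⟩ (t, e) ⟨ht, he⟩ (by
    rw [Prod.dist_eq, dist_self, Real.dist_eq]
    exact max_lt hδ hxe)
  rw [Real.dist_eq, h0 t ht, sub_zero] at this
  exact this.le

theorem exists_abs_le_of_continuousOn {S l r : ℝ} {k : ℝ → ℝ → ℝ}
    (hk : ContinuousOn (fun p : ℝ × ℝ => k p.1 p.2) (Icc 0 S ×ˢ Icc l r)) :
    ∃ C > 0, ∀ t ∈ Icc 0 S, ∀ x ∈ Icc l r, |k t x| ≤ C := by
  obtain ⟨C, hC⟩ := (isCompact_Icc.prod isCompact_Icc).exists_bound_of_continuousOn hk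
  exact ⟨max C 1, by positivity, fun t ht x hx => (hC (t, x) ⟨ht, hx⟩).trans (le_max_left _ _)⟩

/-- At `0` either the boundary value is zero, or the solution is bounded while `Φ` tends to
infinity. -/
theorem IsClassicalSolution.negligible {acc : Prop} {L S : ℝ} {b σ k φ Φ : ℝ → ℝ}
    {v : ℝ → ℝ → ℝ} (hL : 0 < L)
    (hv : IsClassicalSolution acc L S b σ k φ (fun _ => 0) (fun _ => 0) v)
    (hΦ : IsBarrier L b σ Φ) (hacc : acc ∨ Tendsto Φ (𝓝[>] 0) atTop) :
    NegligibleAtBoundary L S Φ v := by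
  intro κ hκ
  obtain ⟨δ, hδ, H⟩ := exists_small_near_edge hv.continuousOn (right_mem_Icc.2 hL.le) hv.bc_right hκ
  have hright : ∀ t ∈ Icc 0 S, ∀ x ∈ Ioo 0 L, L - δ < x → |v t x| ≤ κ := fun t ht x hx h =>
    H t ht x (Ioo_subset_Icc_self hx) (by rw [abs_lt]; constructor <;> linarith [hx.2])
  rcases hacc with hacc | hacc
  · obtain ⟨δ', hδ', H'⟩ := exists_small_near_edge hv.continuousOn (left_mem_Icc.2 hL.le)
      (hv.bc_zero hacc) hκ
    refine ⟨min δ δ', lt_min hδ hδ', fun t ht x hx => ⟨fun h => ?_, fun h => ?_⟩⟩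
    · have := H' t ht x (Ioo_subset_Icc_self hx) (by
        rw [sub_zero, abs_of_pos hx.1]; exact h.trans_le (min_le_right _ _))
      exact this.trans (le_mul_of_one_le_right hκ.le (by linarith [hΦ.nonneg x hx]))
    · exact hright t ht x hx (by linarith [min_le_left δ δ'])
  · obtain ⟨C, hC, HC⟩ := exists_abs_le_of_continuousOn hv.continuousOn
    obtain ⟨δ', hδ', H'⟩ := mem_nhdsGT_iff_exists_Ioo_subset.1
      (hacc.eventually_ge_atTop (C / κ))
    refine ⟨min δ δ', lt_min hδ hδ', fun t ht x hx => ⟨fun h => ?_, fun h => ?_⟩⟩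
    · have h1 : C / κ ≤ Φ x := H' ⟨hx.1, h.trans_le (min_le_right _ _)⟩
      rw [div_le_iff₀ hκ] at h1
      have := HC t ht x (Ioo_subset_Icc_self hx)
      nlinarith
    · exact hright t ht x hx (by linarith [min_le_left δ δ'])

/-! ### Test functions and their evolution under the kernel. -/

/-- Continuous functions with compact support in `(0, L)`. -/
structure IsTest (L : ℝ) (φ : ℝ → ℝ) : Prop where
  continuous : Continuous φ
  hasCompactSupport : HasCompactSupport φ
  tsupport_subset : tsupport φ ⊆ Ioo 0 L

theorem IsTest.mul {L : ℝ} {φ : ℝ → ℝ} (hφ : IsTest L φ) {χ : ℝ → ℝ}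
    (hχ : ContinuousOn χ (Ioo 0 L)) : IsTest L fun x => χ x * φ x := by
  have hsub : tsupport (fun x => χ x * φ x) ⊆ tsupport φ := tsupport_mul_subset_right
  refine ⟨?_, hφ.hasCompactSupport.mul_left, hsub.trans hφ.tsupport_subset⟩
  refine continuous_iff_continuousAt.2 fun x => ?_
  by_cases hx : x ∈ tsupport φ
  · exact (hχ.continuousAt (isOpen_Ioo.mem_nhds (hφ.tsupport_subset hx))).mul
      hφ.continuous.continuousAt
  · have : (fun x => χ x * φ x) =ᶠ[𝓝 x] fun _ => 0 := by
      filter_upwards [(notMem_tsupport_iff_eventuallyEq.1 hx)] with y hy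
      simp [hy]
    exact continuousAt_const.congr this.symm

theorem IsTest.add {L : ℝ} {φ χ : ℝ → ℝ} (hφ : IsTest L φ) (hχ : IsTest L χ) :
    IsTest L fun x => φ x + χ x where
  continuous := hφ.continuous.add hχ.continuous
  hasCompactSupport := hφ.hasCompactSupport.add hχ.hasCompactSupport
  tsupport_subset := (tsupport_add φ χ).trans
    (union_subset hφ.tsupport_subset hχ.tsupport_subset)

theorem isTest_zero (L : ℝ) : IsTest L fun _ => 0 where
  continuous := continuous_const
  hasCompactSupport := HasCompactSupport.zero
  tsupport_subset := by simp [tsupport]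

theorem IsTest.const_mul {L : ℝ} {φ : ℝ → ℝ} (hφ : IsTest L φ) (c : ℝ) :
    IsTest L fun x => c * φ x := hφ.mul continuousOn_const

theorem IsTest.neg {L : ℝ} {φ : ℝ → ℝ} (hφ : IsTest L φ) :
    IsTest L fun x => -φ x := by simpa using hφ.const_mul (-1)

theorem IsTest.sub {L : ℝ} {φ χ : ℝ → ℝ} (hφ : IsTest L φ) (hχ : IsTest L χ) :
    IsTest L fun x => φ x - χ x := by simpa [sub_eq_add_neg] using hφ.add hχ.neg

theorem IsTest.sum {L : ℝ} {ι : Type*} (s : Finset ι) {φ : ι → ℝ → ℝ}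
    (hφ : ∀ i ∈ s, IsTest L (φ i)) : IsTest L fun x => ∑ i ∈ s, φ i x := by
  classical
  induction s using Finset.induction_on with
  | empty => simpa using isTest_zero L
  | insert i s hi ih =>
    simp only [Finset.sum_insert hi]
    exact (hφ i (by simp)).add (ih fun j hj => hφ j (by simp [hj]))

/-- The solution at `(t, x)` with terminal value `φ` at time `s` given by the kernel `Γ`. -/
def evolve (Γ : ℝ → ℝ → ℝ → ℝ → ℝ) (L : ℝ) (φ : ℝ → ℝ) (s t x : ℝ) : ℝ :=
  if t < s then ∫ y in 0..L, Γ t x s y * φ y else φ x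

namespace IsFundamentalSolution

variable {acc : Prop} {L T : ℝ} {b σ Φ φ χ : ℝ → ℝ} {Γ : ℝ → ℝ → ℝ → ℝ → ℝ} {s t x : ℝ}

theorem isClassicalSolution_evolve (hΓ : IsFundamentalSolution acc L T b σ Γ)
    (hs : s ∈ Ioc 0 T) (hφ : IsTest L φ) :
    IsClassicalSolution acc L s b σ (fun _ => 0) φ (fun _ => 0) (fun _ => 0)
      (evolve Γ L φ s) :=
  hΓ.terminal s hs φ hφ.continuous hφ.hasCompactSupport hφ.tsupport_subset

/-- Local integrability in `y` is enough since the support is compact; this is what makes the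
evolution additive. -/
theorem integrableOn_mul_test (hΓ : IsFundamentalSolution acc L T b σ Γ)
    (hs : s ∈ Ioc 0 T) (ht : t ∈ Ico 0 s) (hx : x ∈ Icc 0 L) (hφ : IsTest L φ) :
    IntegrableOn (fun y => Γ t x s y * φ y) (Ioo 0 L) := by
  have h1 : IntegrableOn (fun y => Γ t x s y) (tsupport φ) :=
    (hΓ.locallyIntegrable s hs t ht x hx).integrableOn_compact_subset hφ.tsupport_subset
      hφ.hasCompactSupport
  have h2 : IntegrableOn (fun y => Γ t x s y * φ y) (tsupport φ) :=
    h1.mul_continuousOn hφ.continuous.continuousOn hφ.hasCompactSupport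
  have h3 : Integrable (fun y => Γ t x s y * φ y) := by
    refine (integrableOn_iff_integrable_of_support_subset ?_).1 h2
    exact (Function.support_mul_subset_right _ _).trans (subset_tsupport φ)
  exact h3.integrableOn

theorem evolve_add (hΓ : IsFundamentalSolution acc L T b σ Γ) (hL : 0 < L)
    (hs : s ∈ Ioc 0 T) (ht : t ∈ Icc 0 s) (hx : x ∈ Icc 0 L) (hφ : IsTest L φ)
    (hχ : IsTest L χ) :
    evolve Γ L (fun y => φ y + χ y) s t x = evolve Γ L φ s t x + evolve Γ L χ s t x := by
  unfold evolve
  split_ifs with hts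
  · simp only [intervalIntegral.integral_of_le hL.le, integral_Ioc_eq_integral_Ioo, mul_add]
    exact integral_add (hΓ.integrableOn_mul_test hs ⟨ht.1, hts⟩ hx hφ)
      (hΓ.integrableOn_mul_test hs ⟨ht.1, hts⟩ hx hχ)
  · rfl

theorem evolve_const_mul (c : ℝ) :
    evolve Γ L (fun y => c * φ y) s t x = c * evolve Γ L φ s t x := by
  unfold evolve
  split_ifs with hts
  · rw [← intervalIntegral.integral_const_mul]
    congr 1; ext y; ring
  · rfl

theorem evolve_sum (hΓ : IsFundamentalSolution acc L T b σ Γ) (hL : 0 < L)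
    (hs : s ∈ Ioc 0 T) (ht : t ∈ Icc 0 s) (hx : x ∈ Icc 0 L) {ι : Type*} (I : Finset ι)
    {φ : ι → ℝ → ℝ} (hφ : ∀ i ∈ I, IsTest L (φ i)) :
    evolve Γ L (fun y => ∑ i ∈ I, φ i y) s t x = ∑ i ∈ I, evolve Γ L (φ i) s t x := by
  classical
  induction I using Finset.induction_on with
  | empty => simp [evolve]
  | insert i I hi ih =>
    simp only [Finset.sum_insert hi]
    rw [hΓ.evolve_add hL hs ht hx (hφ i (by simp))
      (IsTest.sum I fun j hj => hφ j (by simp [hj])), ih fun j hj => hφ j (by simp [hj])]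

/-- Sub-Markov property on test functions: `c - evolve` is a solution bounded below by a negligible
function, so the comparison principle applies. It is the only mass bound on the kernel that the
proof uses. -/
theorem evolve_le (hΓ : IsFundamentalSolution acc L T b σ Γ) (hL : 0 < L)
    (hΦ : IsBarrier L b σ Φ) (hacc : acc ∨ Tendsto Φ (𝓝[>] 0) atTop)
    (hs : s ∈ Ioc 0 T) (ht : t ∈ Icc 0 s) (hx : x ∈ Ioo 0 L) (hφ : IsTest L φ) {c : ℝ}
    (hc : 0 ≤ c) (h : ∀ y, φ y ≤ c) : evolve Γ L φ s t x ≤ c := by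
  have hsol := hΓ.isClassicalSolution_evolve hs hφ
  have hneg := hsol.negligible hL hΦ hacc
  suffices H : ∀ t ∈ Icc 0 s, ∀ x ∈ Ioo 0 L, 0 ≤ c - evolve Γ L φ s t x by
    linarith [H t ht x hx]
  refine nonneg_of_boundary_lower_bound hΦ ?_ ?_ ?_ ?_
  · exact continuousOn_const.sub (hsol.continuousOn.mono (prod_mono Subset.rfl Ioo_subset_Icc_self))
  · intro r hr y hy
    refine ⟨_, le_of_eq ?_, (HasParabolicAt.of_time (hasDerivAt_const r c)).sub
      (hsol.solves.hasParabolicAt hr hy)⟩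
    simp
  · intro y hy
    rw [hsol.terminal y (Ioo_subset_Icc_self hy)]
    linarith [h y]
  · intro κ hκ
    obtain ⟨δ, hδ, H⟩ := hneg κ hκ
    refine ⟨δ, hδ, fun r hr y hy => ⟨fun h1 => ?_, fun h1 => ?_⟩⟩
    · linarith [(abs_le.1 ((H r hr y hy).1 h1)).2]
    · linarith [(abs_le.1 ((H r hr y hy).2 h1)).2]

/-- The evolution is homogeneous in time. -/
theorem evolve_eq_evolve_add (hΓ : IsFundamentalSolution acc L T b σ Γ) (hL : 0 < L)
    (hΦ : IsBarrier L b σ Φ) (hacc : acc ∨ Tendsto Φ (𝓝[>] 0) atTop)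
    (hs : s ∈ Ioc 0 T) (ht : t ∈ Icc 0 s) (hx : x ∈ Ioo 0 L) (hφ : IsTest L φ) :
    evolve Γ L φ s t x = evolve Γ L φ T (t + (T - s)) x := by
  have hT : T ∈ Ioc 0 T := ⟨hs.1.trans_le hs.2, le_rfl⟩
  have hsol := hΓ.isClassicalSolution_evolve hs hφ
  have hsolT := hΓ.isClassicalSolution_evolve hT hφ
  -- The two sides solve the same equation with the same terminal value and differ negligibly at the
  -- boundary; comparison in both directions gives equality.
  have hneg := (hsol.negligible hL hΦ hacc).sub
    ((hsolT.negligible hL hΦ hacc).comp_add_const (S := s) (s := T - s) (by linarith [hs.2])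
      (by linarith))
  have hcont : ContinuousOn
      (fun p : ℝ × ℝ => evolve Γ L φ s p.1 p.2 - evolve Γ L φ T (p.1 + (T - s)) p.2)
      (Icc 0 s ×ˢ Ioo 0 L) := by
    refine (hsol.continuousOn.mono (prod_mono Subset.rfl Ioo_subset_Icc_self)).sub ?_
    refine hsolT.continuousOn.comp (f := fun p : ℝ × ℝ => (p.1 + (T - s), p.2)) (by fun_prop)
      fun p hp => ⟨⟨?_, ?_⟩, Ioo_subset_Icc_self hp.2⟩
    · linarith [hp.1.1, hs.2]
    · linarith [hp.1.2]
  have hpar : ∀ r ∈ Ioo 0 s, ∀ y ∈ Ioo 0 L, HasParabolicAt b σ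
      (fun r y => evolve Γ L φ s r y - evolve Γ L φ T (r + (T - s)) y) r y 0 := by
    intro r hr y hy
    simpa using (hsol.solves.hasParabolicAt hr hy).sub
      ((hsolT.solves.hasParabolicAt (t := r + (T - s)) (x := y)
        ⟨by linarith [hr.1, hs.2], by linarith [hr.2]⟩ hy).comp_add_const)
  have hterm : ∀ y ∈ Ioo 0 L, evolve Γ L φ s s y - evolve Γ L φ T (s + (T - s)) y = 0 := by
    intro y hy
    rw [add_sub_cancel, hsol.terminal y (Ioo_subset_Icc_self hy),
      hsolT.terminal y (Ioo_subset_Icc_self hy), sub_self]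
  have h1 := nonneg_of_boundary_lower_bound hΦ hcont
    (fun r hr y hy => ⟨0, le_rfl, hpar r hr y hy⟩) (fun y hy => (hterm y hy).ge) (fun κ hκ => by
      obtain ⟨δ, hδ, H⟩ := hneg κ hκ
      exact ⟨δ, hδ, fun r hr y hy => ⟨fun h1 => (abs_le.1 ((H r hr y hy).1 h1)).1,
        fun h1 => (abs_le.1 ((H r hr y hy).2 h1)).1⟩⟩) t ht x hx
  have h2 := nonneg_of_boundary_lower_bound hΦ hcont.neg
    (fun r hr y hy => ⟨-0, by simp, (hpar r hr y hy).neg⟩)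
    (fun y hy => by simp only [hterm y hy]; simp) (fun κ hκ => by
      obtain ⟨δ, hδ, H⟩ := hneg.neg κ hκ
      exact ⟨δ, hδ, fun r hr y hy => ⟨fun h1 => (abs_le.1 ((H r hr y hy).1 h1)).1,
        fun h1 => (abs_le.1 ((H r hr y hy).2 h1)).1⟩⟩) t ht x hx
  linarith

end IsFundamentalSolution

/-! ### Potentials of the sources `e^{-ks} φ(x)`. -/

theorem intervalIntegrable_of_continuousOn_Ioo {f : ℝ → ℝ} {α β x z : ℝ}
    (hf : ContinuousOn f (Ioo α β)) (hx : x ∈ Ioo α β) (hz : z ∈ Ioo α β) :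
    IntervalIntegrable f volume x z :=
  (hf.mono (ordConnected_Ioo.uIcc_subset hx hz)).intervalIntegrable

theorem hasDerivAt_integral_left_of_continuousOn_Ioo {f : ℝ → ℝ} {α β x z : ℝ}
    (hf : ContinuousOn f (Ioo α β)) (hx : x ∈ Ioo α β) (hz : z ∈ Ioo α β) :
    HasDerivAt (fun u => ∫ y in u..z, f y) (-f x) x :=
  intervalIntegral.integral_hasDerivAt_left (intervalIntegrable_of_continuousOn_Ioo hf hx hz)
    (hf.stronglyMeasurableAtFilter isOpen_Ioo x hx) (hf.continuousAt (isOpen_Ioo.mem_nhds hx))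

theorem hasDerivAt_intervalIntegral_of_continuousOn {G G' : ℝ → ℝ → ℝ} {t S L y : ℝ} (htS : t ≤ S)
    (hy : y ∈ Ioo 0 L)
    (hG : ∀ r ∈ Icc t S, ∀ y ∈ Ioo 0 L, HasDerivAt (G r) (G' r y) y)
    (hGc : ∀ y ∈ Ioo 0 L, ContinuousOn (fun r => G r y) (Icc t S))
    (hG'c : ContinuousOn (fun p : ℝ × ℝ => G' p.1 p.2) (Icc t S ×ˢ Ioo 0 L)) :
    HasDerivAt (fun y => ∫ r in t..S, G r y) (∫ r in t..S, G' r y) y := by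
  obtain ⟨l, hl0, hly⟩ := exists_between hy.1
  obtain ⟨u, hyu, huL⟩ := exists_between hy.2
  have hsub : Icc l u ⊆ Ioo 0 L := fun z hz => ⟨hl0.trans_le hz.1, hz.2.trans_lt huL⟩
  have hIoc : uIoc t S ⊆ Icc t S := by rw [uIoc_of_le htS]; exact Ioc_subset_Icc_self
  obtain ⟨C, hC⟩ := (isCompact_Icc.prod isCompact_Icc).exists_bound_of_continuousOn
    (hG'c.mono (prod_mono Subset.rfl hsub))
  have hG'y : ContinuousOn (fun r => G' r y) (Icc t S) :=
    hG'c.comp (f := fun r : ℝ => (r, y)) (by fun_prop) fun r hr => ⟨hr, hy⟩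
  refine (intervalIntegral.hasDerivAt_integral_of_dominated_loc_of_deriv_le
    (F := fun y r => G r y) (F' := fun y r => G' r y) (bound := fun _ => C) (s := Icc l u)
    (Icc_mem_nhds hly hyu) ?_ ?_ ?_ ?_ intervalIntegrable_const ?_).2
  · filter_upwards [isOpen_Ioo.mem_nhds hy] with z hz
    exact ((hGc z hz).mono hIoc).aestronglyMeasurable measurableSet_uIoc
  · exact ((hGc y hy).mono (by rw [uIcc_of_le htS])).intervalIntegrable
  · exact (hG'y.mono hIoc).aestronglyMeasurable measurableSet_uIoc
  · exact Eventually.of_forall fun r hr z hz => hC (r, z) ⟨hIoc hr, hz⟩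
  · exact Eventually.of_forall fun r hr z hz => hG r (hIoc hr) z (hsub hz)

theorem continuousOn_intervalIntegral_left {G : ℝ → ℝ → ℝ} {S T l u : ℝ} (hlu : l ≤ u)
    (hS : S ∈ Icc 0 T)
    (hG : ContinuousOn (fun p : ℝ × ℝ => G p.1 p.2) (Icc 0 T ×ˢ Icc l u)) :
    ContinuousOn (fun p : ℝ × ℝ => ∫ r in p.1..S, G r p.2) (Icc 0 S ×ˢ Icc l u) := by
  have hT : 0 ≤ T := hS.1.trans hS.2
  -- Projecting onto the rectangle extends `G` to a continuous function on the plane without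
  -- changing it where it is used.
  set Ĝ : ℝ → ℝ → ℝ := fun r x => G (projIcc 0 T hT r) (projIcc l u hlu x) with hĜ
  have hc : Continuous fun p : ℝ × ℝ => Ĝ p.1 p.2 := by
    rw [hĜ]
    exact hG.comp_continuous
      (f := fun p : ℝ × ℝ => ((projIcc 0 T hT p.1 : ℝ), (projIcc l u hlu p.2 : ℝ)))
      (by fun_prop) fun p => ⟨Subtype.coe_prop _, Subtype.coe_prop _⟩
  have h1 : Continuous fun p : ℝ × ℝ => ∫ r in S..p.1, Ĝ r p.2 :=
    intervalIntegral.continuous_parametric_intervalIntegral_of_continuous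
      (f := fun (p : ℝ × ℝ) r => Ĝ r p.2)
      (hc.comp (f := fun q : (ℝ × ℝ) × ℝ => (q.2, q.1.2)) (by fun_prop)) continuous_fst
  refine h1.neg.continuousOn.congr fun p hp => ?_
  rw [intervalIntegral.integral_symm]
  congr 1
  refine intervalIntegral.integral_congr fun r hr => ?_
  rw [uIcc_of_ge hp.1.2] at hr
  simp only [hĜ]
  rw [projIcc_of_mem hT ⟨hp.1.1.trans hr.1, hr.2.trans hS.2⟩, projIcc_of_mem hlu hp.2]

/-- The Duhamel potential of the source `e^{-k s} φ(x)`, cut off shortly before the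
terminal time, where `v` is the solution with terminal value `φ` at time `T`. -/
def potential (T S k : ℝ) (v : ℝ → ℝ → ℝ) (t x : ℝ) : ℝ :=
  Real.exp (-k * t) * ∫ r in t..S, Real.exp (-k * (T - r)) * v r x

/-- The derivatives of `v` are controlled only inside `(0, T)`, so the potential stops at `S < T`.
The source it produces is then `v S` rather than the terminal value; these agree in the limit `S →
T`. -/
theorem SolvesBackwardPDE.hasParabolicAt_potential {L T S k : ℝ} {b σ : ℝ → ℝ}
    {v : ℝ → ℝ → ℝ} (hv : SolvesBackwardPDE L T b σ (fun _ => 0) v)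
    (hvc : ContinuousOn (fun p : ℝ × ℝ => v p.1 p.2) (Icc 0 T ×ˢ Icc 0 L)) (hS : S < T)
    {t x : ℝ} (ht : t ∈ Ioo 0 S) (hx : x ∈ Ioo 0 L) :
    HasParabolicAt b σ (potential T S k v) t x
      (-(Real.exp (-k * (t + (T - S))) * v S x)) := by
  set a : ℝ → ℝ := fun r => Real.exp (-k * (T - r)) with ha
  have hac : Continuous a := by rw [ha]; fun_prop
  have hsub : Icc t S ⊆ Ioo 0 T := fun r hr => ⟨ht.1.trans_le hr.1, hr.2.trans_lt hS⟩
  have ha1 : ContinuousOn (fun p : ℝ × ℝ => a p.1) (Icc t S ×ˢ Ioo 0 L) :=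
    (hac.comp continuous_fst).continuousOn
  have hss : Icc t S ×ˢ Ioo 0 L ⊆ Ioo 0 T ×ˢ Ioo 0 L := prod_mono hsub Subset.rfl
  have slice : ∀ {G : ℝ → ℝ → ℝ},
      ContinuousOn (fun p : ℝ × ℝ => G p.1 p.2) (Icc t S ×ˢ Ioo 0 L) → ∀ y ∈ Ioo 0 L,
      ContinuousOn (fun r => G r y) (Icc t S) := fun hG y hy =>
    hG.comp (f := fun r : ℝ => (r, y)) (by fun_prop) fun r hr => ⟨hr, hy⟩
  have c0 : ContinuousOn (fun p : ℝ × ℝ => a p.1 * v p.1 p.2) (Icc t S ×ˢ Ioo 0 L) :=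
    ha1.mul (hvc.mono (prod_mono (hsub.trans Ioo_subset_Icc_self) Ioo_subset_Icc_self))
  have c1 : ContinuousOn (fun p : ℝ × ℝ => a p.1 * deriv (v p.1) p.2) (Icc t S ×ˢ Ioo 0 L) :=
    ha1.mul (hv.cont_space.mono hss)
  have c2 : ContinuousOn (fun p : ℝ × ℝ => a p.1 * deriv (deriv (v p.1)) p.2)
      (Icc t S ×ˢ Ioo 0 L) := ha1.mul (hv.cont_space_two.mono hss)
  have ct : ContinuousOn (fun p : ℝ × ℝ => a p.1 * deriv (fun r => v r p.2) p.1)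
      (Icc t S ×ˢ Ioo 0 L) := ha1.mul (hv.cont_time.mono hss)
  have ii : ∀ {G : ℝ → ℝ → ℝ},
      ContinuousOn (fun p : ℝ × ℝ => G p.1 p.2) (Icc t S ×ˢ Ioo 0 L) →
      IntervalIntegrable (fun r => G r x) volume t S := fun hG =>
    (by rw [uIcc_of_le ht.2.le]; exact slice hG x hx : ContinuousOn _ _).intervalIntegrable
  have i0 : IntervalIntegrable (fun r => a r * v r x) volume t S :=
    ii (G := fun r y => a r * v r y) c0
  have i1 : IntervalIntegrable (fun r => a r * deriv (v r) x) volume t S :=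
    ii (G := fun r y => a r * deriv (v r) y) c1
  have i2 : IntervalIntegrable (fun r => a r * deriv (deriv (v r)) x) volume t S :=
    ii (G := fun r y => a r * deriv (deriv (v r)) y) c2
  have it : IntervalIntegrable (fun r => a r * deriv (fun s => v s x) r) volume t S :=
    ii (G := fun r y => a r * deriv (fun s => v s y) r) ct
  have hd1 : ∀ y ∈ Ioo 0 L, HasDerivAt (fun y => ∫ r in t..S, a r * v r y)
      (∫ r in t..S, a r * deriv (v r) y) y := fun y hy =>
    hasDerivAt_intervalIntegral_of_continuousOn ht.2.le hy
      (fun r hr z hz => ((hv.diff_space r (hsub hr) z hz).hasDerivAt).const_mul (a r))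
      (slice c0) c1
  have hd2 : HasDerivAt (fun y => ∫ r in t..S, a r * deriv (v r) y)
      (∫ r in t..S, a r * deriv (deriv (v r)) x) x :=
    hasDerivAt_intervalIntegral_of_continuousOn ht.2.le hx
      (fun r hr z hz => ((hv.diff_space_two r (hsub hr) z hz).hasDerivAt).const_mul (a r))
      (slice c1) c2
  have hvx : ContinuousOn (fun r => a r * v r x) (Ioo 0 T) :=
    hac.continuousOn.mul (hvc.comp (f := fun r : ℝ => (r, x)) (by fun_prop)
      fun r hr => ⟨Ioo_subset_Icc_self hr, Ioo_subset_Icc_self hx⟩)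
  have hdt : HasDerivAt (fun s => ∫ r in s..S, a r * v r x) (-(a t * v t x)) t :=
    hasDerivAt_integral_left_of_continuousOn_Ioo hvx (hsub (left_mem_Icc.2 ht.2.le))
      (hsub (right_mem_Icc.2 ht.2.le))
  have hexp : HasDerivAt (fun s => Real.exp (-k * s)) (Real.exp (-k * t) * (-k)) t := by
    simpa using ((hasDerivAt_id t).const_mul (-k)).exp
  refine ⟨_, fun y => Real.exp (-k * t) * ∫ r in t..S, a r * deriv (v r) y, _,
    hexp.mul hdt, ?_, hd2.const_mul _, ?_⟩
  · filter_upwards [isOpen_Ioo.mem_nhds hx] with y hy using (hd1 y hy).const_mul _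
  -- Integration of `∂ᵣ (a v)` over `[t, S]`; the equation then trades `∂ᵣ v` for space derivatives,
  -- which cancel those of the potential.
  have hparts : ∫ r in t..S, (k * (a r * v r x) + a r * deriv (fun s => v s x) r) =
      a S * v S x - a t * v t x := by
    refine intervalIntegral.integral_eq_sub_of_hasDerivAt (f := fun r => a r * v r x) ?_
      ((i0.const_mul k).add it)
    intro r hr
    rw [uIcc_of_le ht.2.le] at hr
    have h1 : HasDerivAt a (Real.exp (-k * (T - r)) * k) r := by
      simpa [ha] using (((hasDerivAt_id r).const_sub T).const_mul (-k)).exp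
    have h2 := h1.fun_mul (hv.diff_time r (hsub hr) x hx).hasDerivAt
    have e : k * (a r * v r x) = a r * k * v r x := by ring
    rw [e]
    exact h2
  rw [intervalIntegral.integral_add (i0.const_mul k) it,
    intervalIntegral.integral_const_mul] at hparts
  have hpde : ∫ r in t..S, a r * deriv (fun s => v s x) r =
      -(b x * (∫ r in t..S, a r * deriv (v r) x) +
        1 / 2 * σ x ^ 2 * ∫ r in t..S, a r * deriv (deriv (v r)) x) := by
    rw [← intervalIntegral.integral_const_mul, ← intervalIntegral.integral_const_mul,
      ← intervalIntegral.integral_add (i1.const_mul _) (i2.const_mul _),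
      ← intervalIntegral.integral_neg]
    refine intervalIntegral.integral_congr fun r hr => ?_
    rw [uIcc_of_le ht.2.le] at hr
    have := hv.pde r (hsub hr) x hx
    unfold generator at this
    have h2 : deriv (fun s => v s x) r =
      -(b x * deriv (v r) x + 1 / 2 * σ x ^ 2 * deriv (deriv (v r)) x) := by linarith
    simp only [h2]; ring
  have e1 : Real.exp (-k * (t + (T - S))) = Real.exp (-k * t) * a S := by
    rw [ha, ← Real.exp_add]; ring_nf
  rw [e1]
  rw [hpde] at hparts
  linear_combination Real.exp (-k * t) * hparts

theorem continuousOn_potential {T S k l u : ℝ} {v : ℝ → ℝ → ℝ} (hlu : l ≤ u) (hS : S ∈ Icc 0 T)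
    (hv : ContinuousOn (fun p : ℝ × ℝ => v p.1 p.2) (Icc 0 T ×ˢ Icc l u)) :
    ContinuousOn (fun p : ℝ × ℝ => potential T S k v p.1 p.2) (Icc 0 S ×ˢ Icc l u) := by
  unfold potential
  refine ContinuousOn.mul (by fun_prop) (continuousOn_intervalIntegral_left hlu hS
    (G := fun r x => Real.exp (-k * (T - r)) * v r x) ?_)
  exact (by fun_prop : Continuous fun p : ℝ × ℝ => Real.exp (-k * (T - p.1))).continuousOn.mul hv

/-- Comparison of `w` with the potential of a source which dominates `-(∂ₜ + b ∂ₓ + ½ σ² ∂ₓ²) w`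
on a rectangle, up to errors of order `κ`. -/
theorem le_sum_potential {acc : Prop} {L T κ l u t₀ x₀ : ℝ} {b σ Φ : ℝ → ℝ} {w F : ℝ → ℝ → ℝ}
    {φ : ℕ → ℝ → ℝ} {Y : ℕ → ℝ → ℝ → ℝ} (I : Finset ℕ)
    (hΦ : IsBarrier L b σ Φ)
    (hwc : ContinuousOn (fun p : ℝ × ℝ => w p.1 p.2) (Icc 0 T ×ˢ Ioo 0 L))
    (hwp : ∀ t ∈ Ioo 0 T, ∀ x ∈ Ioo 0 L, HasParabolicAt b σ w t x (-F t x))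
    (hwT : ∀ x ∈ Ioo 0 L, w T x = 0) (hκ : 0 < κ) (hl : 0 < l) (hu : u < L)
    (hx₀ : x₀ ∈ Ioo l u) (ht₀ : t₀ ∈ Ico 0 T)
    (hY : ∀ k ∈ I, IsClassicalSolution acc L T b σ (fun _ => 0) (φ k) (fun _ => 0) (fun _ => 0)
      (Y k))
    (hF : ∀ t ∈ Icc 0 T, ∀ x ∈ Icc l u, F t x - κ ≤ ∑ k ∈ I, Real.exp (-k * t) * φ k x)
    (hwl : ∀ t ∈ Icc 0 T, w t l ≤ κ * (1 + Φ l)) (hwu : ∀ t ∈ Icc 0 T, w t u ≤ κ)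
    (hYl : ∀ t ∈ Icc 0 T, ∀ r ∈ Icc t T,
      -(κ * (1 + Φ l)) ≤ ∑ k ∈ I, Real.exp (-k * (t + T - r)) * Y k r l)
    (hYu : ∀ t ∈ Icc 0 T, ∀ r ∈ Icc t T,
      -κ ≤ ∑ k ∈ I, Real.exp (-k * (t + T - r)) * Y k r u) {ε₁ : ℝ} (hε₁ : 0 < ε₁) :
    ∃ ε ∈ Ioo 0 ε₁, t₀ + ε < T ∧ w t₀ x₀ ≤ (∑ k ∈ I, potential T (T - ε) k (Y k) t₀ x₀) +
      κ * (2 * T + (1 + T) * (1 + Real.exp (T - t₀) * Φ x₀)) := by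
  have hlu : l < u := hx₀.1.trans hx₀.2
  have hsub : Icc l u ⊆ Ioo 0 L := fun z hz => ⟨hl.trans_le hz.1, hz.2.trans_lt hu⟩
  have hsub' : Icc l u ⊆ Icc 0 L := hsub.trans Ioo_subset_Icc_self
  have hT0 : 0 < T := ht₀.1.trans_lt ht₀.2
  have hTm : T ∈ Icc 0 T := right_mem_Icc.2 hT0.le
  have hlm : l ∈ Ioo 0 L := hsub (left_mem_Icc.2 hlu.le)
  have hum : u ∈ Ioo 0 L := hsub (right_mem_Icc.2 hlu.le)
  have hYc : ∀ k ∈ I, ContinuousOn (fun p : ℝ × ℝ => Y k p.1 p.2) (Icc 0 T ×ˢ Icc l u) :=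
    fun k hk => (hY k hk).continuousOn.mono (prod_mono Subset.rfl hsub')
  have hwc' := hwc.mono (prod_mono (Subset.refl (Icc 0 T)) hsub)
  -- the cut-off time
  obtain ⟨δ₁, hδ₁, H₁⟩ := Metric.uniformContinuousOn_iff.1
    ((isCompact_Icc.prod isCompact_Icc).uniformContinuousOn_of_continuous hwc') κ hκ
  have hZc : ContinuousOn (fun p : ℝ × (ℝ × ℝ) =>
      ∑ k ∈ I, Real.exp (-k * p.1) * Y k p.2.1 p.2.2) (Icc 0 T ×ˢ (Icc 0 T ×ˢ Icc l u)) := by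
    refine continuousOn_finsetSum I fun k hk => ContinuousOn.mul (by fun_prop) ?_
    exact (hYc k hk).comp continuousOn_snd fun p hp => hp.2
  obtain ⟨δ₂, hδ₂, H₂⟩ := Metric.uniformContinuousOn_iff.1
    ((isCompact_Icc.prod (isCompact_Icc.prod isCompact_Icc)).uniformContinuousOn_of_continuous
      hZc) κ hκ
  -- `δ₁` makes `w` small at time `T - ε`, `δ₂` makes the source of the cut-off potential close to
  -- the given one, `ε₁` is the caller's requirement, and `T - t₀` keeps `t₀` before the cut-off.
  obtain ⟨ε, hε0, hε⟩ : ∃ ε, 0 < ε ∧ ε < min (min δ₁ δ₂) (min ε₁ (T - t₀)) :=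
    exists_between (lt_min (lt_min hδ₁ hδ₂) (lt_min hε₁ (by linarith [ht₀.2])))
  have hε1 : ε < δ₁ := hε.trans_le ((min_le_left _ _).trans (min_le_left _ _))
  have hε2 : ε < δ₂ := hε.trans_le ((min_le_left _ _).trans (min_le_right _ _))
  have hε3 : ε < ε₁ := hε.trans_le ((min_le_right _ _).trans (min_le_left _ _))
  have hε4 : ε < T - t₀ := hε.trans_le ((min_le_right _ _).trans (min_le_right _ _))
  set S := T - ε with hS
  have hSm : S ∈ Icc 0 T := ⟨by linarith [ht₀.1], by linarith⟩
  have htS : t₀ < S := by linarith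
  have hIcc : Icc t₀ S ⊆ Icc 0 T := Icc_subset_Icc ht₀.1 hSm.2
  have hwS : ∀ x ∈ Icc l u, w S x ≤ κ := by
    intro x hx
    have := H₁ (S, x) ⟨hSm, hx⟩ (T, x) ⟨hTm, hx⟩ (by
      rw [Prod.dist_eq, dist_self, Real.dist_eq, hS, sub_sub_cancel_left, abs_neg, abs_of_pos hε0]
      exact max_lt hε1 hδ₁)
    rw [hwT x (hsub hx), Real.dist_eq, sub_zero] at this
    exact (le_abs_self _).trans this.le
  have hZS : ∀ t ∈ Icc 0 S, ∀ x ∈ Icc l u, (∑ k ∈ I, Real.exp (-k * t) * φ k x) - κ ≤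
      ∑ k ∈ I, Real.exp (-k * (t + ε)) * Y k S x := by
    intro t ht x hx
    have := H₂ (t + ε, (S, x)) ⟨⟨by linarith [ht.1], by linarith [ht.2]⟩, hSm, hx⟩ (t, (T, x))
      ⟨⟨ht.1, by linarith [ht.2]⟩, hTm, hx⟩ (by
        simp only [Prod.dist_eq, dist_self, Real.dist_eq, hS, sub_sub_cancel_left, abs_neg,
          abs_of_pos hε0, add_sub_cancel_left]
        exact max_lt hε2 (max_lt hε2 hδ₂))
    rw [Real.dist_eq] at this
    have h2 := (abs_lt.1 this).1
    have h3 : ∑ k ∈ I, Real.exp (-k * t) * Y k T x = ∑ k ∈ I, Real.exp (-k * t) * φ k x :=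
      Finset.sum_congr rfl fun k hk => by rw [(hY k hk).terminal x (hsub' hx)]
    simp only [h3] at h2
    linarith
  -- lower bounds of the potential on the lateral boundary
  have hlat : ∀ x ∈ Icc l u, ∀ c : ℝ, 0 ≤ c → (∀ t ∈ Icc 0 T, ∀ r ∈ Icc t T,
      -c ≤ ∑ k ∈ I, Real.exp (-k * (t + T - r)) * Y k r x) → ∀ t ∈ Icc t₀ S,
      -(T * c) ≤ ∑ k ∈ I, potential T S k (Y k) t x := by
    intro x hx c hc h t ht
    have hYx : ∀ k ∈ I, ContinuousOn (fun r => Y k r x) (Icc t S) := fun k hk =>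
      (hYc k hk).comp (f := fun r : ℝ => (r, x)) (by fun_prop)
        fun r hr => ⟨hIcc ⟨ht.1.trans hr.1, hr.2⟩, hx⟩
    have hcon : ∀ k ∈ I,
        ContinuousOn (fun r => Real.exp (-k * (t + T - r)) * Y k r x) (uIcc t S) :=
      fun k hk => by
        rw [uIcc_of_le ht.2]
        exact ContinuousOn.mul (by fun_prop) (hYx k hk)
    have e : ∑ k ∈ I, potential T S k (Y k) t x =
        ∫ r in t..S, ∑ k ∈ I, Real.exp (-k * (t + T - r)) * Y k r x := by
      rw [intervalIntegral.integral_finsetSum fun k hk => (hcon k hk).intervalIntegrable]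
      refine Finset.sum_congr rfl fun k _ => ?_
      rw [potential, ← intervalIntegral.integral_const_mul]
      refine intervalIntegral.integral_congr fun r _ => ?_
      rw [← mul_assoc, ← Real.exp_add]
      ring_nf
    rw [e]
    have h1 : ∫ _r in t..S, -c ≤ ∫ r in t..S, ∑ k ∈ I, Real.exp (-k * (t + T - r)) * Y k r x := by
      refine intervalIntegral.integral_mono_on ht.2 intervalIntegrable_const
        (continuousOn_finsetSum I hcon).intervalIntegrable fun r hr => ?_
      exact h t (hIcc ht) r ⟨hr.1, hr.2.trans hSm.2⟩
    rw [intervalIntegral.integral_const, smul_eq_mul] at h1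
    have : (S - t) * c ≤ T * c := by
      gcongr
      linarith [ht.1, ht₀.1, hSm.2]
    linarith
  refine ⟨ε, ⟨hε0, hε3⟩, by linarith, ?_⟩
  have hexp : ∀ s ∈ Icc t₀ S, ∀ y ∈ Ioo 0 L, Φ y ≤ Real.exp (T - s) * Φ y := fun s hs y hy =>
    le_mul_of_one_le_left (hΦ.nonneg y hy) (Real.one_le_exp (by linarith [hs.2]))
  have hκ' : 0 ≤ κ * (1 + T) := by positivity
  -- The term `2κ(T - t)` pays for two source errors of size `κ`, from `hF` and from the cut-off
  -- `hZS`. In the factor `1 + T` the `1` pays for `w` on the sides and at time `S`, and the `T` for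
  -- the potential on the sides.
  have main := nonneg_of_hasParabolicAt_nonpos (b := b) (σ := σ) (S₀ := t₀) (S := S) (l := l)
    (r := u) (q := fun t x => ((∑ k ∈ I, potential T S k (Y k) t x) - w t x) +
      (2 * κ * (T - t) + κ * (1 + T) * (1 + Real.exp (T - t) * Φ x))) ?_ ?_ ?_ ?_ ?_ t₀
      ⟨le_rfl, htS.le⟩ x₀ (Ioo_subset_Icc_self hx₀)
  · have : 2 * κ * (T - t₀) ≤ 2 * κ * T := by gcongr; linarith [ht₀.1]
    nlinarith [main]
  · have hs1 : Icc t₀ S ×ˢ Icc l u ⊆ Icc 0 S ×ˢ Icc l u :=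
      prod_mono (Icc_subset_Icc_left ht₀.1) Subset.rfl
    have hs2 : Icc t₀ S ×ˢ Icc l u ⊆ Icc 0 T ×ˢ Icc l u := prod_mono hIcc Subset.rfl
    have hΦc : ContinuousOn (fun p : ℝ × ℝ => Φ p.2) (Icc t₀ S ×ˢ Icc l u) :=
      (hΦ.continuousOn.mono hsub).comp continuousOn_snd fun p hp => hp.2
    refine ContinuousOn.add (ContinuousOn.sub ?_ (hwc'.mono hs2)) ?_
    · exact continuousOn_finsetSum I fun k hk =>
        (continuousOn_potential hlu.le hSm (hYc k hk)).mono hs1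
    · refine ContinuousOn.add (by fun_prop) (continuousOn_const.mul (continuousOn_const.add ?_))
      exact (by fun_prop : Continuous fun p : ℝ × ℝ => Real.exp (T - p.1)).continuousOn.mul hΦc
  · intro t ht x hx
    have hx' := hsub (Ioo_subset_Icc_self hx)
    have ht0S : t ∈ Ioo 0 S := ⟨ht₀.1.trans_lt ht.1, ht.2⟩
    have ht0T : t ∈ Ioo 0 T := ⟨ht0S.1, ht.2.trans_le hSm.2⟩
    obtain ⟨ℓ, hℓ, hb⟩ := hΦ.exists_hasParabolicAt (S := T) (t := t) hκ' hx'
    have hlin : HasDerivAt (fun s => 2 * κ * (T - s)) (2 * κ * (-1)) t :=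
      ((hasDerivAt_id t).const_sub T).const_mul (2 * κ)
    refine ⟨_, ?_, ((HasParabolicAt.sum I fun k hk =>
      (hY k hk).solves.hasParabolicAt_potential (k := (k : ℝ)) (hY k hk).continuousOn
        (by linarith : S < T) ht0S hx').sub (hwp t ht0T x hx')).add
          ((HasParabolicAt.of_time hlin).add hb)⟩
    have h1 := hZS t (Ioo_subset_Icc_self ht0S) x (Ioo_subset_Icc_self hx)
    have h2 := hF t (Ioo_subset_Icc_self ht0T) x (Ioo_subset_Icc_self hx)
    have h3 : T - S = ε := by rw [hS]; ring
    rw [h3, Finset.sum_neg_distrib]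
    linarith
  · intro x hx
    have h0 : ∑ k ∈ I, potential T S k (Y k) S x = 0 :=
      Finset.sum_eq_zero fun k _ => by simp [potential]
    have h1 := hwS x hx
    have h2 : κ * 1 ≤ κ * (1 + T) * (1 + Real.exp (T - S) * Φ x) := by
      rw [mul_assoc]
      have h4 : 0 ≤ Real.exp (T - S) * Φ x :=
        mul_nonneg (Real.exp_pos _).le (hΦ.nonneg x (hsub hx))
      gcongr
      nlinarith
    have h3 : 0 ≤ 2 * κ * (T - S) := mul_nonneg (by positivity) (by linarith [hSm.2])
    rw [h0]
    linarith
  · intro t ht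
    have hc : 0 ≤ κ * (1 + Φ l) := mul_nonneg hκ.le (by linarith [hΦ.nonneg l hlm])
    have h1 := hlat l (left_mem_Icc.2 hlu.le) _ hc hYl t ht
    have h2 := hwl t (hIcc ht)
    have h3 : 0 ≤ 2 * κ * (T - t) := mul_nonneg (by positivity) (by linarith [ht.2, hSm.2])
    have h4 : κ * (1 + T) * (1 + Φ l) ≤ κ * (1 + T) * (1 + Real.exp (T - t) * Φ l) := by
      gcongr; exact hexp t ht l hlm
    linarith
  · intro t ht
    have h1 := hlat u (right_mem_Icc.2 hlu.le) κ hκ.le hYu t ht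
    have h2 := hwu t (hIcc ht)
    have h3 : 0 ≤ 2 * κ * (T - t) := mul_nonneg (by positivity) (by linarith [ht.2, hSm.2])
    have h4 : κ * (1 + T) * 1 ≤ κ * (1 + T) * (1 + Real.exp (T - t) * Φ u) := by
      gcongr
      have := mul_nonneg (Real.exp_pos (T - t)).le (hΦ.nonneg u hum)
      linarith
    linarith

/-! ### Cut-off functions and approximation of the source. -/

theorem exists_isTest_eq_one {L : ℝ} {K : Set ℝ} (hK : IsCompact K) (hKL : K ⊆ Ioo 0 L) :
    ∃ η : ℝ → ℝ, IsTest L η ∧ (∀ x ∈ K, η x = 1) ∧ ∀ x, η x ∈ Icc (0 : ℝ) 1 := by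
  obtain ⟨k, hk, hKk, hkL⟩ := exists_compact_between hK isOpen_Ioo hKL
  obtain ⟨η, h1, h0, hc, h01⟩ := exists_continuous_one_zero_of_isCompact hK
    isOpen_interior.isClosed_compl (disjoint_compl_right_iff_subset.2 hKk)
  refine ⟨η, ⟨η.continuous, hc, ?_⟩, fun x hx => h1 hx, h01⟩
  refine (closure_minimal ?_ hk.isClosed).trans hkL
  intro x hx
  by_contra hxk
  exact hx (h0 fun h => hxk (interior_subset h))

theorem continuous_mul_isTest {L : ℝ} {F : ℝ → ℝ → ℝ} {η : ℝ → ℝ}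
    (hF : ContinuousOn (fun p : ℝ × ℝ => F p.1 p.2) (univ ×ˢ Ioo 0 L)) (hη : IsTest L η) :
    Continuous fun p : ℝ × ℝ => F p.1 p.2 * η p.2 := by
  refine continuous_iff_continuousAt.2 fun p => ?_
  by_cases hx : p.2 ∈ tsupport η
  · refine (hF.continuousAt ((isOpen_univ.prod isOpen_Ioo).mem_nhds
      ⟨mem_univ _, hη.tsupport_subset hx⟩)).mul ?_
    exact (hη.continuous.comp continuous_snd).continuousAt
  · have : (fun p : ℝ × ℝ => F p.1 p.2 * η p.2) =ᶠ[𝓝 p] fun _ => 0 := by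
      filter_upwards [continuous_snd.continuousAt.eventually
        (notMem_tsupport_iff_eventuallyEq.1 hx)] with q hq
      simp only [hq, Pi.zero_apply, mul_zero]
    exact continuousAt_const.congr this.symm

/-- Uniform approximation on compact sets by sums `∑ e^{-k s} φₖ(x)`. -/
theorem exists_sum_exp_mul_near {H : ℝ → ℝ → ℝ} (hH : Continuous fun p : ℝ × ℝ => H p.1 p.2)
    (T : ℝ) {K : Set ℝ} (hK : IsCompact K) {ε : ℝ} (hε : 0 < ε) :
    ∃ (I : Finset ℕ) (φ : ℕ → ℝ → ℝ), (∀ k, Continuous (φ k)) ∧ ∀ s ∈ Icc 0 T, ∀ x ∈ K,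
      |(∑ k ∈ I, Real.exp (-k * s) * φ k x) - H s x| < ε := by
  -- The sums are the values at `e^{-s}` of polynomials with coefficients in `C(ℝ)`, hence the range
  -- of an algebra homomorphism. This subalgebra separates points: the variable separates times and
  -- the constant polynomial `id` separates positions.
  let ι : C(ℝ, ℝ) →ₐ[ℝ] C(ℝ × ℝ, ℝ) :=
    ContinuousMap.compRightAlgHom ℝ ℝ (⟨Prod.snd, continuous_snd⟩ : C(ℝ × ℝ, ℝ))
  let e : C(ℝ × ℝ, ℝ) := ⟨fun p => Real.exp (-p.1), by fun_prop⟩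
  let Ψ : Polynomial C(ℝ, ℝ) →ₐ[ℝ] C(ℝ × ℝ, ℝ) :=
    Polynomial.eval₂AlgHom ι e fun a => Commute.all _ _
  have hsep : Ψ.range.SeparatesPoints := by
    rintro ⟨s, x⟩ ⟨s', x'⟩ hne
    by_cases hx : x = x'
    · have hs : s ≠ s' := fun h => hne (by rw [h, hx])
      refine ⟨_, ⟨Ψ Polynomial.X, ⟨_, rfl⟩, rfl⟩, ?_⟩
      simp only [Ψ, Polynomial.eval₂AlgHom_apply, Polynomial.eval₂_X]
      simpa [e] using hs
    · refine ⟨_, ⟨Ψ (Polynomial.C (ContinuousMap.id ℝ)), ⟨_, rfl⟩, rfl⟩, ?_⟩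
      simp only [Ψ, Polynomial.eval₂AlgHom_apply, Polynomial.eval₂_C]
      simpa [ι] using hx
  obtain ⟨_, ⟨p, rfl⟩, hp⟩ :=
    ContinuousMap.exists_mem_subalgebra_near_continuous_of_isCompact_of_separatesPoints hsep
      ⟨fun p : ℝ × ℝ => H p.1 p.2, hH⟩ ((isCompact_Icc (a := 0) (b := T)).prod hK) hε
  refine ⟨p.support, fun k => p.coeff k, fun k => (p.coeff k).continuous, fun s hs x hx => ?_⟩
  have h := hp (s, x) ⟨hs, hx⟩
  rw [Real.norm_eq_abs] at h
  change |_ - H s x| < ε at h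
  convert h using 3
  change _ = (Polynomial.eval₂ (ι : C(ℝ, ℝ) →+* C(ℝ × ℝ, ℝ)) e p) (s, x)
  rw [Polynomial.eval₂_eq_sum, Polynomial.sum, ContinuousMap.sum_apply]
  refine Finset.sum_congr rfl fun k _ => ?_
  have : Real.exp (-k * s) = Real.exp (-s) ^ k := by rw [← Real.exp_nat_mul]; ring_nf
  rw [this, mul_comm]
  rfl

/-- Uniform approximation, with supports kept inside `(0, L)`. -/
theorem exists_sum_exp_mul_isTest_near {L : ℝ} {H : ℝ → ℝ → ℝ}
    (hH : Continuous fun p : ℝ × ℝ => H p.1 p.2) (T : ℝ) {K : Set ℝ} (hK : IsCompact K)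
    (hKL : K ⊆ Ioo 0 L) (hHK : ∀ s, ∀ x ∉ K, H s x = 0) {ε : ℝ} (hε : 0 < ε) :
    ∃ (I : Finset ℕ) (φ : ℕ → ℝ → ℝ), (∀ k, IsTest L (φ k)) ∧ ∀ s ∈ Icc 0 T, ∀ x,
      |(∑ k ∈ I, Real.exp (-k * s) * φ k x) - H s x| ≤ ε := by
  -- Multiplying the approximants by `χ` confines their supports and leaves `H` unchanged, since `χ
  -- = 1` on `K`.
  obtain ⟨χ, hχ, hχ1, hχ01⟩ := exists_isTest_eq_one hK hKL
  obtain ⟨I, φ, hφ, h⟩ := exists_sum_exp_mul_near hH T hχ.hasCompactSupport hε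
  refine ⟨I, fun k x => φ k x * χ x, fun k => hχ.mul (hφ k).continuousOn, fun s hs x => ?_⟩
  have e1 : H s x = H s x * χ x := by
    by_cases hx : x ∈ K
    · rw [hχ1 x hx, mul_one]
    · rw [hHK s x hx, zero_mul]
  have e2 : (∑ k ∈ I, Real.exp (-k * s) * (φ k x * χ x)) - H s x =
      ((∑ k ∈ I, Real.exp (-k * s) * φ k x) - H s x) * χ x := by
    rw [sub_mul, ← e1, Finset.sum_mul]
    simp only [mul_assoc]
  rw [e2, abs_mul, abs_of_nonneg (hχ01 x).1]
  by_cases hx : x ∈ tsupport χ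
  · calc _ ≤ ε * 1 := by
          gcongr
          · exact (hχ01 x).1
          · exact (h s hs x hx).le
          · exact (hχ01 x).2
      _ = ε := mul_one ε
  · rw [image_eq_zero_of_notMem_tsupport hx, mul_zero]
    exact hε.le

/-! ### Duhamel's formula by comparison. -/

section Duhamel

variable {acc : Prop} {L T t₀ x₀ : ℝ} {b σ Φ η : ℝ → ℝ} {w F : ℝ → ℝ → ℝ}
  {Γ : ℝ → ℝ → ℝ → ℝ → ℝ}

/-- The source with its negative part cut off by `η`. -/
def truncate (F : ℝ → ℝ → ℝ) (η : ℝ → ℝ) (s x : ℝ) : ℝ := max (F s x) 0 - max (-F s x) 0 * η x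

theorem IsFundamentalSolution.integrableOn_truncate (hΓ : IsFundamentalSolution acc L T b σ Γ)
    (ht₀ : t₀ ∈ Ico 0 T) (hx₀ : x₀ ∈ Ioo 0 L)
    (hinteg : IntegrableOn (fun p : ℝ × ℝ => Γ t₀ x₀ p.1 p.2 * F p.1 p.2)
      (Ioo t₀ T ×ˢ Ioo 0 L)) (hη : Continuous η) (hη01 : ∀ x, η x ∈ Icc (0 : ℝ) 1) :
    IntegrableOn (fun p : ℝ × ℝ => Γ t₀ x₀ p.1 p.2 * truncate F η p.1 p.2)
      (Ioo t₀ T ×ˢ Ioo 0 L) := by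
  have h1 := hinteg.pos_part
  have h2 := hinteg.neg_part.mul_bdd (g := fun p : ℝ × ℝ => η p.2) (c := 1)
    (hη.comp continuous_snd).aestronglyMeasurable (Eventually.of_forall fun p => by
      rw [Real.norm_eq_abs, abs_of_nonneg (hη01 _).1]; exact (hη01 _).2)
  refine IntegrableOn.congr_fun (h1.sub h2) (fun p hp => ?_) (measurableSet_Ioo.prod measurableSet_Ioo)
  have h0 : 0 ≤ Γ t₀ x₀ p.1 p.2 :=
    hΓ.nonneg p.1 ⟨ht₀.1.trans_lt hp.1.1, hp.1.2.le⟩ t₀ ⟨ht₀.1, hp.1.1⟩ x₀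
      (Ioo_subset_Icc_self hx₀) p.2 hp.2
  simp only [Pi.sub_apply, truncate]
  rw [mul_sub, ← mul_assoc, mul_max_of_nonneg _ _ h0, mul_max_of_nonneg _ _ h0, mul_zero, mul_neg]

/-- One-sided Duhamel estimate. -/
theorem IsFundamentalSolution.le_integral_truncate (hΓ : IsFundamentalSolution acc L T b σ Γ)
    (hL : 0 < L) (hΦ : IsBarrier L b σ Φ) (hacc : acc ∨ Tendsto Φ (𝓝[>] 0) atTop)
    (hwc : ContinuousOn (fun p : ℝ × ℝ => w p.1 p.2) (Icc 0 T ×ˢ Ioo 0 L))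
    (hwp : ∀ t ∈ Ioo 0 T, ∀ x ∈ Ioo 0 L, HasParabolicAt b σ w t x (-F t x))
    (hwT : ∀ x ∈ Ioo 0 L, w T x = 0) (hwn : NegligibleAtBoundary L T Φ w)
    (hF : ContinuousOn (fun p : ℝ × ℝ => F p.1 p.2) (univ ×ˢ Ioo 0 L))
    (ht₀ : t₀ ∈ Ico 0 T) (hx₀ : x₀ ∈ Ioo 0 L)
    (hinteg : IntegrableOn (fun p : ℝ × ℝ => Γ t₀ x₀ p.1 p.2 * F p.1 p.2)
      (Ioo t₀ T ×ˢ Ioo 0 L)) (hη : IsTest L η) (hη01 : ∀ x, η x ∈ Icc (0 : ℝ) 1) :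
    w t₀ x₀ ≤ ∫ p in Ioo t₀ T ×ˢ Ioo 0 L, Γ t₀ x₀ p.1 p.2 * truncate F η p.1 p.2 := by
  have hT0 : 0 < T := ht₀.1.trans_lt ht₀.2
  have hTm : T ∈ Ioc 0 T := ⟨hT0, le_rfl⟩
  have hx₀' := Ioo_subset_Icc_self hx₀
  set J := ∫ p in Ioo t₀ T ×ˢ Ioo 0 L, Γ t₀ x₀ p.1 p.2 * truncate F η p.1 p.2 with hJ
  set j : ℝ → ℝ := fun s => ∫ y in Ioo 0 L, Γ t₀ x₀ s y * truncate F η s y with hj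
  have hGint := hΓ.integrableOn_truncate ht₀ hx₀ hinteg hη.continuous hη01
  have hGint' := hGint
  rw [IntegrableOn, Measure.volume_eq_prod, ← Measure.prod_restrict] at hGint'
  have hjint : IntegrableOn j (Ioo t₀ T) := hGint'.integral_prod_left
  have hjae : ∀ᵐ s ∂(volume.restrict (Ioo t₀ T)),
      IntegrableOn (fun y => Γ t₀ x₀ s y * truncate F η s y) (Ioo 0 L) := hGint'.prod_right_ae
  have hJj : J = ∫ s in Ioo t₀ T, j s := by
    rw [hJ, hj, Measure.volume_eq_prod]
    exact setIntegral_prod _ hGint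
  have hFp : ContinuousOn (fun p : ℝ × ℝ => max (F p.1 p.2) 0) (univ ×ˢ Ioo 0 L) :=
    hF.sup continuousOn_const
  have hFn : ContinuousOn (fun p : ℝ × ℝ => max (-F p.1 p.2) 0) (univ ×ˢ Ioo 0 L) :=
    hF.neg.sup continuousOn_const
  -- a bound for the negative part on the support of the cut-off
  obtain ⟨M, hM, hFM⟩ : ∃ M > 0, ∀ s ∈ Icc 0 T, ∀ x, max (-F s x) 0 * η x ≤ M * η x := by
    obtain ⟨C, hC⟩ := (isCompact_Icc (a := 0) (b := T)).prod hη.hasCompactSupport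
      |>.exists_bound_of_continuousOn
        (hFn.mono (prod_mono (subset_univ (Icc 0 T)) hη.tsupport_subset))
    refine ⟨max C 1, by positivity, fun s hs x => ?_⟩
    by_cases hx : x ∈ tsupport η
    · exact mul_le_mul_of_nonneg_right
        (((le_abs_self _).trans (hC (s, x) ⟨hs, hx⟩)).trans (le_max_left _ _)) (hη01 x).1
    · simp [image_eq_zero_of_notMem_tsupport hx]
  have hYη := (hΓ.isClassicalSolution_evolve hTm hη).negligible hL hΦ hacc
  have key : ∀ κ > 0, w t₀ x₀ ≤ J +
      κ * (T + 1 + 2 * (2 * T + (1 + T) * (1 + Real.exp (T - t₀) * Φ x₀))) := by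
    intro κ hκ
    obtain ⟨δ₁, hδ₁, H₁⟩ := hwn κ hκ
    obtain ⟨δ₂, hδ₂, H₂⟩ := (hYη.const_mul M) κ hκ
    -- The order of choices matters: `l` and `u` depend only on `w` and on the evolution of `η`,
    -- while the cut-off `χ` of the positive part is chosen afterwards. This is possible because
    -- lower bounds for the potential on the sides see only the negative part `≤ M η`.
    obtain ⟨l, hl0, hl⟩ : ∃ l, 0 < l ∧ l < min (min δ₁ δ₂) x₀ :=
      exists_between (lt_min (lt_min hδ₁ hδ₂) hx₀.1)
    obtain ⟨u, hu, huL⟩ : ∃ u, max (max (L - δ₁) (L - δ₂)) x₀ < u ∧ u < L :=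
      exists_between (max_lt (max_lt (by linarith) (by linarith)) hx₀.2)
    have hlx : l < x₀ := hl.trans_le (min_le_right _ _)
    have hl1 : l < δ₁ := hl.trans_le ((min_le_left _ _).trans (min_le_left _ _))
    have hl2 : l < δ₂ := hl.trans_le ((min_le_left _ _).trans (min_le_right _ _))
    have hxu : x₀ < u := (le_max_right _ _).trans_lt hu
    have hu1 : L - δ₁ < u := ((le_max_left _ _).trans (le_max_left _ _)).trans_lt hu
    have hu2 : L - δ₂ < u := ((le_max_right _ _).trans (le_max_left _ _)).trans_lt hu
    have hsub : Icc l u ⊆ Ioo 0 L := fun z hz => ⟨hl0.trans_le hz.1, hz.2.trans_lt huL⟩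
    have hlm : l ∈ Ioo 0 L := hsub ⟨le_rfl, (hlx.trans hxu).le⟩
    have hum : u ∈ Ioo 0 L := hsub ⟨(hlx.trans hxu).le, le_rfl⟩
    obtain ⟨χ, hχ, hχ1, hχ01⟩ := exists_isTest_eq_one isCompact_Icc hsub
    -- `H` has compact support, dominates `F` on `[l, u]`, and lies below `truncate F η` on `(0,
    -- L)`: the first serves the comparison, the second the final integral.
    set H : ℝ → ℝ → ℝ := fun s x => max (F s x) 0 * χ x - max (-F s x) 0 * η x with hH
    have hHc : Continuous fun p : ℝ × ℝ => H p.1 p.2 :=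
      (continuous_mul_isTest (F := fun s x => max (F s x) 0) hFp hχ).sub
        (continuous_mul_isTest (F := fun s x => max (-F s x) 0) hFn hη)
    have hslice : ∀ {G : ℝ → ℝ → ℝ},
        ContinuousOn (fun p : ℝ × ℝ => G p.1 p.2) (univ ×ˢ Ioo 0 L) → ∀ s,
        ContinuousOn (G s) (Ioo 0 L) := fun hG s =>
      hG.comp (f := fun x : ℝ => (s, x)) (by fun_prop) fun x hx => ⟨mem_univ _, hx⟩
    have hHt : ∀ s, IsTest L (H s) := fun s =>
      (hχ.mul (hslice (G := fun s x => max (F s x) 0) hFp s)).sub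
        (hη.mul (hslice (G := fun s x => max (-F s x) 0) hFn s))
    have hH0 : ∀ s, ∀ x ∉ tsupport χ ∪ tsupport η, H s x = 0 := fun s x hx => by
      rw [mem_union, not_or] at hx
      simp [hH, image_eq_zero_of_notMem_tsupport hx.1, image_eq_zero_of_notMem_tsupport hx.2]
    obtain ⟨I, φ, hφ, happ⟩ := exists_sum_exp_mul_isTest_near hHc T
      (hχ.hasCompactSupport.isCompact.union hη.hasCompactSupport.isCompact)
      (union_subset hχ.tsupport_subset hη.tsupport_subset) hH0 hκ
    set N : ℝ → ℝ → ℝ := fun s x => ∑ k ∈ I, Real.exp (-k * s) * φ k x with hN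
    have hNt : ∀ s, IsTest L (N s) := fun s => IsTest.sum I fun k _ => (hφ k).const_mul _
    set Y : ℕ → ℝ → ℝ → ℝ := fun k => evolve Γ L (φ k) T
    have hY : ∀ k ∈ I, IsClassicalSolution acc L T b σ (fun _ => 0) (φ k) (fun _ => 0)
        (fun _ => 0) (Y k) := fun k _ => hΓ.isClassicalSolution_evolve hTm (hφ k)
    have hYsum : ∀ s, ∀ r ∈ Icc 0 T, ∀ x ∈ Icc 0 L,
        ∑ k ∈ I, Real.exp (-k * s) * Y k r x = evolve Γ L (N s) T r x := by
      intro s r hr x hx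
      rw [hN, hΓ.evolve_sum hL hTm hr hx I fun k _ => (hφ k).const_mul _]
      exact Finset.sum_congr rfl fun k _ => (IsFundamentalSolution.evolve_const_mul _).symm
    -- lower bound of the evolution of the approximating source
    have hlow : ∀ s ∈ Icc 0 T, ∀ r ∈ Icc 0 T, ∀ x ∈ Ioo 0 L,
        -κ - M * evolve Γ L η T r x ≤ ∑ k ∈ I, Real.exp (-k * s) * Y k r x := by
      intro s hs r hr x hx
      have hx' := Ioo_subset_Icc_self hx
      rw [hYsum s r hr x hx']
      have h1 : evolve Γ L (fun y => -1 * (N s y + M * η y)) T r x ≤ κ := by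
        refine hΓ.evolve_le hL hΦ hacc hTm hr hx (((hNt s).add (hη.const_mul M)).const_mul _)
          hκ.le fun y => ?_
        have a1 := (abs_le.1 (happ s hs y)).1
        have a2 := hFM s hs y
        have a3 : 0 ≤ max (F s y) 0 * χ y := mul_nonneg (le_max_right _ _) (hχ01 y).1
        simp only [hN, hH] at a1 ⊢
        linarith
      rw [IsFundamentalSolution.evolve_const_mul,
        hΓ.evolve_add hL hTm hr hx' (hNt s) (hη.const_mul M),
        IsFundamentalSolution.evolve_const_mul] at h1
      linarith
    have g1 : ∀ t ∈ Icc 0 T, ∀ x ∈ Icc l u, F t x - 2 * κ ≤ N t x := by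
      intro t ht x hx
      have a1 := (abs_le.1 (happ t ht x)).1
      have a2 : F t x ≤ H t x := by
        simp only [hH]
        rw [hχ1 x hx, mul_one]
        have : max (-F t x) 0 * η x ≤ max (-F t x) 0 * 1 := by
          gcongr; exact (hη01 x).2
        rcases le_total (F t x) 0 with h | h
        · rw [max_eq_left (by linarith : 0 ≤ -F t x)] at this ⊢; rw [max_eq_right h]; linarith
        · rw [max_eq_right (by linarith : -F t x ≤ 0)] at this ⊢; rw [max_eq_left h]; linarith
      simp only [hN]
      linarith
    have g2 : ∀ t ∈ Icc 0 T, w t l ≤ 2 * κ * (1 + Φ l) := by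
      intro t ht
      have := (abs_le.1 ((H₁ t ht l hlm).1 hl1)).2
      have h0 := hΦ.nonneg l hlm
      nlinarith
    have g3 : ∀ t ∈ Icc 0 T, w t u ≤ 2 * κ := by
      intro t ht
      linarith [(abs_le.1 ((H₁ t ht u hum).2 hu1)).2]
    have g4 : ∀ t ∈ Icc 0 T, ∀ r ∈ Icc t T,
        -(2 * κ * (1 + Φ l)) ≤ ∑ k ∈ I, Real.exp (-k * (t + T - r)) * Y k r l := by
      intro t ht r hr
      have hr' : r ∈ Icc 0 T := ⟨ht.1.trans hr.1, hr.2⟩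
      have h1 := hlow (t + T - r) ⟨by linarith [ht.1, hr.2], by linarith [hr.1]⟩ r hr' l hlm
      have h2 := (abs_le.1 ((H₂ r hr' l hlm).1 hl2)).2
      have h0 := hΦ.nonneg l hlm
      nlinarith
    have g5 : ∀ t ∈ Icc 0 T, ∀ r ∈ Icc t T,
        -(2 * κ) ≤ ∑ k ∈ I, Real.exp (-k * (t + T - r)) * Y k r u := by
      intro t ht r hr
      have hr' : r ∈ Icc 0 T := ⟨ht.1.trans hr.1, hr.2⟩
      have h1 := hlow (t + T - r) ⟨by linarith [ht.1, hr.2], by linarith [hr.1]⟩ r hr' u hum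
      have h2 := (abs_le.1 ((H₂ r hr' u hum).2 hu2)).2
      linarith
    -- The tolerance is `2κ` because the lateral bounds combine the approximation error with the
    -- boundary size of `M` times the evolution of `η`. Taking `ε < κ / M` makes the time layer
    -- omitted by the cut-off cost at most `κ`.
    obtain ⟨ε, ⟨hε0, hε1⟩, hεT, hw⟩ := le_sum_potential I hΦ hwc hwp hwT
      (by positivity : 0 < 2 * κ) hl0 huL ⟨hlx, hxu⟩ ht₀ hY g1 g2 g3 g4 g5
      (ε₁ := κ / M) (by positivity)
    -- the potential as an integral over terminal times
    set z : ℝ → ℝ := fun s => ∑ k ∈ I, Real.exp (-k * s) * Y k (t₀ + T - s) x₀ with hz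
    have hzc : ∀ k ∈ I, ContinuousOn (fun s => Real.exp (-k * s) * Y k (t₀ + T - s) x₀)
        (uIcc (t₀ + ε) T) := by
      intro k hk
      rw [uIcc_of_le hεT.le]
      refine ContinuousOn.mul (by fun_prop) ((hY k hk).continuousOn.comp
        (f := fun s : ℝ => (t₀ + T - s, x₀)) (by fun_prop) fun s hs => ⟨⟨?_, ?_⟩, hx₀'⟩)
      · linarith [hs.2, ht₀.1]
      · linarith [hs.1]
    have hpot : ∑ k ∈ I, potential T (T - ε) k (Y k) t₀ x₀ = ∫ s in (t₀ + ε)..T, z s := by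
      rw [hz, intervalIntegral.integral_finsetSum fun k hk => (hzc k hk).intervalIntegrable]
      refine Finset.sum_congr rfl fun k _ => ?_
      have e1 : ∀ s, Real.exp (-k * s) * Y k (t₀ + T - s) x₀ =
          (fun r => Real.exp (-k * (t₀ + T - r)) * Y k r x₀) (t₀ + T - s) := fun s => by
        simp only [sub_sub_cancel]
      simp only [e1]
      rw [intervalIntegral.integral_comp_sub_left
        (fun r => Real.exp (-k * (t₀ + T - r)) * Y k r x₀), potential,
        ← intervalIntegral.integral_const_mul]
      have e2 : t₀ + T - T = t₀ := by ring
      have e3 : t₀ + T - (t₀ + ε) = T - ε := by ring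
      rw [e2, e3]
      refine intervalIntegral.integral_congr fun r _ => ?_
      rw [← mul_assoc, ← Real.exp_add]
      ring_nf
    have hmem : ∀ s ∈ Ioo t₀ T, s ∈ Ioc 0 T ∧ t₀ ∈ Ico 0 s := fun s hs =>
      ⟨⟨ht₀.1.trans_lt hs.1, hs.2.le⟩, ht₀.1, hs.1⟩
    have hev : ∀ (ψ : ℝ → ℝ), ∀ s ∈ Ioo t₀ T,
        evolve Γ L ψ s t₀ x₀ = ∫ y in Ioo 0 L, Γ t₀ x₀ s y * ψ y := fun ψ s hs => by
      rw [evolve, if_pos hs.1, intervalIntegral.integral_of_le hL.le, integral_Ioc_eq_integral_Ioo]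
    -- By time homogeneity `z s` is the evolution of the approximating source from time `s`;
    -- `evolve_le` bounds its error, and `Γ ≥ 0` allows `H` to be replaced by the larger truncated
    -- source.
    have hzj : ∀ᵐ s ∂(volume.restrict (Ioo t₀ T)), z s ≤ j s + κ := by
      filter_upwards [hjae, ae_restrict_mem measurableSet_Ioo] with s hsi hs
      obtain ⟨hs1, hs2⟩ := hmem s hs
      have hs3 : t₀ ∈ Icc 0 s := ⟨hs2.1, hs2.2.le⟩
      have e1 : z s = evolve Γ L (N s) s t₀ x₀ := by
        rw [hΓ.evolve_eq_evolve_add hL hΦ hacc hs1 hs3 hx₀ (hNt s),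
          ← hYsum s _ ⟨by linarith [hs1.2, ht₀.1], by linarith [hs.1]⟩ x₀ hx₀', hz]
        simp only [add_sub_assoc]
      have h1 : evolve Γ L (fun y => N s y + -1 * H s y) s t₀ x₀ ≤ κ := by
        refine hΓ.evolve_le hL hΦ hacc hs1 hs3 hx₀ ((hNt s).add ((hHt s).const_mul _))
          hκ.le fun y => ?_
        have := (abs_le.1 (happ s ⟨hs1.1.le, hs1.2⟩ y)).2
        simp only [hN]
        linarith
      rw [hΓ.evolve_add hL hs1 hs3 hx₀' (hNt s) ((hHt s).const_mul _),
        IsFundamentalSolution.evolve_const_mul] at h1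
      have h2 : evolve Γ L (H s) s t₀ x₀ ≤ j s := by
        rw [hev (H s) s hs, hj]
        refine setIntegral_mono_on (hΓ.integrableOn_mul_test hs1 hs2 hx₀' (hHt s)) hsi
          measurableSet_Ioo fun y hy => ?_
        refine mul_le_mul_of_nonneg_left ?_ (hΓ.nonneg s hs1 t₀ hs2 x₀ hx₀' y hy)
        simp only [hH, truncate]
        have : max (F s y) 0 * χ y ≤ max (F s y) 0 * 1 := by
          gcongr; exact (hχ01 y).2
        linarith
      linarith
    -- The cut-off potential lacks the terminal times in `[t₀, t₀ + ε]`; there a lower bound for `j`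
    -- is enough.
    have hjM : ∀ᵐ s ∂(volume.restrict (Ioo t₀ T)), -M ≤ j s := by
      filter_upwards [hjae, ae_restrict_mem measurableSet_Ioo] with s hsi hs
      obtain ⟨hs1, hs2⟩ := hmem s hs
      have h1 : evolve Γ L η s t₀ x₀ ≤ 1 := hΓ.evolve_le hL hΦ hacc hs1
        ⟨hs2.1, hs2.2.le⟩ hx₀ hη zero_le_one fun y => (hη01 y).2
      have h2 : evolve Γ L (fun y => -M * η y) s t₀ x₀ ≤ j s := by
        rw [hev _ s hs, hj]
        refine setIntegral_mono_on (hΓ.integrableOn_mul_test hs1 hs2 hx₀' (hη.const_mul _)) hsi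
          measurableSet_Ioo fun y hy => ?_
        refine mul_le_mul_of_nonneg_left ?_ (hΓ.nonneg s hs1 t₀ hs2 x₀ hx₀' y hy)
        have a1 := hFM s ⟨hs1.1.le, hs1.2⟩ y
        have a2 := le_max_right (F s y) 0
        simp only [truncate]
        linarith
      rw [IsFundamentalSolution.evolve_const_mul] at h2
      nlinarith
    have hjI : ∀ {a c : ℝ}, a ∈ Icc t₀ T → c ∈ Icc t₀ T → IntervalIntegrable j volume a c := by
      intro a c ha hc
      refine IntervalIntegrable.mono_set (a := t₀) (b := T) ?_ ?_
      · rw [intervalIntegrable_iff_integrableOn_Ioo_of_le ht₀.2.le]; exact hjint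
      · rw [uIcc_of_le ht₀.2.le]; exact ordConnected_Icc.uIcc_subset ha hc
    have m1 : t₀ ∈ Icc t₀ T := ⟨le_rfl, ht₀.2.le⟩
    have m2 : t₀ + ε ∈ Icc t₀ T := ⟨by linarith, hεT.le⟩
    have m3 : T ∈ Icc t₀ T := ⟨ht₀.2.le, le_rfl⟩
    have hsplit : J = (∫ s in t₀..(t₀ + ε), j s) + ∫ s in (t₀ + ε)..T, j s := by
      rw [intervalIntegral.integral_add_adjacent_intervals (hjI m1 m2) (hjI m2 m3), hJj,
        intervalIntegral.integral_of_le ht₀.2.le, integral_Ioc_eq_integral_Ioo]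
    have hae : ∀ {P : ℝ → Prop}, (∀ᵐ s ∂(volume.restrict (Ioo t₀ T)), P s) →
        ∀ {a c : ℝ}, a ∈ Icc t₀ T → c ∈ Icc t₀ T →
        ∀ᵐ s ∂(volume.restrict (Icc a c)), P s := by
      intro P hP a c ha hc
      rw [← restrict_Ioo_eq_restrict_Icc]
      exact ae_restrict_of_ae_restrict_of_subset (Ioo_subset_Ioo ha.1 hc.2) hP
    have hI1 : -M * ε ≤ ∫ s in t₀..(t₀ + ε), j s := by
      have := intervalIntegral.integral_mono_ae_restrict (by linarith : t₀ ≤ t₀ + ε)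
        intervalIntegrable_const (hjI m1 m2) (hae hjM m1 m2)
      rw [intervalIntegral.integral_const, smul_eq_mul] at this
      linarith
    have hI2 : ∫ s in (t₀ + ε)..T, z s ≤ (∫ s in (t₀ + ε)..T, j s) + κ * T := by
      have := intervalIntegral.integral_mono_ae_restrict hεT.le
        (continuousOn_finsetSum I hzc).intervalIntegrable
        ((hjI m2 m3).add intervalIntegrable_const) (hae hzj m2 m3)
      rw [intervalIntegral.integral_add (hjI m2 m3) intervalIntegrable_const,
        intervalIntegral.integral_const, smul_eq_mul] at this
      have h3 : (T - (t₀ + ε)) * κ ≤ T * κ := by gcongr; linarith [ht₀.1]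
      linarith
    have hMε : M * ε ≤ κ := by
      rw [lt_div_iff₀ hM] at hε1
      linarith
    rw [hpot] at hw
    linarith
  have hlim : Tendsto (fun κ : ℝ => J +
      κ * (T + 1 + 2 * (2 * T + (1 + T) * (1 + Real.exp (T - t₀) * Φ x₀)))) (𝓝[>] 0)
      (𝓝 (J + 0 * (T + 1 + 2 * (2 * T + (1 + T) * (1 + Real.exp (T - t₀) * Φ x₀))))) :=
    (Continuous.tendsto (by fun_prop) 0).mono_left nhdsWithin_le_nhds
  rw [zero_mul, add_zero] at hlim
  exact ge_of_tendsto hlim (eventually_mem_nhdsWithin.mono fun κ hκ => key κ hκ)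

theorem exists_isTest_tendsto_one {L : ℝ} (hL : 0 < L) :
    ∃ η : ℕ → ℝ → ℝ, (∀ n, IsTest L (η n)) ∧ (∀ n x, η n x ∈ Icc (0 : ℝ) 1) ∧
      ∀ x ∈ Ioo 0 L, ∀ᶠ n in atTop, η n x = 1 := by
  have h : ∀ n : ℕ, Icc (L / (n + 2)) (L - L / (n + 2)) ⊆ Ioo 0 L := fun n x hx => by
    have : 0 < L / ((n : ℝ) + 2) := by positivity
    exact ⟨this.trans_le hx.1, by linarith [hx.2]⟩
  choose η h1 h2 h3 using fun n => exists_isTest_eq_one isCompact_Icc (h n)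
  refine ⟨η, h1, h3, fun x hx => ?_⟩
  have hlim : Tendsto (fun n : ℕ => L / ((n : ℝ) + 2)) atTop (𝓝 0) :=
    Tendsto.div_atTop tendsto_const_nhds
      (tendsto_atTop_add_const_right _ _ tendsto_natCast_atTop_atTop)
  filter_upwards [hlim.eventually_lt_const hx.1,
    hlim.eventually_lt_const (sub_pos.2 hx.2)] with n a1 a2
  exact h2 n x ⟨a1.le, by linarith⟩

/-- The cut-off of the negative part is removed by dominated convergence, with the absolutely
integrable integrand itself as majorant. -/
theorem IsFundamentalSolution.le_integral (hΓ : IsFundamentalSolution acc L T b σ Γ)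
    (hL : 0 < L) (hΦ : IsBarrier L b σ Φ) (hacc : acc ∨ Tendsto Φ (𝓝[>] 0) atTop)
    (hwc : ContinuousOn (fun p : ℝ × ℝ => w p.1 p.2) (Icc 0 T ×ˢ Ioo 0 L))
    (hwp : ∀ t ∈ Ioo 0 T, ∀ x ∈ Ioo 0 L, HasParabolicAt b σ w t x (-F t x))
    (hwT : ∀ x ∈ Ioo 0 L, w T x = 0) (hwn : NegligibleAtBoundary L T Φ w)
    (hF : ContinuousOn (fun p : ℝ × ℝ => F p.1 p.2) (univ ×ˢ Ioo 0 L))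
    (ht₀ : t₀ ∈ Ico 0 T) (hx₀ : x₀ ∈ Ioo 0 L)
    (hinteg : IntegrableOn (fun p : ℝ × ℝ => Γ t₀ x₀ p.1 p.2 * F p.1 p.2)
      (Ioo t₀ T ×ˢ Ioo 0 L)) :
    w t₀ x₀ ≤ ∫ p in Ioo t₀ T ×ˢ Ioo 0 L, Γ t₀ x₀ p.1 p.2 * F p.1 p.2 := by
  obtain ⟨η, h1, h01, hlim⟩ := exists_isTest_tendsto_one hL
  refine ge_of_tendsto (f := fun n : ℕ => ∫ p in Ioo t₀ T ×ˢ Ioo 0 L,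
    Γ t₀ x₀ p.1 p.2 * truncate F (η n) p.1 p.2) (x := atTop) ?_ (Eventually.of_forall fun n =>
      hΓ.le_integral_truncate hL hΦ hacc hwc hwp hwT hwn hF ht₀ hx₀ hinteg (h1 n) (h01 n))
  refine tendsto_integral_of_dominated_convergence
    (fun p => ‖Γ t₀ x₀ p.1 p.2 * F p.1 p.2‖)
    (fun n => (hΓ.integrableOn_truncate ht₀ hx₀ hinteg (h1 n).continuous
      (h01 n)).aestronglyMeasurable) hinteg.norm (fun n => Eventually.of_forall fun p => ?_) ?_
  · rw [norm_mul, norm_mul]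
    gcongr
    rw [Real.norm_eq_abs, Real.norm_eq_abs, truncate]
    have h := h01 n p.2
    rcases le_total (F p.1 p.2) 0 with h' | h'
    · rw [max_eq_right h', max_eq_left (by linarith), zero_sub, abs_neg, abs_mul, abs_neg,
        abs_of_nonneg h.1]
      exact mul_le_of_le_one_right (abs_nonneg _) h.2
    · rw [max_eq_left h', max_eq_right (by linarith), zero_mul, sub_zero]
  · filter_upwards [ae_restrict_mem (measurableSet_Ioo.prod measurableSet_Ioo)] with p hp
    refine tendsto_const_nhds.congr' ?_
    filter_upwards [hlim p.2 hp.2] with n hn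
    rw [truncate, hn, mul_one]
    rcases le_total (F p.1 p.2) 0 with h' | h'
    · rw [max_eq_right h', max_eq_left (by linarith)]; ring
    · rw [max_eq_left h', max_eq_right (by linarith)]; ring

/-- Duhamel's formula for a solution of the inhomogeneous equation with zero data. -/
theorem IsFundamentalSolution.eq_integral (hΓ : IsFundamentalSolution acc L T b σ Γ)
    (hL : 0 < L) (hΦ : IsBarrier L b σ Φ) (hacc : acc ∨ Tendsto Φ (𝓝[>] 0) atTop)
    (hwc : ContinuousOn (fun p : ℝ × ℝ => w p.1 p.2) (Icc 0 T ×ˢ Ioo 0 L))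
    (hwp : ∀ t ∈ Ioo 0 T, ∀ x ∈ Ioo 0 L, HasParabolicAt b σ w t x (-F t x))
    (hwT : ∀ x ∈ Ioo 0 L, w T x = 0) (hwn : NegligibleAtBoundary L T Φ w)
    (hF : ContinuousOn (fun p : ℝ × ℝ => F p.1 p.2) (univ ×ˢ Ioo 0 L))
    (ht₀ : t₀ ∈ Ico 0 T) (hx₀ : x₀ ∈ Ioo 0 L)
    (hinteg : IntegrableOn (fun p : ℝ × ℝ => Γ t₀ x₀ p.1 p.2 * F p.1 p.2)
      (Ioo t₀ T ×ˢ Ioo 0 L)) :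
    w t₀ x₀ = ∫ s in t₀..T, ∫ y in 0..L, Γ t₀ x₀ s y * F s y := by
  have h1 := hΓ.le_integral hL hΦ hacc hwc hwp hwT hwn hF ht₀ hx₀ hinteg
  have h2 := hΓ.le_integral (F := fun s y => -F s y) hL hΦ hacc hwc.neg
    (fun t ht x hx => (hwp t ht x hx).neg) (fun x hx => by simp [hwT x hx]) hwn.neg hF.neg ht₀ hx₀
    (by simp only [mul_neg]; exact hinteg.neg)
  simp only [mul_neg, integral_neg] at h2
  have h3 : w t₀ x₀ = ∫ p in Ioo t₀ T ×ˢ Ioo 0 L, Γ t₀ x₀ p.1 p.2 * F p.1 p.2 := by linarith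
  rw [h3, intervalIntegral.integral_of_le ht₀.2.le, integral_Ioc_eq_integral_Ioo,
    Measure.volume_eq_prod, setIntegral_prod _ hinteg]
  simp only [intervalIntegral.integral_of_le hL.le, integral_Ioc_eq_integral_Ioo]

end Duhamel

/-! ### Scale potentials and their divergence at `0`. -/

theorem antitoneOn_Ioc_of_hasDerivAt_nonpos {g g' : ℝ → ℝ} {z : ℝ}
    (hg : ∀ x ∈ Ioc 0 z, HasDerivAt g (g' x) x) (hg' : ∀ x ∈ Ioc 0 z, g' x ≤ 0) :
    AntitoneOn g (Ioc 0 z) :=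
  antitoneOn_of_hasDerivWithinAt_nonpos (convex_Ioc 0 z)
    (fun x hx => (hg x hx).continuousAt.continuousWithinAt)
    (fun x hx => (hg x (interior_subset hx)).hasDerivWithinAt)
    fun x hx => hg' x (interior_subset hx)

theorem tendsto_atTop_of_antitoneOn_Ioc {g : ℝ → ℝ} {z : ℝ}
    (hg : AntitoneOn g (Ioc 0 z)) (hub : ¬∃ K, ∀ x ∈ Ioc 0 z, g x ≤ K) :
    Tendsto g (𝓝[>] 0) atTop := by
  refine tendsto_atTop.2 fun K => ?_
  push Not at hub
  obtain ⟨x, hx, hxK⟩ := hub K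
  filter_upwards [Ioo_mem_nhdsGT hx.1] with y hy
  exact hxK.le.trans (hg ⟨hy.1, hy.2.le.trans hx.2⟩ hx hy.2.le)

theorem exists_tendsto_of_antitoneOn_Ioc {g : ℝ → ℝ} {z K : ℝ} (hz : 0 < z)
    (hg : AntitoneOn g (Ioc 0 z)) (hK : ∀ x ∈ Ioc 0 z, g x ≤ K) :
    ∃ l, Tendsto g (𝓝[>] 0) (𝓝 l) :=
  ⟨_, AntitoneOn.tendsto_nhdsWithin_Ioo_right (nonempty_Ioo.2 hz) (hg.mono Ioo_subset_Ioc_self)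
    ⟨K, by rintro _ ⟨x, hx, rfl⟩; exact hK x (Ioo_subset_Ioc_self hx)⟩⟩

theorem lintegral_lt_top_of_integral_le {g : ℝ → ℝ} {L z K : ℝ} (hz : z ∈ Ioo 0 L)
    (hg : ContinuousOn g (Ioo 0 L)) (hpos : ∀ x ∈ Ioo 0 L, 0 ≤ g x)
    (hK : ∀ x ∈ Ioc 0 z, ∫ y in x..z, g y ≤ K) :
    ∫⁻ y in Ioo 0 z, ENNReal.ofReal (g y) < ⊤ := by
  have hmem : ∀ n : ℕ, z / (n + 1) ∈ Ioc 0 z := fun n => by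
    refine ⟨div_pos hz.1 (by positivity), div_le_self hz.1.le ?_⟩
    linarith [n.cast_nonneg (α := ℝ)]
  have hsub : ∀ n : ℕ, Ioc (z / (n + 1)) z ⊆ Ioo 0 L := fun n x hx =>
    ⟨(hmem n).1.trans hx.1, hx.2.trans_lt hz.2⟩
  have hinteg : IntegrableOn g (Ioc 0 z) := by
    refine integrableOn_Ioc_of_intervalIntegral_norm_bounded_left (I := K) (l := atTop)
      (a := fun n : ℕ => z / (n + 1)) (fun n => ?_) ?_ (Eventually.of_forall fun n => ?_)
    · refine (ContinuousOn.integrableOn_Icc (hg.mono fun x hx => ?_)).mono_set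
        Ioc_subset_Icc_self
      exact ⟨(hmem n).1.trans_le hx.1, hx.2.trans_lt hz.2⟩
    · exact Tendsto.div_atTop tendsto_const_nhds
        (tendsto_atTop_add_const_right _ _ tendsto_natCast_atTop_atTop)
    · have := hK _ (hmem n)
      rw [intervalIntegral.integral_of_le (hmem n).2] at this
      refine le_trans (le_of_eq ?_) this
      exact setIntegral_congr_fun measurableSet_Ioc fun x hx =>
        Real.norm_of_nonneg (hpos x (hsub n hx))
  exact Integrable.lintegral_lt_top (hinteg.mono_set Ioo_subset_Ioc_self)

/-- The second primitive `∫ₓᶻ S(y) ∫_y^z m(r) dr dy` of the speed density `m = 2 / (σ² S)` with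
respect to the scale density `S`. -/
def scalePotential (σ S : ℝ → ℝ) (z x : ℝ) : ℝ :=
  ∫ y in x..z, S y * ∫ r in y..z, 2 / (σ r ^ 2 * S r)

section ScalePotential

variable {L z : ℝ} {β σ S : ℝ → ℝ}

theorem continuousOn_speed (hσ : ContinuousOn σ (Ioo 0 L)) (hσpos : ∀ x ∈ Ioo 0 L, 0 < σ x)
    (hSpos : ∀ x ∈ Ioo 0 L, 0 < S x) (hS : ContinuousOn S (Ioo 0 L)) :
    ContinuousOn (fun r => 2 / (σ r ^ 2 * S r)) (Ioo 0 L) :=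
  continuousOn_const.div ((hσ.pow 2).mul hS) fun x hx =>
    (mul_pos (pow_pos (hσpos x hx) 2) (hSpos x hx)).ne'

theorem hasDerivAt_scalePotential (hσ : ContinuousOn σ (Ioo 0 L))
    (hσpos : ∀ x ∈ Ioo 0 L, 0 < σ x) (hSpos : ∀ x ∈ Ioo 0 L, 0 < S x)
    (hS : ContinuousOn S (Ioo 0 L)) (hz : z ∈ Ioo 0 L) {x : ℝ} (hx : x ∈ Ioo 0 L) :
    HasDerivAt (scalePotential σ S z) (-(S x * ∫ r in x..z, 2 / (σ r ^ 2 * S r))) x := by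
  have hm := continuousOn_speed hσ hσpos hSpos hS
  refine hasDerivAt_integral_left_of_continuousOn_Ioo (α := 0) (β := L)
    (hS.mul fun y hy => ?_) hx hz
  exact (hasDerivAt_integral_left_of_continuousOn_Ioo hm hy hz).continuousAt.continuousWithinAt

theorem scalePotential_nonneg (hσpos : ∀ x ∈ Ioo 0 L, 0 < σ x) (hSpos : ∀ x ∈ Ioo 0 L, 0 < S x)
    (hz : z ∈ Ioo 0 L) {x : ℝ} (hx : x ∈ Ioo 0 L) : 0 ≤ scalePotential σ S z x := by
  have hm : ∀ r ∈ Ioo 0 L, 0 ≤ 2 / (σ r ^ 2 * S r) := fun r hr => by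
    have := hσpos r hr
    have := hSpos r hr
    positivity
  unfold scalePotential
  rcases le_total x z with h | h
  · refine intervalIntegral.integral_nonneg h fun y hy => ?_
    have hy' : y ∈ Ioo 0 L := ⟨hx.1.trans_le hy.1, hy.2.trans_lt hz.2⟩
    refine mul_nonneg (hSpos y hy').le (intervalIntegral.integral_nonneg hy.2 fun r hr => ?_)
    exact hm r ⟨hy'.1.trans_le hr.1, hr.2.trans_lt hz.2⟩
  · rw [intervalIntegral.integral_symm, ← intervalIntegral.integral_neg]
    refine intervalIntegral.integral_nonneg h fun y hy => ?_
    have hy' : y ∈ Ioo 0 L := ⟨hz.1.trans_le hy.1, hy.2.trans_lt hx.2⟩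
    rw [intervalIntegral.integral_symm, mul_neg, neg_neg]
    refine mul_nonneg (hSpos y hy').le (intervalIntegral.integral_nonneg hy.1 fun r hr => ?_)
    exact hm r ⟨hz.1.trans_le hr.1, hr.2.trans_lt hy'.2⟩

/-- The equation for `S` makes it a scale density, so the generator is `½ σ² S (S⁻¹ φ')'`; here `S⁻¹
φ'` is minus the integral of the speed density from `x` to `z`. -/
theorem hasGeneratorAt_scalePotential (hσ : ContinuousOn σ (Ioo 0 L))
    (hσpos : ∀ x ∈ Ioo 0 L, 0 < σ x) (hSpos : ∀ x ∈ Ioo 0 L, 0 < S x)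
    (hS : ∀ x ∈ Ioo 0 L, HasDerivAt S (-(2 * β x / σ x ^ 2) * S x) x) (hz : z ∈ Ioo 0 L) {x : ℝ}
    (hx : x ∈ Ioo 0 L) : HasGeneratorAt β σ (scalePotential σ S z) x 1 := by
  have hSc : ContinuousOn S (Ioo 0 L) := fun y hy => (hS y hy).continuousAt.continuousWithinAt
  have hm := continuousOn_speed hσ hσpos hSpos hSc
  refine ⟨fun y => -(S y * ∫ r in y..z, 2 / (σ r ^ 2 * S r)), _, ?_,
    ((hS x hx).fun_mul (hasDerivAt_integral_left_of_continuousOn_Ioo hm hx hz)).neg, ?_⟩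
  · filter_upwards [isOpen_Ioo.mem_nhds hx] with y hy
    exact hasDerivAt_scalePotential hσ hσpos hSpos hSc hz hy
  · have h1 := (hσpos x hx).ne'
    have h2 := (hSpos x hx).ne'
    field_simp
    ring

end ScalePotential

/-- Divergence of the potential of the transformed diffusion: `ψ` plays the role of a decreasing
solution which blows up at `0`, `q` that of minus its scale derivative. -/
theorem tendsto_atTop_of_transformed_potential {L z : ℝ} {s m ψ q v : ℝ → ℝ} (hz : z ∈ Ioo 0 L)
    (hs : ∀ x ∈ Ioo 0 L, 0 < s x) (hm : ∀ x ∈ Ioo 0 L, 0 < m x) (hψ : ∀ x ∈ Ioo 0 L, 0 < ψ x)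
    (hmc : ContinuousOn m (Ioo 0 L))
    (hψ' : ∀ x ∈ Ioo 0 L, HasDerivAt ψ (-(s x * q x)) x)
    (hq' : ∀ x ∈ Ioo 0 L, HasDerivAt q (-(m x * (x * ψ x))) x) (hqz : 0 < q z)
    (hψtop : Tendsto ψ (𝓝[>] 0) atTop)
    (hmψ : Tendsto (fun y => ∫ r in y..z, m r * ψ r) (𝓝[>] 0) atTop)
    (hv : ∀ x ∈ Ioo 0 L,
      HasDerivAt v (-(s x / ψ x ^ 2 * ∫ r in x..z, m r * ψ r ^ 2)) x) :
    Tendsto v (𝓝[>] 0) atTop := by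
  have hsub : Ioc 0 z ⊆ Ioo 0 L := fun x hx => ⟨hx.1, hx.2.trans_lt hz.2⟩
  have hzz : z ∈ Ioc 0 z := ⟨hz.1, le_rfl⟩
  have hL : 0 < L := hz.1.trans hz.2
  have hψc : ContinuousOn ψ (Ioo 0 L) := fun y hy => (hψ' y hy).continuousAt.continuousWithinAt
  set A : ℝ → ℝ := fun y => ∫ r in y..z, m r * ψ r ^ 2 with hA
  set R : ℝ → ℝ := fun y => q z + ∫ r in y..z, m r * ψ r with hR
  have hA' : ∀ x ∈ Ioc 0 z, HasDerivAt A (-(m x * ψ x ^ 2)) x := fun x hx =>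
    hasDerivAt_integral_left_of_continuousOn_Ioo (hmc.mul (hψc.pow 2)) (hsub hx) hz
  have hR' : ∀ x ∈ Ioc 0 z, HasDerivAt R (-(m x * ψ x)) x := fun x hx =>
    (hasDerivAt_integral_left_of_continuousOn_Ioo (hmc.mul hψc) (hsub hx) hz).const_add (q z)
  have hAz : A z = 0 := by simp [hA]
  have hRz : R z = q z := by simp [hR]
  have hRtop : Tendsto R (𝓝[>] 0) atTop := tendsto_atTop_add_const_left _ _ hmψ
  have hqpos : ∀ x ∈ Ioc 0 z, 0 < q x := fun x hx => hqz.trans_le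
    (antitoneOn_Ioc_of_hasDerivAt_nonpos (fun y hy => hq' y (hsub hy)) (fun y hy => by
      have := mul_pos (hm y (hsub hy)) (mul_pos hy.1 (hψ y (hsub hy)))
      linarith) hx hzz hx.2)
  have hA0 : ∀ x ∈ Ioc 0 z, 0 ≤ A x := fun x hx => by
    have := antitoneOn_Ioc_of_hasDerivAt_nonpos hA' (fun y hy => by
      have := mul_pos (hm y (hsub hy)) (pow_pos (hψ y (hsub hy)) 2)
      linarith) hx hzz hx.2
    rwa [hAz] at this
  have hRpos : ∀ x ∈ Ioc 0 z, 0 < R x := fun x hx => by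
    have := antitoneOn_Ioc_of_hasDerivAt_nonpos hR' (fun y hy => by
      have := mul_pos (hm y (hsub hy)) (hψ y (hsub hy))
      linarith) hx hzz hx.2
    rw [hRz] at this
    exact hqz.trans_le this
  -- `(L + 1) R - q` is antitone since `x < L + 1`, and it is nonnegative at `z`.
  have hqR : ∀ x ∈ Ioc 0 z, q x ≤ (L + 1) * R x := fun x hx => by
    have := antitoneOn_Ioc_of_hasDerivAt_nonpos
      (fun y hy => ((hR' y hy).const_mul (L + 1)).fun_sub (hq' y (hsub hy))) (fun y hy => by
        have h1 := mul_pos (hm y (hsub hy)) (hψ y (hsub hy))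
        have h2 := (hsub hy).2
        nlinarith) hx hzz hx.2
    simp only [hRz] at this
    nlinarith
  -- The terms `m ψ²` cancel in `(ψ R - A)' = -s q R ≤ 0`.
  have hAψR : ∀ x ∈ Ioc 0 z, A x ≤ ψ x * R x := fun x hx => by
    have := antitoneOn_Ioc_of_hasDerivAt_nonpos
      (fun y hy => ((hψ' y (hsub hy)).fun_mul (hR' y hy)).fun_sub (hA' y hy)) (fun y hy => by
        have := mul_pos (mul_pos (hs y (hsub hy)) (hqpos y hy)) (hRpos y hy)
        nlinarith) hx hzz hx.2
    simp only [hRz, hAz] at this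
    nlinarith [mul_pos (hψ z hz) hqz]
  set θ : ℝ → ℝ := fun y => A y / (ψ y * R y) with hθ
  have hψR : ∀ x ∈ Ioc 0 z, 0 < ψ x * R x := fun x hx => mul_pos (hψ x (hsub hx)) (hRpos x hx)
  have hθ1 : ∀ x ∈ Ioc 0 z, θ x ≤ 1 := fun x hx => (div_le_one (hψR x hx)).2 (hAψR x hx)
  have hvanti : AntitoneOn v (Ioc 0 z) :=
    antitoneOn_Ioc_of_hasDerivAt_nonpos (fun x hx => hv x (hsub hx)) fun x hx => by
      have h1 := hs x (hsub hx)
      have h2 := hA0 x hx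
      have : 0 ≤ s x / ψ x ^ 2 * A x := by positivity
      linarith
  by_contra hcon
  obtain ⟨K, hK⟩ : ∃ K, ∀ x ∈ Ioc 0 z, v x ≤ K := by
    by_contra h
    exact hcon (tendsto_atTop_of_antitoneOn_Ioc hvanti h)
  -- Suppose `v` is bounded. The bound on `q` lets `(L + 1) v'` absorb the only unsigned
  -- contribution of `q` to `θ'`, leaving `E' ≤ (1 - θ) (log R)'`. So `E` and `v` are monotone and
  -- bounded, and `θ` has a limit at `0`.
  set E : ℝ → ℝ := fun y => θ y + (L + 1) * v y with hE
  have hEK : ∀ x ∈ Ioc 0 z, E x ≤ 1 + (L + 1) * K := fun x hx => by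
    have h1 := hθ1 x hx
    have h2 := hK x hx
    simp only [hE]
    gcongr
  obtain ⟨E', hE', hE'le⟩ : ∃ E' : ℝ → ℝ, (∀ x ∈ Ioc 0 z, HasDerivAt E (E' x) x) ∧
      ∀ x ∈ Ioc 0 z, E' x ≤ -((1 - θ x) * (m x * ψ x / R x)) := by
    refine ⟨_, fun x hx => ((hA' x hx).fun_div ((hψ' x (hsub hx)).fun_mul (hR' x hx))
      (hψR x hx).ne').fun_add ((hv x (hsub hx)).const_mul (L + 1)), fun x hx => ?_⟩
    have h1 := (hψ x (hsub hx)).ne'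
    have h2 := (hRpos x hx).ne'
    have h3 : 0 ≤ s x * A x / (ψ x ^ 2 * R x) * ((L + 1) * R x - q x) :=
      mul_nonneg (div_nonneg (mul_nonneg (hs x (hsub hx)).le (hA0 x hx))
        (mul_pos (pow_pos (hψ x (hsub hx)) 2) (hRpos x hx)).le) (sub_nonneg.2 (hqR x hx))
    refine sub_nonpos.1 (le_of_eq_of_le ?_ (neg_nonpos.2 h3))
    change (-(m x * ψ x ^ 2) * (ψ x * R x) -
      A x * (-(s x * q x) * R x + ψ x * -(m x * ψ x))) / (ψ x * R x) ^ 2 +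
      (L + 1) * -(s x / ψ x ^ 2 * A x) - -((1 - A x / (ψ x * R x)) * (m x * ψ x / R x)) = _
    field_simp
    ring
  have hEanti : AntitoneOn E (Ioc 0 z) := antitoneOn_Ioc_of_hasDerivAt_nonpos hE' fun x hx => by
    refine (hE'le x hx).trans (neg_nonpos.2 (mul_nonneg (sub_nonneg.2 (hθ1 x hx)) ?_))
    exact (div_pos (mul_pos (hm x (hsub hx)) (hψ x (hsub hx))) (hRpos x hx)).le
  obtain ⟨lE, hlE⟩ := exists_tendsto_of_antitoneOn_Ioc hz.1 hEanti hEK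
  obtain ⟨lv, hlv⟩ := exists_tendsto_of_antitoneOn_Ioc hz.1 hvanti hK
  have hlθ : Tendsto θ (𝓝[>] 0) (𝓝 (lE - (L + 1) * lv)) := by
    refine (hlE.sub (hlv.const_mul (L + 1))).congr fun y => ?_
    simp only [hE]; ring
  have hpick : ∀ {P : ℝ → Prop}, (∀ᶠ x in 𝓝[>] (0 : ℝ), P x) →
      ∃ y ∈ Ioc 0 z, ∀ x ∈ Ioc 0 y, P x := by
    intro P hP
    obtain ⟨y, hy, h⟩ := mem_nhdsGT_iff_exists_Ioo_subset.1 hP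
    have hy0 : 0 < y := hy
    refine ⟨min (y / 2) z, ⟨lt_min (half_pos hy0) hz.1, min_le_right _ _⟩, fun x hx => ?_⟩
    exact h ⟨hx.1, (hx.2.trans (min_le_left _ _)).trans_lt (half_lt_self hy0)⟩
  -- If the limit is at most `1/2`, then `1 - θ > 1/4` near `0` and `E` grows at least like `¼ log
  -- R`. Otherwise `A ≥ ¼ ψ R`, and `v` grows at least like `log ψ / (4(L + 1))`. Either contradicts
  -- boundedness.
  rcases le_or_gt (lE - (L + 1) * lv) (1 / 2) with hcase | hcase
  · obtain ⟨y, hy, hθy⟩ := hpick (hlθ.eventually_lt_const (by linarith : _ < (3 / 4 : ℝ)))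
    have hsy : Ioc 0 y ⊆ Ioc 0 z := Ioc_subset_Ioc_right hy.2
    have hanti := antitoneOn_Ioc_of_hasDerivAt_nonpos
      (fun x hx => (hE' x (hsy hx)).fun_sub
        (((hR' x (hsy hx)).log (hRpos x (hsy hx)).ne').const_mul (1 / 4))) (fun x hx => by
      have h1 := hE'le x (hsy hx)
      have h2 := hθy x hx
      have h3 : 0 < m x * ψ x / R x :=
        div_pos (mul_pos (hm x (hsub (hsy hx))) (hψ x (hsub (hsy hx)))) (hRpos x (hsy hx))
      rw [neg_div]
      nlinarith)
    have hlog := Real.tendsto_log_atTop.comp hRtop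
    obtain ⟨x, hx, hxlog⟩ := ((hlog.eventually_gt_atTop
      (4 * (1 + (L + 1) * K - (E y - 1 / 4 * Real.log (R y))))).and
        (Ioc_mem_nhdsGT hy.1)).exists
    have h1 := hanti hxlog (right_mem_Ioc.2 hy.1) hxlog.2
    have h2 := hEK x (hsy hxlog)
    simp only [Function.comp] at h1 hx
    linarith
  · obtain ⟨y, hy, hθy⟩ := hpick (hlθ.eventually_const_lt (by linarith : (1 / 4 : ℝ) < _))
    have hsy : Ioc 0 y ⊆ Ioc 0 z := Ioc_subset_Ioc_right hy.2
    have hanti := antitoneOn_Ioc_of_hasDerivAt_nonpos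
      (fun x hx => (hv x (hsub (hsy hx))).fun_sub
        (((hψ' x (hsub (hsy hx))).log (hψ x (hsub (hsy hx))).ne').const_mul
          (1 / (4 * (L + 1))))) (fun x hx => by
      have h1 := hψ x (hsub (hsy hx))
      have h2 := hs x (hsub (hsy hx))
      have h3 := hqR x (hsy hx)
      have h4 : 1 / 4 * (ψ x * R x) ≤ A x :=
        ((lt_div_iff₀ (hψR x (hsy hx))).1 (hθy x hx)).le
      have h5 : 1 / (4 * (L + 1)) * (ψ x * q x) ≤ A x := by
        refine le_trans ?_ h4
        rw [div_mul_eq_mul_div, div_le_iff₀ (by positivity)]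
        nlinarith
      have h6 : s x / ψ x ^ 2 * (1 / (4 * (L + 1)) * (ψ x * q x)) ≤ s x / ψ x ^ 2 * A x := by
        gcongr
      have h7 : s x / ψ x ^ 2 * (1 / (4 * (L + 1)) * (ψ x * q x)) =
          -(1 / (4 * (L + 1)) * (-(s x * q x) / ψ x)) := by field_simp
      rw [h7] at h6
      linarith)
    have hlog := Real.tendsto_log_atTop.comp hψtop
    obtain ⟨x, hx, hxlog⟩ := ((hlog.eventually_gt_atTop
      (4 * (L + 1) * (K - (v y - 1 / (4 * (L + 1)) * Real.log (ψ y))))).and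
        (Ioc_mem_nhdsGT hy.1)).exists
    have h1 := hanti hxlog (right_mem_Ioc.2 hy.1) hxlog.2
    have h2 := hK x (hsy hxlog)
    simp only [Function.comp] at h1 hx
    have h3 : K - (v y - 1 / (4 * (L + 1)) * Real.log (ψ y)) <
        1 / (4 * (L + 1)) * Real.log (ψ x) := by
      refine lt_of_eq_of_lt ?_
        (mul_lt_mul_of_pos_left hx (by positivity : 0 < 1 / (4 * (L + 1))))
      rw [← mul_assoc, one_div_mul_cancel (by positivity), one_mul]
    linarith

/-- Tonelli on the triangle `y < z`; it rewrites Feller's `I₀` as an iterated integral in the order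
of `scalePotential`. -/
theorem lintegral_triangle_swap {c : ℝ} {g h : ℝ → ENNReal}
    (hg : AEMeasurable g (volume.restrict (Ioo 0 c)))
    (hh : AEMeasurable h (volume.restrict (Ioo 0 c))) :
    ∫⁻ z in Ioo 0 c, (∫⁻ y in Ioo 0 z, g y) * h z =
      ∫⁻ y in Ioo 0 c, g y * ∫⁻ z in Ioo y c, h z := by
  have h1 : ∀ z ∈ Ioo 0 c, (∫⁻ y in Ioo 0 z, g y) * h z =
      ∫⁻ y in Ioo 0 c, {p : ℝ × ℝ | p.2 < p.1}.indicator (fun p => g p.2 * h p.1) (z, y) := by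
    intro z hz
    have e : Iio z ∩ Ioo 0 c = Ioo 0 z := by
      ext y; simp only [mem_inter_iff, mem_Iio, mem_Ioo]
      exact ⟨fun h => ⟨h.2.1, h.1⟩, fun h => ⟨h.2, h.1, h.2.trans hz.2⟩⟩
    rw [← lintegral_mul_const'' (h z) (hg.mono_measure
      (Measure.restrict_mono (Ioo_subset_Ioo_right hz.2.le) le_rfl)), ← e,
      ← Measure.restrict_restrict measurableSet_Iio, ← lintegral_indicator measurableSet_Iio]
    rfl
  have h2 : ∀ y ∈ Ioo 0 c, g y * ∫⁻ z in Ioo y c, h z =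
      ∫⁻ z in Ioo 0 c, {p : ℝ × ℝ | p.2 < p.1}.indicator (fun p => g p.2 * h p.1) (z, y) := by
    intro y hy
    have e : Ioi y ∩ Ioo 0 c = Ioo y c := by
      ext z; simp only [mem_inter_iff, mem_Ioi, mem_Ioo]
      exact ⟨fun h => ⟨h.1, h.2.2⟩, fun h => ⟨h.1, hy.1.trans h.1, h.2⟩⟩
    rw [← lintegral_const_mul'' (g y) (hh.mono_measure
      (Measure.restrict_mono (Ioo_subset_Ioo_left hy.1.le) le_rfl)), ← e,
      ← Measure.restrict_restrict measurableSet_Ioi, ← lintegral_indicator measurableSet_Ioi]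
    rfl
  rw [setLIntegral_congr_fun measurableSet_Ioo h1, setLIntegral_congr_fun measurableSet_Ioo h2]
  refine lintegral_lintegral_swap
    (f := fun z y => {p : ℝ × ℝ | p.2 < p.1}.indicator (fun p => g p.2 * h p.1) (z, y)) ?_
  exact (hg.comp_snd.mul hh.comp_fst).indicator (measurableSet_lt measurable_snd measurable_fst)

theorem lintegral_Ioo_ofReal {g : ℝ → ℝ} {L y z : ℝ} (hy : y ∈ Ioo 0 L) (hz : z ∈ Ioo 0 L)
    (hyz : y ≤ z) (hg : ContinuousOn g (Ioo 0 L)) (hpos : ∀ x ∈ Ioo 0 L, 0 ≤ g x) :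
    ∫⁻ x in Ioo y z, ENNReal.ofReal (g x) = ENNReal.ofReal (∫ x in y..z, g x) := by
  have hsub : Icc y z ⊆ Ioo 0 L := fun x hx => ⟨hy.1.trans_le hx.1, hx.2.trans_lt hz.2⟩
  rw [intervalIntegral.integral_of_le hyz, integral_Ioc_eq_integral_Ioo]
  refine (ofReal_integral_eq_lintegral_ofReal
    ((hg.mono hsub).integrableOn_Icc.mono_set Ioo_subset_Icc_self) ?_).symm
  filter_upwards [ae_restrict_mem measurableSet_Ioo] with x hx
  exact hpos x (hsub (Ioo_subset_Icc_self hx))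

/-! ### Consequences of Feller's integrals being infinite. -/

section Feller

variable {L c : ℝ} {μ σ : ℝ → ℝ}

theorem scaleDensity_pos (b σ : ℝ → ℝ) (c x : ℝ) : 0 < scaleDensity b σ c x := Real.exp_pos _

theorem speedDensity_eq (b σ : ℝ → ℝ) (c x : ℝ) :
    speedDensity b σ c x = 2 / (σ x ^ 2 * scaleDensity b σ c x) := by
  rw [speedDensity, scaleDensity, Real.exp_neg, ← div_eq_mul_inv, div_div_eq_mul_div,
    div_mul_eq_mul_div]

theorem hasDerivAt_scaleDensity (hμ : ContinuousOn μ (Ioo 0 L)) (hσ : ContinuousOn σ (Ioo 0 L))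
    (hσpos : ∀ x ∈ Ioo 0 L, 0 < σ x) (hc : c ∈ Ioo 0 L) {x : ℝ} (hx : x ∈ Ioo 0 L) :
    HasDerivAt (scaleDensity μ σ c) (-(2 * μ x / σ x ^ 2) * scaleDensity μ σ c x) x := by
  have hcont : ContinuousOn (fun y => 2 * μ y / σ y ^ 2) (Ioo 0 L) :=
    (continuousOn_const.mul hμ).div (hσ.pow 2) fun y hy => (pow_pos (hσpos y hy) 2).ne'
  have h := (hasDerivAt_integral_left_of_continuousOn_Ioo hcont hx hc).exp
  have e : scaleDensity μ σ c = fun x => Real.exp (∫ y in x..c, 2 * μ y / σ y ^ 2) := by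
    ext x; rw [scaleDensity, intervalIntegral.integral_symm, neg_neg]
  rw [e, mul_comm]
  exact h

theorem continuousOn_scaleDensity (hμ : ContinuousOn μ (Ioo 0 L)) (hσ : ContinuousOn σ (Ioo 0 L))
    (hσpos : ∀ x ∈ Ioo 0 L, 0 < σ x) (hc : c ∈ Ioo 0 L) :
    ContinuousOn (scaleDensity μ σ c) (Ioo 0 L) := fun _ hx =>
  (hasDerivAt_scaleDensity hμ hσ hσpos hc hx).continuousAt.continuousWithinAt

theorem continuousOn_speedDensity (hμ : ContinuousOn μ (Ioo 0 L)) (hσ : ContinuousOn σ (Ioo 0 L))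
    (hσpos : ∀ x ∈ Ioo 0 L, 0 < σ x) (hc : c ∈ Ioo 0 L) :
    ContinuousOn (speedDensity μ σ c) (Ioo 0 L) := by
  have e : speedDensity μ σ c = fun x => 2 / (σ x ^ 2 * scaleDensity μ σ c x) := by
    ext x; exact speedDensity_eq μ σ c x
  rw [e]
  exact continuousOn_speed hσ hσpos (fun x _ => scaleDensity_pos μ σ c x)
    (continuousOn_scaleDensity hμ hσ hσpos hc)

theorem speedDensity_pos (hσpos : ∀ x ∈ Ioo 0 L, 0 < σ x) {x : ℝ} (hx : x ∈ Ioo 0 L) :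
    0 < speedDensity μ σ c x := by
  have := hσpos x hx
  unfold speedDensity
  positivity

theorem aemeasurable_ofReal_of_continuousOn {g : ℝ → ℝ} {L c : ℝ} (hc : c ≤ L)
    (hg : ContinuousOn g (Ioo 0 L)) :
    AEMeasurable (fun x => ENNReal.ofReal (g x)) (volume.restrict (Ioo 0 c)) :=
  ((hg.mono (Ioo_subset_Ioo_right hc)).aemeasurable measurableSet_Ioo).ennreal_ofReal

/-- The potential is monotone near `0`, so it diverges unless bounded; a bound would make `I₀`, its
value at `0` after exchanging integrals, finite. -/
theorem tendsto_scalePotential_of_fellerI0 (hμ : ContinuousOn μ (Ioo 0 L))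
    (hσ : ContinuousOn σ (Ioo 0 L)) (hσpos : ∀ x ∈ Ioo 0 L, 0 < σ x) (hc : c ∈ Ioo 0 L)
    (hI : fellerI0 μ σ c = ⊤) :
    Tendsto (scalePotential σ (scaleDensity μ σ c) c) (𝓝[>] 0) atTop := by
  set s := scaleDensity μ σ c with hs
  have hspos : ∀ x ∈ Ioo 0 L, 0 < s x := fun x _ => scaleDensity_pos μ σ c x
  have hsc : ContinuousOn s (Ioo 0 L) := continuousOn_scaleDensity hμ hσ hσpos hc
  have hmc := continuousOn_speedDensity hμ hσ hσpos hc
  have hmpos : ∀ x ∈ Ioo 0 L, 0 ≤ speedDensity μ σ c x := fun x hx =>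
    (speedDensity_pos hσpos hx).le
  have hsub : Ioc 0 c ⊆ Ioo 0 L := fun x hx => ⟨hx.1, hx.2.trans_lt hc.2⟩
  have hM : ∀ y, ∫ r in y..c, 2 / (σ r ^ 2 * s r) = ∫ r in y..c, speedDensity μ σ c r := fun y => by
    simp only [speedDensity_eq, hs]
  have hM0 : ∀ y ∈ Ioc 0 c, 0 ≤ ∫ r in y..c, speedDensity μ σ c r := fun y hy =>
    intervalIntegral.integral_nonneg hy.2 fun r hr =>
      hmpos r ⟨hy.1.trans_le hr.1, hr.2.trans_lt hc.2⟩
  refine tendsto_atTop_of_antitoneOn_Ioc (z := c) (antitoneOn_Ioc_of_hasDerivAt_nonpos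
    (fun x hx => hasDerivAt_scalePotential hσ hσpos hspos hsc hc (hsub hx)) fun x hx => ?_) ?_
  · rw [hM]
    exact neg_nonpos.2 (mul_nonneg (hspos x (hsub hx)).le (hM0 x hx))
  rintro ⟨K, hK⟩
  -- The absolute value acts only to the right of `c`; it makes `g` nonnegative on all of `(0, L)`.
  set g : ℝ → ℝ := fun y => s y * |∫ r in y..c, speedDensity μ σ c r| with hg
  have hgc : ContinuousOn g (Ioo 0 L) := hsc.mul fun y hy =>
    (hasDerivAt_integral_left_of_continuousOn_Ioo hmc hy hc).continuousAt.continuousWithinAt.abs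
  have hlt : ∫⁻ y in Ioo 0 c, ENNReal.ofReal (g y) < ⊤ := by
    refine lintegral_lt_top_of_integral_le (K := K) hc hgc
      (fun x hx => mul_nonneg (hspos x hx).le (abs_nonneg _)) fun x hx => ?_
    refine le_of_eq_of_le ?_ (hK x hx)
    refine intervalIntegral.integral_congr fun y hy => ?_
    rw [uIcc_of_le hx.2] at hy
    simp only [hg]
    rw [hM, abs_of_nonneg (hM0 y ⟨hx.1.trans_le hy.1, hy.2⟩)]
  have heq : fellerI0 μ σ c = ∫⁻ y in Ioo 0 c, ENNReal.ofReal (g y) := by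
    unfold fellerI0 scaleMeasure
    rw [lintegral_triangle_swap (aemeasurable_ofReal_of_continuousOn hc.2.le hsc)
      (aemeasurable_ofReal_of_continuousOn hc.2.le hmc)]
    refine setLIntegral_congr_fun measurableSet_Ioo fun y hy => ?_
    have hy' := Ioo_subset_Ioc_self hy
    simp only [hg]
    rw [lintegral_Ioo_ofReal (hsub hy') hc hy.2.le hmc hmpos, abs_of_nonneg (hM0 y hy'),
      ENNReal.ofReal_mul (hspos y (hsub hy')).le]
  rw [heq] at hI
  exact hlt.ne hI

/-- If `0` is natural or exit, a decreasing positive function whose scale derivative stays away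
from zero is not integrable at `0` with respect to the speed measure. -/
theorem tendsto_integral_speed_of_fellerJ0 {z : ℝ} {ψ q : ℝ → ℝ} (hμ : ContinuousOn μ (Ioo 0 L))
    (hσ : ContinuousOn σ (Ioo 0 L)) (hσpos : ∀ x ∈ Ioo 0 L, 0 < σ x) (hc : c ∈ Ioo 0 L)
    (hz : z ∈ Ioo 0 c) (hψ : ∀ x ∈ Ioo 0 L, 0 < ψ x)
    (hψ' : ∀ x ∈ Ioo 0 L, HasDerivAt ψ (-(scaleDensity μ σ c x * q x)) x)
    (hqz : 0 < q z) (hq : ∀ x ∈ Ioc 0 z, q z ≤ q x) (hJ : fellerJ0 μ σ c = ⊤) :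
    Tendsto (fun y => ∫ r in y..z, speedDensity μ σ c r * ψ r) (𝓝[>] 0) atTop := by
  set s := scaleDensity μ σ c with hs
  set m := speedDensity μ σ c with hm
  have hspos : ∀ x ∈ Ioo 0 L, 0 < s x := fun x _ => scaleDensity_pos μ σ c x
  have hsc : ContinuousOn s (Ioo 0 L) := continuousOn_scaleDensity hμ hσ hσpos hc
  have hmc : ContinuousOn m (Ioo 0 L) := continuousOn_speedDensity hμ hσ hσpos hc
  have hmpos : ∀ x ∈ Ioo 0 L, 0 < m x := fun x hx => speedDensity_pos hσpos hx
  have hψc : ContinuousOn ψ (Ioo 0 L) := fun y hy => (hψ' y hy).continuousAt.continuousWithinAt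
  have hzL : z ∈ Ioo 0 L := ⟨hz.1, hz.2.trans hc.2⟩
  have hsub : Ioc 0 z ⊆ Ioo 0 L := fun x hx => ⟨hx.1, hx.2.trans_lt hzL.2⟩
  have hmψc := hmc.mul hψc
  have hmψpos : ∀ x ∈ Ioo 0 L, 0 ≤ m x * ψ x := fun x hx => (mul_pos (hmpos x hx) (hψ x hx)).le
  refine tendsto_atTop_of_antitoneOn_Ioc (z := z) (antitoneOn_Ioc_of_hasDerivAt_nonpos
    (fun x hx => hasDerivAt_integral_left_of_continuousOn_Ioo hmψc (hsub hx) hzL)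
      fun x hx => neg_nonpos.2 (hmψpos x (hsub hx))) ?_
  rintro ⟨K, hK⟩
  have hlt := lintegral_lt_top_of_integral_le hzL hmψc hmψpos hK
  set P := ∫ x in z..c, s x with hP
  have hP0 : 0 ≤ P := intervalIntegral.integral_nonneg hz.2.le fun x hx =>
    (hspos x ⟨hz.1.trans_le hx.1, hx.2.trans_lt hc.2⟩).le
  -- `1 / q z` gives `C q ≥ 1` on `(0, z]`, so `C ψ` grows towards `0` at least as fast as the scale
  -- integral up to `c`; `P / ψ z` gives the inequality at `z`. Thus `J₀` is at most `C ∫ m ψ` plus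
  -- a finite part over `[z, c)`.
  set C := 1 / q z + P / ψ z with hC
  have hC0 : 0 ≤ C := add_nonneg (by positivity) (div_nonneg hP0 (hψ z hzL).le)
  have hbound : ∀ y ∈ Ioc 0 z, ∫ x in y..c, s x ≤ C * ψ y := by
    intro y hy
    have := antitoneOn_Ioc_of_hasDerivAt_nonpos
      (fun x hx => ((hψ' x (hsub hx)).const_mul C).fun_sub
        (hasDerivAt_integral_left_of_continuousOn_Ioo hsc (hsub hx) hc)) (fun x hx => by
        have h1 : 1 ≤ C * q x := by
          have h2 : 1 / q z * q z ≤ C * q x := by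
            refine mul_le_mul ?_ (hq x hx) hqz.le hC0
            have := div_nonneg hP0 (hψ z hzL).le
            linarith
          rwa [one_div_mul_cancel hqz.ne'] at h2
        have := hspos x (hsub hx)
        nlinarith) hy ⟨hz.1, le_rfl⟩ hy.2
    have h3 : P ≤ C * ψ z := by
      rw [hC, add_mul, div_mul_cancel₀ _ (hψ z hzL).ne']
      have : 0 ≤ 1 / q z * ψ z := mul_nonneg (by positivity) (hψ z hzL).le
      linarith
    simp only at this
    linarith
  have hfin : fellerJ0 μ σ c < ⊤ := by
    unfold fellerJ0 scaleMeasure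
    have hsplit : Ioo 0 c = Ioo 0 z ∪ Ico z c := (Ioo_union_Ico_eq_Ioo hz.1 hz.2.le).symm
    rw [hsplit]
    refine (lintegral_union_le _ _ _).trans_lt (ENNReal.add_lt_top.2 ⟨?_, ?_⟩)
    · calc _ ≤ ∫⁻ y in Ioo 0 z, ENNReal.ofReal C * ENNReal.ofReal (m y * ψ y) := by
            refine setLIntegral_mono' measurableSet_Ioo fun y hy => ?_
            have hy' := Ioo_subset_Ioc_self hy
            rw [lintegral_Ioo_ofReal (hsub hy') hc (hy.2.trans hz.2).le hsc
              fun x hx => (hspos x hx).le, ← ENNReal.ofReal_mul hC0,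
              ← ENNReal.ofReal_mul (intervalIntegral.integral_nonneg (hy.2.trans hz.2).le
                fun x hx => (hspos x ⟨hy.1.trans_le hx.1, hx.2.trans_lt hc.2⟩).le)]
            refine ENNReal.ofReal_le_ofReal ?_
            have h1 := mul_le_mul_of_nonneg_right (hbound y hy') (hmpos y (hsub hy')).le
            calc _ ≤ C * ψ y * m y := h1
              _ = _ := by ring
        _ = ENNReal.ofReal C * ∫⁻ y in Ioo 0 z, ENNReal.ofReal (m y * ψ y) :=
            lintegral_const_mul' _ _ ENNReal.ofReal_ne_top
        _ < ⊤ := ENNReal.mul_lt_top ENNReal.ofReal_lt_top hlt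
    · have hIcc : Icc z c ⊆ Ioo 0 L := fun x hx => ⟨hz.1.trans_le hx.1, hx.2.trans_lt hc.2⟩
      calc _ ≤ ∫⁻ y in Ico z c, ENNReal.ofReal P * ENNReal.ofReal (m y) := by
            refine setLIntegral_mono' measurableSet_Ico fun y hy => ?_
            gcongr
            rw [hP, ← lintegral_Ioo_ofReal hzL hc hz.2.le hsc fun x hx => (hspos x hx).le]
            exact lintegral_mono_set (Ioo_subset_Ioo_left hy.1)
        _ = ENNReal.ofReal P * ∫⁻ y in Ico z c, ENNReal.ofReal (m y) :=
            lintegral_const_mul' _ _ ENNReal.ofReal_ne_top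
        _ < ⊤ := ENNReal.mul_lt_top ENNReal.ofReal_lt_top
            (Integrable.lintegral_lt_top
              ((hmc.mono hIcc).integrableOn_Icc.mono_set Ico_subset_Icc_self))
  exact hfin.ne hJ

end Feller

/-! ### The transform by `e^f` and the barrier at a natural endpoint. -/

section Transform

variable {L T : ℝ} {μ σ f g : ℝ → ℝ}

theorem hasDerivAt_of_contDiffOn_two (hf : ContDiffOn ℝ 2 f (Ioo 0 L)) {x : ℝ}
    (hx : x ∈ Ioo 0 L) : HasDerivAt f (deriv f x) x :=
  ((hf.differentiableOn (by norm_num)).differentiableAt (isOpen_Ioo.mem_nhds hx)).hasDerivAt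

theorem contDiffOn_one_deriv (hf : ContDiffOn ℝ 2 f (Ioo 0 L)) :
    ContDiffOn ℝ 1 (deriv f) (Ioo 0 L) := hf.deriv_of_isOpen isOpen_Ioo (by norm_num)

theorem hasDerivAt_deriv_of_contDiffOn_two (hf : ContDiffOn ℝ 2 f (Ioo 0 L)) {x : ℝ}
    (hx : x ∈ Ioo 0 L) : HasDerivAt (deriv f) (deriv (deriv f) x) x :=
  (((contDiffOn_one_deriv hf).differentiableOn (by norm_num)).differentiableAt
    (isOpen_Ioo.mem_nhds hx)).hasDerivAt

theorem continuousOn_deriv_deriv (hf : ContDiffOn ℝ 2 f (Ioo 0 L)) :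
    ContinuousOn (deriv (deriv f)) (Ioo 0 L) :=
  (contDiffOn_one_deriv hf).continuousOn_deriv_of_isOpen isOpen_Ioo (by norm_num)

/-- The transform by `e^f` removes the discounting term. -/
theorem HasGeneratorAt.exp_mul (hf : ContDiffOn ℝ 2 f (Ioo 0 L)) {k : ℝ → ℝ} {x ℓ : ℝ}
    (hx : x ∈ Ioo 0 L)
    (hode : 1 / 2 * σ x ^ 2 * (deriv f x) ^ 2 - generator μ σ f x - x = 0)
    (hk : HasGeneratorAt μ σ k x ℓ) :
    HasGeneratorAt (tiltedDrift μ σ f) σ (fun y => Real.exp (f y) * k y) x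
      (Real.exp (f x) * (ℓ - x * k x)) := by
  obtain ⟨D, d, h1, h2, h3⟩ := hk
  have hf1 := hasDerivAt_of_contDiffOn_two hf hx
  have hf2 := hasDerivAt_deriv_of_contDiffOn_two hf hx
  refine ⟨fun y => Real.exp (f y) * deriv f y * k y + Real.exp (f y) * D y, _, ?_,
    ((hf1.exp.fun_mul hf2).fun_mul h1.self_of_nhds).fun_add (hf1.exp.fun_mul h2), ?_⟩
  · filter_upwards [h1, isOpen_Ioo.mem_nhds hx] with y hy hy'
    exact (hasDerivAt_of_contDiffOn_two hf hy').exp.fun_mul hy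
  · unfold generator at hode
    rw [h3]
    simp only [tiltedDrift]
    linear_combination (Real.exp (f x) * k x) * hode

theorem HasParabolicAt.exp_mul (hf : ContDiffOn ℝ 2 f (Ioo 0 L)) {u : ℝ → ℝ → ℝ} {t x ℓ : ℝ}
    (hx : x ∈ Ioo 0 L)
    (hode : 1 / 2 * σ x ^ 2 * (deriv f x) ^ 2 - generator μ σ f x - x = 0)
    (hu : HasParabolicAt μ σ u t x ℓ) :
    HasParabolicAt (tiltedDrift μ σ f) σ (fun r y => Real.exp (f y) * u r y) t x
      (Real.exp (f x) * (ℓ - x * u t x)) := by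
  obtain ⟨ut, D, d, h0, h1, h2, h3⟩ := hu
  obtain ⟨D', d', h1', h2', h3'⟩ :=
    HasGeneratorAt.exp_mul hf hx hode (⟨D, d, h1, h2, rfl⟩ : HasGeneratorAt μ σ (u t) x _)
  refine ⟨_, D', d', h0.const_mul _, h1', h2', ?_⟩
  rw [← h3', h3]
  ring

/-- The function `e^{-x(T-t) + f(x)} g(x)` and the value of the operator on it. -/
theorem hasParabolicAt_payoff (hf : ContDiffOn ℝ 2 f (Ioo 0 L)) (hg : ContDiffOn ℝ 2 g (Ioo 0 L))
    {s x : ℝ} (hx : x ∈ Ioo 0 L) :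
    HasParabolicAt (tiltedDrift μ σ f) σ (fun r y => Real.exp (-y * (T - r) + f y) * g y) s x
      (source T μ σ f g s x) ∧
    source T μ σ f g s x = Real.exp (-x * (T - s) + f x) * (x * g x +
      tiltedDrift μ σ f x * ((deriv f x - (T - s)) * g x + deriv g x) +
      1 / 2 * σ x ^ 2 * ((deriv f x - (T - s)) ^ 2 * g x + 2 * (deriv f x - (T - s)) * deriv g x +
        deriv (deriv f) x * g x + deriv (deriv g) x)) := by
  have hlin : ∀ y, HasDerivAt (fun y : ℝ => -y * (T - s)) (-1 * (T - s)) y := fun y =>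
    (hasDerivAt_id y).neg.mul_const _
  have hexp : ∀ y ∈ Ioo 0 L, HasDerivAt (fun y => Real.exp (-y * (T - s) + f y))
      (Real.exp (-y * (T - s) + f y) * (-1 * (T - s) + deriv f y)) y := fun y hy =>
    ((hlin y).fun_add (hasDerivAt_of_contDiffOn_two hf hy)).exp
  have ht : HasDerivAt (fun r => Real.exp (-x * (T - r) + f x) * g x)
      (Real.exp (-x * (T - s) + f x) * (-x * (-1)) * g x) s :=
    ((((hasDerivAt_id s).const_sub T).const_mul (-x)).add_const (f x)).exp.mul_const (g x)
  have hd1 : ∀ᶠ y in 𝓝 x, HasDerivAt (fun y => Real.exp (-y * (T - s) + f y) * g y)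
      (Real.exp (-y * (T - s) + f y) * (-1 * (T - s) + deriv f y) * g y +
        Real.exp (-y * (T - s) + f y) * deriv g y) y := by
    filter_upwards [isOpen_Ioo.mem_nhds hx] with y hy
    exact (hexp y hy).fun_mul (hasDerivAt_of_contDiffOn_two hg hy)
  have hd2 := (((hexp x hx).fun_mul
    ((hasDerivAt_deriv_of_contDiffOn_two hf hx).const_add (-1 * (T - s)))).fun_mul
      (hasDerivAt_of_contDiffOn_two hg hx)).fun_add
        ((hexp x hx).fun_mul (hasDerivAt_deriv_of_contDiffOn_two hg hx))
  have hgen : HasGeneratorAt (tiltedDrift μ σ f) σ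
      (fun y => Real.exp (-y * (T - s) + f y) * g y) x _ := ⟨_, _, hd1, hd2, rfl⟩
  refine ⟨⟨_, _, _, ht, hd1, hd2, ?_⟩, ?_⟩
  · rw [source, hgen.generator_eq, ht.deriv]
  · rw [source, hgen.generator_eq, ht.deriv]
    ring

theorem continuousOn_source (hμ : ContinuousOn μ (Ioo 0 L)) (hσ : ContinuousOn σ (Ioo 0 L))
    (hf : ContDiffOn ℝ 2 f (Ioo 0 L)) (hg : ContDiffOn ℝ 2 g (Ioo 0 L)) :
    ContinuousOn (fun p : ℝ × ℝ => source T μ σ f g p.1 p.2) (univ ×ˢ Ioo 0 L) := by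
  have lift : ∀ {k : ℝ → ℝ}, ContinuousOn k (Ioo 0 L) →
      ContinuousOn (fun p : ℝ × ℝ => k p.2) (univ ×ˢ Ioo 0 L) := fun hk =>
    hk.comp continuousOn_snd fun p hp => hp.2
  have cμ := lift hμ
  have cσ := lift hσ
  have cf := lift hf.continuousOn
  have cg := lift hg.continuousOn
  have cf1 := lift (contDiffOn_one_deriv hf).continuousOn
  have cg1 := lift (contDiffOn_one_deriv hg).continuousOn
  have cf2 := lift (continuousOn_deriv_deriv hf)
  have cg2 := lift (continuousOn_deriv_deriv hg)
  have cτ : ContinuousOn (fun p : ℝ × ℝ => T - p.1) (univ ×ˢ Ioo 0 L) := by fun_prop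
  have cx : ContinuousOn (fun p : ℝ × ℝ => p.2) (univ ×ˢ Ioo 0 L) := by fun_prop
  have ca := cf1.sub cτ
  refine ContinuousOn.congr ?_ fun p hp => (hasParabolicAt_payoff hf hg hp.2).2
  refine ((cx.neg.mul cτ).add cf).rexp.mul (((cx.mul cg).add ?_).add ?_)
  · exact (cμ.sub ((cσ.pow 2).mul cf1)).mul ((ca.mul cg).add cg1)
  · exact (continuousOn_const.mul (cσ.pow 2)).mul (((((ca.pow 2).mul cg).add
      ((continuousOn_const.mul ca).mul cg1)).add (cf2.mul cg)).add cg2)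

/-- At a natural boundary there is a barrier which dominates both bounded functions and bounded
multiples of `e^f`. -/
theorem exists_isBarrier_of_zeroIsNatural (hL : 0 < L) (hμ : ContinuousOn μ (Ioo 0 L))
    (hσ : ContinuousOn σ (Ioo 0 L)) (hσpos : ∀ x ∈ Ioo 0 L, 0 < σ x)
    (hnat : ZeroIsNatural μ σ L) (hf : ContDiffOn ℝ 2 f (Ioo 0 L))
    (hode : ∀ x ∈ Ioo 0 L,
      1 / 2 * σ x ^ 2 * (deriv f x) ^ 2 - generator μ σ f x - x = 0) :
    ∃ Φ, IsBarrier L (tiltedDrift μ σ f) σ Φ ∧ Tendsto Φ (𝓝[>] 0) atTop ∧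
      Tendsto (fun x => Φ x * Real.exp (-f x)) (𝓝[>] 0) atTop := by
  set c := L / 2 with hcdef
  have hc : c ∈ Ioo 0 L := ⟨by positivity, by linarith⟩
  have hsubc : Ioc 0 c ⊆ Ioo 0 L := fun x hx => ⟨hx.1, hx.2.trans_lt hc.2⟩
  have hnear : Ioo 0 L ∈ 𝓝[>] (0 : ℝ) := Ioo_mem_nhdsGT hL
  set s := scaleDensity μ σ c with hs
  set m := speedDensity μ σ c with hm
  have hspos : ∀ x ∈ Ioo 0 L, 0 < s x := fun x _ => scaleDensity_pos μ σ c x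
  have hs' : ∀ x ∈ Ioo 0 L, HasDerivAt s (-(2 * μ x / σ x ^ 2) * s x) x :=
    fun x hx => hasDerivAt_scaleDensity hμ hσ hσpos hc hx
  set ψ : ℝ → ℝ := fun x => Real.exp (-f x) with hψ
  have hψpos : ∀ x ∈ Ioo 0 L, 0 < ψ x := fun x _ => Real.exp_pos _
  -- `q = -ψ' / s` is minus the scale derivative of `ψ`; the equation for `f` becomes `q' = -m x ψ`,
  -- so `q` is decreasing.
  set q : ℝ → ℝ := fun x => deriv f x * ψ x / s x with hq
  have hψ1 : ∀ x ∈ Ioo 0 L, HasDerivAt ψ (Real.exp (-f x) * -deriv f x) x := fun x hx =>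
    (hasDerivAt_of_contDiffOn_two hf hx).fun_neg.exp
  have hψ' : ∀ x ∈ Ioo 0 L, HasDerivAt ψ (-(s x * q x)) x := fun x hx => by
    refine (hψ1 x hx).congr_deriv ?_
    have := (hspos x hx).ne'
    simp only [hq, hψ]
    field_simp
  have hq' : ∀ x ∈ Ioo 0 L, HasDerivAt q (-(m x * (x * ψ x))) x := fun x hx => by
    have h := ((hasDerivAt_deriv_of_contDiffOn_two hf hx).fun_mul (hψ1 x hx)).fun_div (hs' x hx)
      (hspos x hx).ne'
    refine h.congr_deriv ?_
    have h1 := (hspos x hx).ne'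
    have h2 := (hσpos x hx).ne'
    have h3 := hode x hx
    unfold generator at h3
    have h4 : x = 1 / 2 * σ x ^ 2 * deriv f x ^ 2 -
      (μ x * deriv f x + 1 / 2 * σ x ^ 2 * deriv (deriv f) x) := by linarith
    have h5 : m x = 2 / (σ x ^ 2 * s x) := speedDensity_eq μ σ c x
    calc _ = -(2 / (σ x ^ 2 * s x) * ((1 / 2 * σ x ^ 2 * deriv f x ^ 2 -
          (μ x * deriv f x + 1 / 2 * σ x ^ 2 * deriv (deriv f) x)) * ψ x)) := by
          simp only [hψ]
          field_simp
          ring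
      _ = _ := by rw [← h4, h5]
  by_cases hbdd : ∃ K, ∀ x ∈ Ioc 0 c, ψ x ≤ K
  · obtain ⟨K, hK⟩ := hbdd
    have hK0 : 0 < K := (hψpos c hc).trans_le (hK c ⟨hc.1, le_rfl⟩)
    set v := scalePotential σ s c with hv
    have hvtop : Tendsto v (𝓝[>] 0) atTop :=
      tendsto_scalePotential_of_fellerI0 hμ hσ hσpos hc hnat.1
    have hv0 : ∀ x ∈ Ioo 0 L, 0 ≤ v x := fun x hx => scalePotential_nonneg hσpos hspos hc hx
    refine ⟨fun x => Real.exp (f x) * (1 + v x), ⟨fun x hx => ?_, fun x hx => ?_⟩, ?_, ?_⟩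
    · have := hv0 x hx
      positivity
    -- The tilted generator of `e^f (1 + v)` is `e^f (1 - x (1 + v))`, which is at most `e^f (1 +
    -- v)`.
    · refine ⟨_, ?_, HasGeneratorAt.exp_mul hf hx (hode x hx)
        ((hasGeneratorAt_scalePotential hσ hσpos hspos hs' hc hx).const_add 1)⟩
      have h1 := hv0 x hx
      have h2 := mul_nonneg hx.1.le (by linarith : 0 ≤ 1 + v x)
      refine mul_le_mul_of_nonneg_left ?_ (Real.exp_pos _).le
      linarith
    · refine tendsto_atTop_mono' _ ?_ (hvtop.const_mul_atTop (inv_pos.2 hK0))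
      filter_upwards [Ioc_mem_nhdsGT hc.1] with x hx
      have h1 : K⁻¹ ≤ Real.exp (f x) := by
        rw [inv_le_comm₀ hK0 (Real.exp_pos _), ← Real.exp_neg]
        exact hK x hx
      have h2 := hv0 x (hsubc hx)
      exact mul_le_mul h1 (by linarith) h2 (Real.exp_pos _).le
    · refine tendsto_atTop_mono' _ ?_ hvtop
      filter_upwards with x
      have : Real.exp (f x) * (1 + v x) * Real.exp (-f x) = 1 + v x := by
        rw [mul_right_comm, ← Real.exp_add, add_neg_cancel, Real.exp_zero, one_mul]
      rw [this]
      linarith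
  -- If `q ≤ 0` throughout, `ψ` would be increasing and hence bounded on `(0, c]`. Once `q z > 0`,
  -- monotonicity of `q` keeps it positive on `(0, z]`, so `ψ` decreases there.
  · obtain ⟨z, hz, hqz⟩ : ∃ z ∈ Ioo 0 c, 0 < q z := by
      by_contra! h
      refine hbdd ⟨ψ c, fun x hx => ?_⟩
      refine monotoneOn_of_hasDerivWithinAt_nonneg (D := Ioc 0 c) (convex_Ioc 0 c)
        (fun y hy => (hψ' y (hsubc hy)).continuousAt.continuousWithinAt)
        (fun y hy => (hψ' y (hsubc (interior_subset hy))).hasDerivWithinAt) (fun y hy => ?_) hx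
        ⟨hc.1, le_rfl⟩ hx.2
      rw [interior_Ioc] at hy
      have h1 := h y hy
      have h2 := hspos y (hsubc (Ioo_subset_Ioc_self hy))
      nlinarith
    have hzL : z ∈ Ioo 0 L := ⟨hz.1, hz.2.trans hc.2⟩
    have hsubz : Ioc 0 z ⊆ Ioo 0 L := fun x hx => ⟨hx.1, hx.2.trans_lt hzL.2⟩
    have hmpos : ∀ x ∈ Ioo 0 L, 0 < m x := fun x hx => speedDensity_pos hσpos hx
    have hqge : ∀ x ∈ Ioc 0 z, q z ≤ q x := fun x hx =>
      antitoneOn_Ioc_of_hasDerivAt_nonpos (fun y hy => hq' y (hsubz hy)) (fun y hy => by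
        have := mul_pos (hmpos y (hsubz hy)) (mul_pos hy.1 (hψpos y (hsubz hy)))
        linarith) hx ⟨hz.1, le_rfl⟩ hx.2
    have hψanti : AntitoneOn ψ (Ioc 0 z) :=
      antitoneOn_Ioc_of_hasDerivAt_nonpos (fun y hy => hψ' y (hsubz hy)) fun y hy => by
        have := mul_pos (hspos y (hsubz hy)) (hqz.trans_le (hqge y hy))
        linarith
    have hψtop : Tendsto ψ (𝓝[>] 0) atTop := by
      refine tendsto_atTop_of_antitoneOn_Ioc hψanti fun ⟨K, hK⟩ => hbdd ?_
      have hcc : ContinuousOn ψ (Icc z c) := fun y hy =>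
        (hψ' y ⟨hz.1.trans_le hy.1, hy.2.trans_lt hc.2⟩).continuousAt.continuousWithinAt
      obtain ⟨K', hK'⟩ := isCompact_Icc.exists_bound_of_continuousOn hcc
      refine ⟨max K K', fun x hx => ?_⟩
      rcases le_total x z with h | h
      · exact (hK x ⟨hx.1, h⟩).trans (le_max_left _ _)
      · exact ((le_abs_self _).trans (hK' x ⟨h, hx.2⟩)).trans (le_max_right _ _)
    -- `s e^{2f} = s / ψ²` is a scale density of the tilted diffusion, whose speed density is `m
    -- ψ²`.
    set S : ℝ → ℝ := fun x => s x * Real.exp (2 * f x) with hS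
    have hSpos : ∀ x ∈ Ioo 0 L, 0 < S x := fun x hx => mul_pos (hspos x hx) (Real.exp_pos _)
    have hS' : ∀ x ∈ Ioo 0 L,
        HasDerivAt S (-(2 * tiltedDrift μ σ f x / σ x ^ 2) * S x) x := fun x hx => by
      refine ((hs' x hx).fun_mul
        ((hasDerivAt_of_contDiffOn_two hf hx).const_mul 2).exp).congr_deriv ?_
      have := (hσpos x hx).ne'
      simp only [hS, tiltedDrift]
      field_simp
      ring
    have hSc : ContinuousOn S (Ioo 0 L) := fun y hy =>
      (hS' y hy).continuousAt.continuousWithinAt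
    set v := scalePotential σ S z with hv
    have hv0 : ∀ x ∈ Ioo 0 L, 0 ≤ v x := fun x hx => scalePotential_nonneg hσpos hSpos hzL hx
    have hψsq : ∀ x, ψ x ^ 2 = (Real.exp (2 * f x))⁻¹ := fun x => by
      rw [hψ, ← Real.exp_nat_mul, ← Real.exp_neg]
      congr 1
      push_cast
      ring
    have hvtop : Tendsto v (𝓝[>] 0) atTop := by
      refine tendsto_atTop_of_transformed_potential hzL hspos hmpos hψpos
        (continuousOn_speedDensity hμ hσ hσpos hc) hψ' hq' hqz hψtop
        (tendsto_integral_speed_of_fellerJ0 hμ hσ hσpos hc hz hψpos hψ' hqz hqge hnat.2)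
        fun x hx => ?_
      have e1 : s x / ψ x ^ 2 = S x := by rw [hψsq, div_inv_eq_mul]
      have e2 : ∀ r, m r * ψ r ^ 2 = 2 / (σ r ^ 2 * S r) := fun r => by
        rw [hψsq, hm, speedDensity_eq, ← div_eq_mul_inv, div_div, mul_assoc]
      simp only [e1, e2]
      exact hasDerivAt_scalePotential hσ hσpos hSpos hSc hzL hx
    refine ⟨fun x => 1 + v x, ⟨fun x hx => by linarith [hv0 x hx], fun x hx => ⟨1, ?_,
      (hasGeneratorAt_scalePotential hσ hσpos hSpos hS' hzL hx).const_add 1⟩⟩,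
      tendsto_atTop_add_const_left _ _ hvtop, ?_⟩
    · linarith [hv0 x hx]
    · refine tendsto_atTop_mono' _ ?_ hψtop
      filter_upwards [hnear] with x hx
      exact le_mul_of_one_le_left (hψpos x hx).le (by linarith [hv0 x hx])

end Transform

/-! ### The transformed difference `w` and its boundary behaviour. -/

/-- The transformed difference between the price and the discounted payoff. -/
def excess (T : ℝ) (f g : ℝ → ℝ) (u : ℝ → ℝ → ℝ) (t x : ℝ) : ℝ :=
  Real.exp (f x) * u t x - Real.exp (-x * (T - t) + f x) * g x

section Excess

variable {L T : ℝ} {μ σ f g : ℝ → ℝ} {u : ℝ → ℝ → ℝ}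

theorem excess_eq (T : ℝ) (f g : ℝ → ℝ) (u : ℝ → ℝ → ℝ) (t x : ℝ) :
    excess T f g u t x = Real.exp (f x) * (u t x - Real.exp (-x * (T - t)) * g x) := by
  rw [excess, Real.exp_add]; ring

theorem continuousOn_excess (hT : 0 < T) (hu : SolvesPricingProblem L T μ σ g u) {D : Set ℝ}
    (hD : D ⊆ Icc 0 L) (hf : ContinuousOn f D) :
    ContinuousOn (fun p : ℝ × ℝ => excess T f g u p.1 p.2) (Icc 0 T ×ˢ D) := by
  have hTm : T ∈ Icc 0 T := right_mem_Icc.2 hT.le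
  have cf : ContinuousOn (fun p : ℝ × ℝ => f p.2) (Icc 0 T ×ˢ D) :=
    hf.comp continuousOn_snd fun p hp => hp.2
  have cu : ContinuousOn (fun p : ℝ × ℝ => u p.1 p.2) (Icc 0 T ×ˢ D) :=
    hu.continuousOn.mono (prod_mono Subset.rfl hD)
  -- Continuity of `g` up to the endpoints is read off from `u T`.
  have cg : ContinuousOn (fun p : ℝ × ℝ => u T p.2) (Icc 0 T ×ˢ D) :=
    hu.continuousOn.comp (f := fun p : ℝ × ℝ => (T, p.2)) (by fun_prop)
      fun p hp => ⟨hTm, hD hp.2⟩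
  have ce : ContinuousOn (fun p : ℝ × ℝ => Real.exp (-p.2 * (T - p.1))) (Icc 0 T ×ˢ D) := by
    fun_prop
  refine (cf.rexp.mul (cu.sub (ce.mul cg))).congr fun p hp => ?_
  simp only [Pi.mul_apply, Pi.sub_apply]
  rw [excess_eq, hu.terminal p.2 (hD hp.2)]

theorem excess_terminal (hu : SolvesPricingProblem L T μ σ g u) {x : ℝ} (hx : x ∈ Icc 0 L) :
    excess T f g u T x = 0 := by
  rw [excess_eq, hu.terminal x hx]; simp

theorem excess_right (hu : SolvesPricingProblem L T μ σ g u) {t : ℝ} (ht : t ∈ Icc 0 T) :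
    excess T f g u t L = 0 := by
  rw [excess_eq, hu.bc_right t ht]; simp

theorem excess_zero (hu : SolvesPricingProblem L T μ σ g u)
    (hacc : ZeroIsRegular μ σ L ∨ ZeroIsExit μ σ L) {t : ℝ} (ht : t ∈ Icc 0 T) :
    excess T f g u t 0 = 0 := by
  rw [excess_eq, hu.bc_zero hacc t ht]; simp

theorem hasParabolicAt_excess (hu : SolvesPricingProblem L T μ σ g u)
    (hf : ContDiffOn ℝ 2 f (Ioo 0 L)) (hg : ContDiffOn ℝ 2 g (Ioo 0 L))
    (hode : ∀ x ∈ Ioo 0 L,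
      1 / 2 * σ x ^ 2 * (deriv f x) ^ 2 - generator μ σ f x - x = 0)
    {t x : ℝ} (ht : t ∈ Ioo 0 T) (hx : x ∈ Ioo 0 L) :
    HasParabolicAt (tiltedDrift μ σ f) σ (excess T f g u) t x (-source T μ σ f g t x) := by
  have h := (HasParabolicAt.exp_mul hf hx (hode x hx) (hu.solves.hasParabolicAt ht hx)).sub
    (hasParabolicAt_payoff (μ := μ) (σ := σ) (T := T) (s := t) hf hg hx).1
  rw [sub_self, mul_zero, zero_sub] at h
  exact h

/-- Where `f` is finite at an endpoint, `w` is continuous there with value zero. At a natural `0`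
only `|w| ≤ 2C e^f` is available, and this is beaten by `Φ` because `Φ e^{-f} → ∞`. -/
theorem negligible_excess {Φ : ℝ → ℝ} (hL : 0 < L) (hT : 0 < T)
    (hu : SolvesPricingProblem L T μ σ g u) (hfL : ContinuousOn f (Ioc 0 L))
    (hf0 : ZeroIsRegular μ σ L ∨ ZeroIsExit μ σ L → ContinuousOn f (Icc 0 L))
    (hΦ : ∀ x ∈ Ioo 0 L, 0 ≤ Φ x)
    (hacc : (ZeroIsRegular μ σ L ∨ ZeroIsExit μ σ L) ∨
      Tendsto (fun x => Φ x * Real.exp (-f x)) (𝓝[>] 0) atTop) :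
    NegligibleAtBoundary L T Φ (excess T f g u) := by
  intro κ hκ
  have hsub : Icc (L / 2) L ⊆ Ioc 0 L := fun x hx => ⟨(half_pos hL).trans_le hx.1, hx.2⟩
  obtain ⟨δ, hδ, H⟩ := exists_small_near_edge
    (continuousOn_excess hT hu (hsub.trans Ioc_subset_Icc_self) (hfL.mono hsub))
    (⟨by linarith, le_rfl⟩ : L ∈ Icc (L / 2) L) (fun t ht => excess_right hu ht) hκ
  have hright : ∀ t ∈ Icc 0 T, ∀ x ∈ Ioo 0 L, L - min δ (L / 2) < x →
      |excess T f g u t x| ≤ κ := fun t ht x hx h => by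
    refine H t ht x ⟨?_, hx.2.le⟩ ?_
    · linarith [min_le_right δ (L / 2)]
    · rw [abs_lt]
      constructor <;> linarith [hx.2, min_le_left δ (L / 2)]
  obtain ⟨δ', hδ', hleft⟩ : ∃ δ' > 0, ∀ t ∈ Icc 0 T, ∀ x ∈ Ioo 0 L, x < δ' →
      |excess T f g u t x| ≤ κ * (1 + Φ x) := by
    rcases hacc with hacc | hacc
    · obtain ⟨δ', hδ', H'⟩ := exists_small_near_edge
        (continuousOn_excess hT hu Subset.rfl (hf0 hacc)) (left_mem_Icc.2 hL.le)
        (fun t ht => excess_zero hu hacc ht) hκ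
      refine ⟨δ', hδ', fun t ht x hx h => ?_⟩
      refine (H' t ht x (Ioo_subset_Icc_self hx) (by rwa [sub_zero, abs_of_pos hx.1])).trans ?_
      exact le_mul_of_one_le_right hκ.le (by linarith [hΦ x hx])
    · obtain ⟨C, hC, HC⟩ := exists_abs_le_of_continuousOn hu.continuousOn
      obtain ⟨δ', hδ', H'⟩ := mem_nhdsGT_iff_exists_Ioo_subset.1
        (hacc.eventually_ge_atTop (2 * C / κ))
      refine ⟨δ', hδ', fun t ht x hx h => ?_⟩
      have h1 : 2 * C / κ ≤ Φ x * Real.exp (-f x) := H' ⟨hx.1, h⟩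
      rw [div_le_iff₀ hκ] at h1
      have hx' := Ioo_subset_Icc_self hx
      have h2 : |u t x - Real.exp (-x * (T - t)) * g x| ≤ 2 * C := by
        have a1 := HC t ht x hx'
        have a2 := HC T (right_mem_Icc.2 hT.le) x hx'
        rw [hu.terminal x hx'] at a2
        have a3 : Real.exp (-x * (T - t)) ≤ 1 := by
          rw [Real.exp_le_one_iff]
          have := mul_nonneg hx.1.le (sub_nonneg.2 ht.2)
          linarith
        have a4 : |Real.exp (-x * (T - t)) * g x| ≤ C := by
          rw [abs_mul, abs_of_pos (Real.exp_pos _)]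
          exact (mul_le_of_le_one_left (abs_nonneg _) a3).trans a2
        have := abs_sub (u t x) (Real.exp (-x * (T - t)) * g x)
        linarith
      rw [excess_eq, abs_mul, abs_of_pos (Real.exp_pos _)]
      calc _ ≤ Real.exp (f x) * (Φ x * Real.exp (-f x) * κ) := by
            gcongr; exact h2.trans h1
        _ = κ * Φ x * (Real.exp (f x) * Real.exp (-f x)) := by ring
        _ = κ * Φ x := by rw [← Real.exp_add, add_neg_cancel, Real.exp_zero, mul_one]
        _ ≤ κ * (1 + Φ x) := by gcongr; linarith
  refine ⟨min (min δ (L / 2)) δ', lt_min (lt_min hδ (half_pos hL)) hδ',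
    fun t ht x hx => ⟨fun h => ?_, fun h => ?_⟩⟩
  · exact hleft t ht x hx (h.trans_le (min_le_right _ _))
  · exact hright t ht x hx (by linarith [min_le_left (min δ (L / 2)) δ'])

end Excess

theorem integral_eq_zero_of_kernel_eq_zero {L T t x : ℝ} {Γ : ℝ → ℝ → ℝ → ℝ → ℝ} {F : ℝ → ℝ → ℝ}
    (hL : 0 < L) (htT : t ≤ T) (h : ∀ s ∈ Ioc t T, ∀ y ∈ Ioo 0 L, Γ t x s y = 0) :
    ∫ s in t..T, ∫ y in 0..L, Γ t x s y * F s y = 0 := by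
  rw [intervalIntegral.integral_of_le htT]
  refine setIntegral_eq_zero_of_forall_eq_zero fun s hs => ?_
  rw [intervalIntegral.integral_of_le hL.le, integral_Ioc_eq_integral_Ioo]
  exact setIntegral_eq_zero_of_forall_eq_zero fun y hy => by rw [h s hs y hy, zero_mul]

end ShortRate

end

/-! ### Assembly. -/

theorem mainTheorem1 (L T : ℝ) (hL : 0 < L) (hT : 0 < T)
    (μ σ : ℝ → ℝ) (hμ : ContinuousOn μ (Set.Ioo 0 L)) (hσ : ContinuousOn σ (Set.Ioo 0 L))
    (hσpos : ∀ x ∈ Set.Ioo 0 L, 0 < σ x)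
    (hzero : ShortRate.ZeroIsRegular μ σ L ∨ ShortRate.ZeroIsExit μ σ L ∨
      ShortRate.ZeroIsNatural μ σ L)
    (hright : ShortRate.RightIsRegular μ σ L)
    -- the payoff and the price
    (g : ℝ → ℝ) (hg : ContDiffOn ℝ 2 g (Set.Ioo 0 L))
    (u : ℝ → ℝ → ℝ) (hu : ShortRate.SolvesPricingProblem L T μ σ g u)
    -- the solution of the nonlinear ODE, finite at the accessible endpoints
    (f : ℝ → ℝ) (hf : ContDiffOn ℝ 2 f (Set.Ioo 0 L))
    (hfL : ContinuousOn f (Set.Ioc 0 L))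
    (hf0 : ShortRate.ZeroIsRegular μ σ L ∨ ShortRate.ZeroIsExit μ σ L →
      ContinuousOn f (Set.Icc 0 L))
    (hode : ∀ x ∈ Set.Ioo 0 L,
      1 / 2 * σ x ^ 2 * (deriv f x) ^ 2 - ShortRate.generator μ σ f x - x = 0)
    -- the fundamental solution
    (Γ : ℝ → ℝ → ℝ → ℝ → ℝ)
    (hΓ : ShortRate.IsFundamentalSolution
      (ShortRate.ZeroIsRegular μ σ L ∨ ShortRate.ZeroIsExit μ σ L) L T
      (ShortRate.tiltedDrift μ σ f) σ Γ)
    (t : ℝ) (ht : t ∈ Set.Icc 0 T) (x : ℝ) (hx : x ∈ Set.Icc 0 L)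
    (hx0 : x = 0 → ShortRate.ZeroIsRegular μ σ L ∨ ShortRate.ZeroIsExit μ σ L)
    -- the double integral converges absolutely
    (hinteg : MeasureTheory.IntegrableOn
      (fun p : ℝ × ℝ => Γ t x p.1 p.2 * ShortRate.source T μ σ f g p.1 p.2)
      (Set.Ioo t T ×ˢ Set.Ioo 0 L)) :
    u t x = Real.exp (-x * (T - t)) * g x +
      Real.exp (-f x) * ∫ s in t..T, ∫ ξ in 0..L,
        Γ t x s ξ * ShortRate.source T μ σ f g s ξ := by
  have hxm : ∀ s, s ∈ Set.Ioc t T → s ∈ Set.Ioc 0 T ∧ t ∈ Set.Ico 0 s := fun s hs =>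
    ⟨⟨ht.1.trans_lt hs.1, hs.2⟩, ht.1, hs.1⟩
  -- At an endpoint with a Dirichlet condition the kernel vanishes, and the formula reduces to the
  -- boundary value of `u`.
  rcases eq_or_ne x L with rfl | hxL
  · rw [ShortRate.integral_eq_zero_of_kernel_eq_zero hL ht.2 fun s hs y hy =>
      hΓ.bc_right s (hxm s hs).1 y hy t (hxm s hs).2, mul_zero, add_zero, hu.bc_right t ht]
  rcases eq_or_ne x 0 with rfl | hx0'
  · rw [ShortRate.integral_eq_zero_of_kernel_eq_zero hL ht.2 fun s hs y hy =>
      hΓ.bc_zero (hx0 rfl) s (hxm s hs).1 y hy t (hxm s hs).2, mul_zero, add_zero,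
      hu.bc_zero (hx0 rfl) t ht]
    simp
  have hxI : x ∈ Set.Ioo 0 L := ⟨lt_of_le_of_ne hx.1 hx0'.symm, lt_of_le_of_ne hx.2 hxL⟩
  rcases eq_or_ne t T with rfl | htT
  · rw [intervalIntegral.integral_same, hu.terminal x hx]
    simp
  -- The first growth condition controls evolutions of test functions, the second the excess;
  -- neither is needed when `0` is accessible.
  obtain ⟨Φ, hΦ, hΦ1, hΦ2⟩ : ∃ Φ, ShortRate.IsBarrier L (ShortRate.tiltedDrift μ σ f) σ Φ ∧
      ((ShortRate.ZeroIsRegular μ σ L ∨ ShortRate.ZeroIsExit μ σ L) ∨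
        Filter.Tendsto Φ (nhdsWithin 0 (Set.Ioi 0)) Filter.atTop) ∧
      ((ShortRate.ZeroIsRegular μ σ L ∨ ShortRate.ZeroIsExit μ σ L) ∨
        Filter.Tendsto (fun x => Φ x * Real.exp (-f x)) (nhdsWithin 0 (Set.Ioi 0))
          Filter.atTop) := by
    by_cases hacc : ShortRate.ZeroIsRegular μ σ L ∨ ShortRate.ZeroIsExit μ σ L
    · exact ⟨_, ShortRate.isBarrier_zero L _ σ, Or.inl hacc, Or.inl hacc⟩
    · have hnat : ShortRate.ZeroIsNatural μ σ L := by tauto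
      obtain ⟨Φ, h1, h2, h3⟩ :=
        ShortRate.exists_isBarrier_of_zeroIsNatural hL hμ hσ hσpos hnat hf hode
      exact ⟨Φ, h1, Or.inr h2, Or.inr h3⟩
  have key := hΓ.eq_integral hL hΦ hΦ1
    (ShortRate.continuousOn_excess hT hu Set.Ioo_subset_Icc_self hf.continuousOn)
    (fun s hs y hy => ShortRate.hasParabolicAt_excess hu hf hg hode hs hy)
    (fun y hy => ShortRate.excess_terminal hu (Set.Ioo_subset_Icc_self hy))
    (ShortRate.negligible_excess hL hT hu hfL hf0 hΦ.nonneg hΦ2)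
    (ShortRate.continuousOn_source hμ hσ hf hg) ⟨ht.1, lt_of_le_of_ne ht.2 htT⟩ hxI hinteg
  rw [← key, ShortRate.excess_eq, ← mul_assoc, ← Real.exp_add, neg_add_cancel, Real.exp_zero,
    one_mul, add_sub_cancel]
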